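/- **Theorem (Consistency of MPCA$_{op}$).** Fix integers $p_0,q_0\ge 1$ and put $r_0=\min(p_0,q_0)$. For each $(T,p,q)$ (along any family in which $T,p,q\to\infty$) suppose that the observed random $p\times q$ matrices satisfy $$X_t=RF_tC^{\top}+E_t,\qquad t=1,\dots,T,$$ where $X_1,\dots,X_T$ are independent, $R$ ($p\times p_0$) and $C$ ($q\times q_0$) are deterministic, and the following hold. (A) Almost surely, $$\begin{pmatrix}\mathrm{Vec}(F_t)\\ \mathrm{Vec}(E_t)\end{pmatrix}=r_t\begin{pmatrix}\Sigma_2^{1/2}\otimes\Sigma_1^{1/2}&0\\0&\Omega_2^{1/2}\otimes\Omega_1^{1/2}\end{pmatrix}\frac{Z_t}{\|Z_t\|_2},$$ where $Z_t$ is a standard Gaussian vector in $\mathbb R^{p_0q_0+pq}$, $r_t>0$ is a random variable independent of $Z_t$, the matrices $\Sigma_1$ ($p_0\times p_0$), $\Sigma_2$ ($q_0\times q_0$), $\Omega_1$ ($p\times p$), $\Omega_2$ ($q\times q$) are symmetric positive definite, and $(pq)^{-1/2}r_t=O_p(1)$ for each fixed $t$. (B) $R^{\top}R/p=I_{p_0}$,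 $C^{\top}C/q=I_{q_0}$, and for some constants $c_1,C_1>0$ not depending on $(T,p,q)$ all eigenvalues of $\Sigma_1$ and $\Sigma_2$ lie in $[c_1,C_1]$, for all large $T,p,q$. (C) For some constants $c_2,C_2>0$ not depending on $(T,p,q)$ all eigenvalues of $\Omega_1$ and $\Omega_2$ lie in $[c_2,C_2]$, for all large $T,p,q$. No moment conditions are placed on $r_t$, $F_t$ or $E_t$. The MPCA$_{op}$ estimators are defined as follows. Let the columns of $\hat R_t$ and $\hat C_t$ be orthonormal eigenvectors belonging to the $r_0$ largest eigenvalues (counted with multiplicity) of $X_tX_t^{\top}$ and $X_t^{\top}X_t$. Then the columns of $\hat R_{op}/\sqrt p$ and $\hat C_{op}/\sqrt q$ are orthonormal eigenvectors belonging to the $p_0$, respectively $q_0$, largest eigenvalues of $\frac1T\sum_{t}\hat R_t\hat R_t^{\top}$ and $\frac1T\sum_t\hat C_t\hat C_t^{\top}$. Wherever eigenvectors are not unique, any choice is allowed. Then there exist (data-dependent) orthogonal matrices $H_R$ of size $p_0\times p_0$ and $H_C$ of size $q_0\times q_0$, measurable whenever $\hat R_{op}$, respectively $\hat C_{op}$,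 is, such that, as $T,p,q\to\infty$, $$\frac{\|\hat R_{op}-RH_R\|_F^2}{p}=O_p\!\left(T^{-1}+p^{-1/2}+q^{-1/2}\right),\qquad \frac{\|\hat C_{op}-CH_C\|_F^2}{q}=O_p\!\left(T^{-1}+p^{-1/2}+q^{-1/2}\right).$$ -/

import Mathlib

open MeasureTheory ProbabilityTheory Filter Matrix
open scoped Matrix Kronecker MatrixOrder

noncomputable section

/-- The Frobenius norm of a real matrix. -/
def frobeniusNorm {m n : Type*} [Fintype m] [Fintype n] (A : Matrix m n ℝ) : ℝ :=
  letI := Matrix.frobeniusNormedAddCommGroup (m := m) (n := n) (α := ℝ)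
  ‖A‖

/-- All eigenvalues of the symmetric matrix `A` lie in `[c, C]`; equivalently, the smallest one
is at least `c` and the largest one is at most `C`. -/
def EigenvaluesBetween {n : ℕ} (A : Matrix (Fin n) (Fin n) ℝ) (c C : ℝ) : Prop :=
  ∃ hA : A.IsHermitian, ∀ j, c ≤ hA.eigenvalues j ∧ hA.eigenvalues j ≤ C

/-- Stochastic boundedness `Y = O_P(a)` along the filter `l`, where `Y i` is a real function on
the probability space `(Ω i, P i)` and `a i` is a deterministic rate. If the functions are not
measurable, the (outer) probability of the exceptional event is meant. -/
def IsBigOInProb {ι : Type*} (l : Filter ι) {Ω : ι → Type*} [∀ i, MeasurableSpace (Ω i)]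
    (P : ∀ i, Measure (Ω i)) (Y : ∀ i, Ω i → ℝ) (a : ι → ℝ) : Prop :=
  ∀ ε : ℝ, 0 < ε → ∃ K : ℝ, 0 < K ∧
    ∀ᶠ i in l, P i {ω | K * |a i| < |Y i ω|} ≤ ENNReal.ofReal ε

/-- The joint matrix elliptical factor model `X_t = R F_t Cᵀ + E_t`, `t = 1, …, T`, with
`p × q` observations `X_t` and `p₀ × q₀` factors `F_t`, on the probability space `(Ω, P)`. -/
structure MatrixEllipticalFactorModel {Ω : Type*} [MeasurableSpace Ω] (P : Measure Ω)
    (p q p₀ q₀ T : ℕ) where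
  /-- row loadings -/
  R : Matrix (Fin p) (Fin p₀) ℝ
  /-- column loadings -/
  C : Matrix (Fin q) (Fin q₀) ℝ
  /-- row transformation matrix of the factors -/
  Sig₁ : Matrix (Fin p₀) (Fin p₀) ℝ
  /-- column transformation matrix of the factors -/
  Sig₂ : Matrix (Fin q₀) (Fin q₀) ℝ
  /-- row transformation matrix of the errors -/
  Om₁ : Matrix (Fin p) (Fin p) ℝ
  /-- column transformation matrix of the errors -/
  Om₂ : Matrix (Fin q) (Fin q) ℝ
  /-- factor matrices -/
  F : Fin T → Ω → Matrix (Fin p₀) (Fin q₀) ℝ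
  /-- error matrices -/
  E : Fin T → Ω → Matrix (Fin p) (Fin q) ℝ
  /-- radial variables -/
  r : Fin T → Ω → ℝ
  /-- Gaussian vectors of dimension `p₀ q₀ + p q`; the coordinates are indexed as those of
  `Vec F_t` followed by those of `Vec E_t` -/
  Z : Fin T → Ω → EuclideanSpace ℝ ((Fin q₀ × Fin p₀) ⊕ (Fin q × Fin p))
  posDef_Sig₁ : Sig₁.PosDef
  posDef_Sig₂ : Sig₂.PosDef
  posDef_Om₁ : Om₁.PosDef
  posDef_Om₂ : Om₂.PosDef
  aemeasurable_r : ∀ t, AEMeasurable (r t) P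
  r_pos : ∀ t, ∀ᵐ ω ∂P, 0 < r t ω
  hasLaw_Z : ∀ t, HasLaw (Z t) (stdGaussian _) P
  indep_r_Z : ∀ t, IndepFun (r t) (Z t) P
  /-- `(Vec F_t, Vec E_t) = r_t · diag(Σ₂^{1/2} ⊗ Σ₁^{1/2}, Ω₂^{1/2} ⊗ Ω₁^{1/2}) Z_t / ‖Z_t‖₂` -/
  elliptical : ∀ t, ∀ᵐ ω ∂P,
    Sum.elim (vec (F t ω)) (vec (E t ω)) =
      r t ω • (fromBlocks (CFC.sqrt Sig₂ ⊗ₖ CFC.sqrt Sig₁) 0 0 (CFC.sqrt Om₂ ⊗ₖ CFC.sqrt Om₁) *ᵥ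
        (‖Z t ω‖⁻¹ • WithLp.ofLp (Z t ω)))
  /-- the observed matrices are independent over time -/
  indep_obs : iIndepFun (fun t ω => vec (R * F t ω * Cᵀ + E t ω)) P

namespace MatrixEllipticalFactorModel

variable {Ω : Type*} [MeasurableSpace Ω] {P : Measure Ω} {p q p₀ q₀ T : ℕ}

/-- The observations `X_t = R F_t Cᵀ + E_t`. -/
def X (M : MatrixEllipticalFactorModel P p q p₀ q₀ T) (t : Fin T) (ω : Ω) :
    Matrix (Fin p) (Fin q) ℝ :=
  M.R * M.F t ω * M.Cᵀ + M.E t ω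

/-- Strong factor conditions with constants `c, K`. -/
def StrongFactors (M : MatrixEllipticalFactorModel P p q p₀ q₀ T) (c K : ℝ) : Prop :=
  (p : ℝ)⁻¹ • (M.Rᵀ * M.R) = 1 ∧ (q : ℝ)⁻¹ • (M.Cᵀ * M.C) = 1 ∧
    EigenvaluesBetween M.Sig₁ c K ∧ EigenvaluesBetween M.Sig₂ c K

/-- Regular noise conditions with constants `c, K`. -/
def RegularNoise (M : MatrixEllipticalFactorModel P p q p₀ q₀ T) (c K : ℝ) : Prop :=
  EigenvaluesBetween M.Om₁ c K ∧ EigenvaluesBetween M.Om₂ c K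

/-- The radial variable `r_t` scaled by `(pq)^{-1/2}` (and `0` if there is no time point `t`). -/
def scaledRadius (M : MatrixEllipticalFactorModel P p q p₀ q₀ T) (t : ℕ) (ω : Ω) : ℝ :=
  if h : t < T then ((p : ℝ) * q) ^ (-(1 / 2) : ℝ) * M.r ⟨t, h⟩ ω else 0

end MatrixEllipticalFactorModel

/-- The columns of `U` are leading `k` orthonormal eigenvectors of the symmetric matrix `A`: they
are the first `k` columns in some spectral decomposition `A = V diag(d) Vᵀ` with `V` orthogonal
and `d` non-increasing. -/
def IsLeadingEigenvectors {n k : ℕ} (A : Matrix (Fin n) (Fin n) ℝ)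
    (U : Matrix (Fin n) (Fin k) ℝ) : Prop :=
  ∃ (hk : k ≤ n) (V : Matrix (Fin n) (Fin n) ℝ) (d : Fin n → ℝ),
    V ∈ Matrix.orthogonalGroup (Fin n) ℝ ∧ Antitone d ∧ A = V * diagonal d * Vᵀ ∧
      U = V.submatrix id (Fin.castLE hk)

/-- `Rhat` and `Chat` are an output of the algorithm MPCA_op with factor numbers `p₀, q₀` on the
data `X_1, …, X_T`: with `r₀ = min p₀ q₀`, `Rt t` and `Ct t` are leading `r₀` eigenvectors of
`X_t X_tᵀ` and `X_tᵀ X_t`, and `Rhat / √p`, `Chat / √q` are leading `p₀`, `q₀` eigenvectors of the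
averages of the projection matrices `Rt t (Rt t)ᵀ` and `Ct t (Ct t)ᵀ`. -/
def IsMPCAop {p q p₀ q₀ T : ℕ} (X : Fin T → Matrix (Fin p) (Fin q) ℝ)
    (Rhat : Matrix (Fin p) (Fin p₀) ℝ) (Chat : Matrix (Fin q) (Fin q₀) ℝ) : Prop :=
  ∃ (Rt : Fin T → Matrix (Fin p) (Fin (min p₀ q₀)) ℝ)
    (Ct : Fin T → Matrix (Fin q) (Fin (min p₀ q₀)) ℝ),
    (∀ t, IsLeadingEigenvectors (X t * (X t)ᵀ) (Rt t)) ∧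
    (∀ t, IsLeadingEigenvectors ((X t)ᵀ * X t) (Ct t)) ∧
    IsLeadingEigenvectors ((T : ℝ)⁻¹ • ∑ t, Rt t * (Rt t)ᵀ) ((√(p : ℝ))⁻¹ • Rhat) ∧
    IsLeadingEigenvectors ((T : ℝ)⁻¹ • ∑ t, Ct t * (Ct t)ᵀ) ((√(q : ℝ))⁻¹ • Chat)

end

/-! Write U = R/√p and V = C/√q, which have orthonormal columns. Up to a positive random factor, X_t
equals U A_t Vᵀ + N_t, where A_t = Σ₁^{1/2} W_t Σ₂^{1/2}, N_t = (pq)^{-1/2} Ω₁^{1/2} G_t Ω₂^{1/2},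
and W_t, G_t are the two Gaussian blocks of Z_t (`ae_exists_X_eq`). Eigenvectors do not see the
factor, so r_t and ‖Z_t‖ drop out and no moments are needed.

Put x = √(p+q)/√(pq) ≤ p^{-1/2} + q^{-1/2}. The norm of N_t is of order x
(`lintegral_opNorm_sq_le`). Almost surely A_t has rank k = min(p₀, q₀); let Γ_t be the projection
onto its column space. A sin Θ bound that needs no gap in the spectrum of X_t (`factor_bound`)
places the projection onto the leading left singular vectors of X_t within a multiple of √ρ_t of U
Γ_t Uᵀ, where ρ_t is the noise norm times the norm of a generalized inverse of A_t. That inverse is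
heavy-tailed, but √ρ_t has mean O(√x), because Gaussian determinants have negative moments of order
3/4 (`lintegral_enorm_det_rpow_le`). So the average of the projections is within O_p(√x) of U B Uᵀ
with B = T⁻¹ ∑ Γ_t.

If p₀ > q₀, every Γ_t is singular and a lower bound for B must come from averaging; but Γ_t is not a
function of X_t, and only the X_t are known to be independent. Hence Γ_t is compared with S_t, the
Gram matrix of Uᵀ X_t V divided by its squared Frobenius norm. It is a bounded scale-free function
of X_t, is dominated by 2Γ_t + 4√ρ_t, and has a uniformly positive definite mean
(`exists_le_integral_normalizedGram`). Chebyshev's inequality then bounds B below outside an event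
of probability O(1/T).

A second use of the sin Θ bound gives a squared subspace distance O_p(x)
(`measure_subspace_distance_le`); T enters only through the exceptional probability, so the term T⁻¹
in the rate is slack. A measurable, nearly optimal rotation passes from subspaces to loadings. The
column side is the row side of the transposed data. -/

section

open scoped Matrix.Norms.L2Operator ENNReal

/-! ### Operator norm in terms of dot products. -/

section OperatorNorm

variable {m n : Type*} [Fintype m] [Fintype n]

theorem toLp_norm_sq (x : n → ℝ) : ‖WithLp.toLp 2 x‖ ^ 2 = x ⬝ᵥ x := by
  rw [EuclideanSpace.real_norm_sq_eq]
  simp [dotProduct, sq]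

theorem mulVec_dotProduct_self_le [DecidableEq n] (A : Matrix m n ℝ) (x : n → ℝ) :
    (A *ᵥ x) ⬝ᵥ (A *ᵥ x) ≤ ‖A‖ ^ 2 * (x ⬝ᵥ x) := by
  have h := Matrix.l2_opNorm_mulVec A (WithLp.toLp 2 x)
  rw [← toLp_norm_sq, ← toLp_norm_sq, ← mul_pow]
  exact pow_le_pow_left₀ (norm_nonneg _) h 2

theorem opNorm_le_of_dotProduct [DecidableEq n] (A : Matrix m n ℝ) {c : ℝ} (hc : 0 ≤ c)
    (h : ∀ x : n → ℝ, (A *ᵥ x) ⬝ᵥ (A *ᵥ x) ≤ c ^ 2 * (x ⬝ᵥ x)) : ‖A‖ ≤ c := by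
  rw [Matrix.l2_opNorm_def]
  refine ContinuousLinearMap.opNorm_le_bound _ hc fun x => ?_
  have h' := h (WithLp.ofLp x)
  rw [← toLp_norm_sq, ← toLp_norm_sq, ← mul_pow] at h'
  exact le_of_sq_le_sq h' (by positivity)

theorem opNorm_transpose [DecidableEq m] [DecidableEq n] (A : Matrix m n ℝ) : ‖Aᵀ‖ = ‖A‖ := by
  rw [← Matrix.conjTranspose_eq_transpose_of_trivial]
  exact Matrix.l2_opNorm_conjTranspose A

end OperatorNorm

/-! ### Frobenius norm. -/

section Frobenius

variable {l m n : Type*} [Fintype l] [Fintype m] [Fintype n]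

theorem frobeniusNorm_sq (A : Matrix m n ℝ) : frobeniusNorm A ^ 2 = ∑ i, ∑ j, A i j ^ 2 := by
  let _ := Matrix.frobeniusNormedAddCommGroup (m := m) (n := n) (α := ℝ)
  have h : frobeniusNorm A = (∑ i, ∑ j, ‖A i j‖ ^ (2 : ℝ)) ^ (1 / 2 : ℝ) :=
    Matrix.frobenius_norm_def A
  rw [h, ← Real.sqrt_eq_rpow, Real.sq_sqrt]
  · simp
  · positivity

theorem frobeniusNorm_nonneg (A : Matrix m n ℝ) : 0 ≤ frobeniusNorm A := by
  let _ := Matrix.frobeniusNormedAddCommGroup (m := m) (n := n) (α := ℝ)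
  exact norm_nonneg A

theorem frobeniusNorm_sum_le {ι : Type*} (s : Finset ι) (A : ι → Matrix m n ℝ) :
    frobeniusNorm (∑ i ∈ s, A i) ≤ ∑ i ∈ s, frobeniusNorm (A i) := by
  let _ := Matrix.frobeniusNormedAddCommGroup (m := m) (n := n) (α := ℝ)
  exact norm_sum_le s A

theorem frobeniusNorm_add_le (A B : Matrix m n ℝ) :
    frobeniusNorm (A + B) ≤ frobeniusNorm A + frobeniusNorm B := by
  let _ := Matrix.frobeniusNormedAddCommGroup (m := m) (n := n) (α := ℝ)
  exact norm_add_le A B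

theorem frobeniusNorm_smul (c : ℝ) (A : Matrix m n ℝ) :
    frobeniusNorm (c • A) = |c| * frobeniusNorm A := by
  rw [← sq_eq_sq₀ (frobeniusNorm_nonneg _) (mul_nonneg (abs_nonneg _) (frobeniusNorm_nonneg _)),
    mul_pow, sq_abs, frobeniusNorm_sq, frobeniusNorm_sq]
  simp [Finset.mul_sum, mul_pow]

theorem frobeniusNorm_sq_eq_trace (A : Matrix m n ℝ) : frobeniusNorm A ^ 2 = (Aᵀ * A).trace := by
  rw [frobeniusNorm_sq, Finset.sum_comm]
  simp [Matrix.trace, Matrix.mul_apply, sq]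

theorem frobeniusNorm_transpose (A : Matrix m n ℝ) : frobeniusNorm Aᵀ = frobeniusNorm A := by
  rw [← sq_eq_sq₀ (frobeniusNorm_nonneg _) (frobeniusNorm_nonneg _), frobeniusNorm_sq,
    frobeniusNorm_sq, Finset.sum_comm]
  simp

theorem frobeniusNorm_mul_le [DecidableEq m] (A : Matrix l m ℝ) (B : Matrix m n ℝ) :
    frobeniusNorm (A * B) ≤ ‖A‖ * frobeniusNorm B := by
  refine le_of_sq_le_sq ?_ (mul_nonneg (norm_nonneg _) (frobeniusNorm_nonneg _))
  rw [mul_pow, frobeniusNorm_sq, frobeniusNorm_sq, Finset.sum_comm,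
    Finset.sum_comm (γ := m), Finset.mul_sum]
  refine Finset.sum_le_sum fun j _ => ?_
  have h := mulVec_dotProduct_self_le A (fun k => B k j)
  simpa [dotProduct, mulVec, Matrix.mul_apply, sq] using h

theorem frobeniusNorm_mul_le' [DecidableEq l] [DecidableEq m] [DecidableEq n] (A : Matrix l m ℝ)
    (B : Matrix m n ℝ) : frobeniusNorm (A * B) ≤ frobeniusNorm A * ‖B‖ := by
  rw [← frobeniusNorm_transpose, Matrix.transpose_mul, mul_comm, ← frobeniusNorm_transpose A,
    ← opNorm_transpose B]
  exact frobeniusNorm_mul_le _ _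

theorem opNorm_le_frobeniusNorm [DecidableEq n] (A : Matrix m n ℝ) :
    ‖A‖ ≤ frobeniusNorm A := by
  refine opNorm_le_of_dotProduct A (frobeniusNorm_nonneg A) fun x => ?_
  rw [frobeniusNorm_sq, Finset.sum_mul]
  refine Finset.sum_le_sum fun i _ => ?_
  have h := Finset.sum_mul_sq_le_sq_mul_sq Finset.univ (A i) x
  simpa [dotProduct, mulVec, sq] using h

theorem frobeniusNorm_one [DecidableEq n] :
    frobeniusNorm (1 : Matrix n n ℝ) ^ 2 = Fintype.card n := by
  rw [frobeniusNorm_sq_eq_trace]; simp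

end Frobenius

/-! ### Leading eigenvectors and low-rank approximation. -/

section LeadingEigenvectors

theorem IsLeadingEigenvectors.transpose_mul_self {n k : ℕ} {A : Matrix (Fin n) (Fin n) ℝ}
    {U : Matrix (Fin n) (Fin k) ℝ} (h : IsLeadingEigenvectors A U) : Uᵀ * U = 1 := by
  obtain ⟨hk, V, d, hV, -, -, rfl⟩ := h
  have hV' : Vᵀ * V = 1 := by
    simpa using Matrix.mem_orthogonalGroup_iff' (A := V).1 hV
  ext i j
  have := congrFun (congrFun hV' (Fin.castLE hk i)) (Fin.castLE hk j)
  simpa [Matrix.mul_apply, Matrix.one_apply] using this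

/-- The part of `X` outside the span of its leading `k` left singular vectors is no larger than the
distance of `X` to any matrix of rank at most `k`. -/
theorem IsLeadingEigenvectors.opNorm_residual_le {n q k : ℕ} {X S : Matrix (Fin n) (Fin q) ℝ}
    {U : Matrix (Fin n) (Fin k) ℝ} (h : IsLeadingEigenvectors (X * Xᵀ) U) (hS : S.rank ≤ k) :
    ‖(1 - U * Uᵀ) * X‖ ≤ ‖X - S‖ := by
  obtain ⟨hk, V, d, hV, hd, hA, rfl⟩ := h
  have hV1 : Vᵀ * V = 1 := by
    simpa using Matrix.mem_orthogonalGroup_iff' (A := V).1 hV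
  have hV2 : V * Vᵀ = 1 := by
    simpa using Matrix.mem_orthogonalGroup_iff (A := V).1 hV
  -- in the coordinates of the eigenbasis
  have quad (w : Fin n → ℝ) : (Xᵀ *ᵥ (V *ᵥ w)) ⬝ᵥ (Xᵀ *ᵥ (V *ᵥ w)) = ∑ j, d j * w j ^ 2 := by
    rw [Matrix.dotProduct_mulVec, Matrix.vecMul_transpose, Matrix.mulVec_mulVec, hA,
      Matrix.mulVec_mulVec, Matrix.mul_assoc, hV1, Matrix.mul_one, ← Matrix.mulVec_mulVec,
      Matrix.dotProduct_mulVec, Matrix.vecMul_mulVec, hV1]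
    simp only [dotProduct, Matrix.mulVec_diagonal, Matrix.vecMul_one]
    exact Finset.sum_congr rfl fun j _ => by ring
  have isoV (w : Fin n → ℝ) : (V *ᵥ w) ⬝ᵥ (V *ᵥ w) = w ⬝ᵥ w := by
    rw [Matrix.dotProduct_mulVec, Matrix.vecMul_mulVec, hV1]
    simp
  -- Indices start at 0, so this is the (k+1)-st eigenvalue. Since Sᵀ has rank at most k, it kills a
  -- nonzero combination of the first k+1 eigenvectors. There Xᵀ and (X - S)ᵀ agree, while the
  -- quadratic form of X Xᵀ is at least that eigenvalue.
  have hd0 : ∀ hlt : k < n, d ⟨k, hlt⟩ ≤ ‖X - S‖ ^ 2 := by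
    intro hlt
    set B := (Sᵀ * V).submatrix id (Fin.castLE (Nat.succ_le_of_lt hlt)) with hB
    have hrank : B.rank ≤ k := by
      have h1 : B = Sᵀ * V.submatrix id (Fin.castLE (Nat.succ_le_of_lt hlt)) := by
        ext i j; simp [hB, Matrix.mul_apply]
      rw [h1]
      exact (Matrix.rank_mul_le_left _ _).trans (by rwa [Matrix.rank_transpose])
    obtain ⟨z, hz0, hz⟩ : ∃ z : Fin (k + 1) → ℝ, z ≠ 0 ∧ B *ᵥ z = 0 := by
      have h2 := LinearMap.finrank_range_add_finrank_ker B.mulVecLin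
      rw [Module.finrank_fin_fun] at h2
      have h3 : 0 < Module.finrank ℝ (LinearMap.ker B.mulVecLin) := by
        have : Module.finrank ℝ (LinearMap.range B.mulVecLin) ≤ k := hrank
        omega
      have := Module.finrank_pos_iff.1 h3
      obtain ⟨z, hz⟩ := exists_ne (0 : LinearMap.ker B.mulVecLin)
      exact ⟨z, fun h => hz (Subtype.ext h), z.2⟩
    set w : Fin n → ℝ := fun j => if hj : (j : ℕ) < k + 1 then z ⟨j, hj⟩ else 0 with hw
    have hwz : ∀ j, w (Fin.castLE (Nat.succ_le_of_lt hlt) j) = z j := by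
      intro j; simp [hw, Nat.lt_succ_iff.1 j.2]
    have hw0 : w ≠ 0 := by
      intro h0
      apply hz0
      ext j
      rw [← hwz, h0]; rfl
    have hSw : Sᵀ *ᵥ (V *ᵥ w) = 0 := by
      rw [← hz, Matrix.mulVec_mulVec]
      ext i
      symm
      refine Fintype.sum_of_injective (Fin.castLE (Nat.succ_le_of_lt hlt))
        (Fin.castLE_injective _) _ _ ?_ ?_
      · intro j hj
        have : w j = 0 := by
          simp only [hw]
          split_ifs with h
          · exact absurd ⟨⟨j, h⟩, rfl⟩ hj
          · rfl
        simp [this]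
      · intro j
        simp [hB, hwz]
    have hpos : 0 < w ⬝ᵥ w := by
      refine lt_of_le_of_ne ?_ (fun h => hw0 (dotProduct_self_eq_zero.1 h.symm))
      exact Finset.sum_nonneg fun j _ => mul_self_nonneg _
    have h1 : d ⟨k, hlt⟩ * (w ⬝ᵥ w) ≤ ∑ j, d j * w j ^ 2 := by
      rw [dotProduct, Finset.mul_sum]
      refine Finset.sum_le_sum fun j _ => ?_
      by_cases hj : (j : ℕ) < k + 1
      · have : d ⟨k, hlt⟩ ≤ d j := hd (Fin.le_def.2 (Nat.lt_succ_iff.1 hj))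
        nlinarith [mul_self_nonneg (w j)]
      · simp only [hw, hj]; simp
    have h2 : ∑ j, d j * w j ^ 2 ≤ ‖X - S‖ ^ 2 * (w ⬝ᵥ w) := by
      rw [← quad, ← isoV w, ← opNorm_transpose (X - S)]
      convert mulVec_dotProduct_self_le (X - S)ᵀ (V *ᵥ w) using 2 <;>
        rw [Matrix.transpose_sub, Matrix.sub_mulVec, hSw, sub_zero]
    exact le_of_mul_le_mul_right (h1.trans h2) hpos
  set U := V.submatrix id (Fin.castLE hk) with hU
  rw [← opNorm_transpose]
  refine opNorm_le_of_dotProduct _ (norm_nonneg _) fun x => ?_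
  set y := Vᵀ *ᵥ x with hy
  have hx : V *ᵥ y = x := by rw [hy, Matrix.mulVec_mulVec, hV2, Matrix.one_mulVec]
  set w : Fin n → ℝ := fun j => if (j : ℕ) < k then 0 else y j with hw
  have hres : (1 - U * Uᵀ) *ᵥ x = V *ᵥ w := by
    have h1 : V *ᵥ w = V *ᵥ y - V *ᵥ (fun j => if (j : ℕ) < k then y j else 0) := by
      rw [← Matrix.mulVec_sub]
      congr 1
      ext j
      simp only [hw, Pi.sub_apply]
      split_ifs <;> simp
    rw [h1, hx, Matrix.sub_mulVec, Matrix.one_mulVec, ← Matrix.mulVec_mulVec]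
    congr 1
    have h2 : Uᵀ *ᵥ x = fun j => y (Fin.castLE hk j) := by
      ext j; simp [hU, hy, mulVec, dotProduct]
    rw [h2]
    ext i
    refine Fintype.sum_of_injective (Fin.castLE hk) (Fin.castLE_injective _) _ _ ?_ ?_
    · intro j hj
      have : ¬ (j : ℕ) < k := fun h => hj ⟨⟨j, h⟩, rfl⟩
      simp [this]
    · intro j
      simp [hU]
  have hT : (((1 - U * Uᵀ) * X)ᵀ) *ᵥ x = Xᵀ *ᵥ (V *ᵥ w) := by
    rw [Matrix.transpose_mul, ← Matrix.mulVec_mulVec, ← hres]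
    simp [Matrix.transpose_mul]
  rw [hT, quad]
  calc ∑ j, d j * w j ^ 2 ≤ ∑ j, ‖X - S‖ ^ 2 * y j ^ 2 := by
        refine Finset.sum_le_sum fun j _ => ?_
        by_cases hj : (j : ℕ) < k
        · simp only [hw, hj, if_true]
          rw [zero_pow two_ne_zero, mul_zero]
          positivity
        · have hlt : k < n := lt_of_le_of_lt (not_lt.1 hj) j.2
          have h1 : d j ≤ ‖X - S‖ ^ 2 :=
            (hd (Fin.le_def.2 (not_lt.1 hj))).trans (hd0 hlt)
          simp only [hw, hj, if_false]
          exact mul_le_mul_of_nonneg_right h1 (sq_nonneg _)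
    _ = ‖X - S‖ ^ 2 * (x ⬝ᵥ x) := by
        rw [← hx, isoV, dotProduct, Finset.mul_sum]
        exact Finset.sum_congr rfl fun j _ => by ring

end LeadingEigenvectors

/-! ### Orthogonal projections. -/

section Projections

variable {n : Type*} [Fintype n]

theorem frobeniusNorm_mul_sq_of_projections {P Q : Matrix n n ℝ} (hPT : Pᵀ = P) (hPP : P * P = P)
    (hQT : Qᵀ = Q) (hQQ : Q * Q = Q) : frobeniusNorm (Q * P) ^ 2 = (Q * P).trace := by
  rw [frobeniusNorm_sq_eq_trace, Matrix.transpose_mul, hPT, hQT,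
    show P * Q * (Q * P) = P * (Q * Q) * P by simp only [Matrix.mul_assoc], hQQ, Matrix.mul_assoc,
    Matrix.trace_mul_comm, Matrix.mul_assoc, hPP]

theorem frobeniusNorm_sub_sq_of_projections {P Q : Matrix n n ℝ} (hPT : Pᵀ = P) (hPP : P * P = P)
    (hQT : Qᵀ = Q) (hQQ : Q * Q = Q) :
    frobeniusNorm (Q - P) ^ 2 = Q.trace + P.trace - 2 * (Q * P).trace := by
  rw [frobeniusNorm_sq_eq_trace, Matrix.transpose_sub, hPT, hQT, Matrix.sub_mul, Matrix.mul_sub,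
    Matrix.mul_sub, hPP, hQQ, Matrix.trace_sub, Matrix.trace_sub, Matrix.trace_sub,
    Matrix.trace_mul_comm P Q]
  ring

theorem frobeniusNorm_compl_mul_sq_of_projections [DecidableEq n] {P Q : Matrix n n ℝ} (hPT : Pᵀ = P)
    (hPP : P * P = P) (hQT : Qᵀ = Q) (hQQ : Q * Q = Q) :
    frobeniusNorm ((1 - Q) * P) ^ 2 = P.trace - (Q * P).trace := by
  rw [frobeniusNorm_mul_sq_of_projections hPT hPP, Matrix.sub_mul, Matrix.one_mul,
    Matrix.trace_sub]
  · simp [hQT]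
  · simp [Matrix.sub_mul, Matrix.mul_sub, hQQ]

theorem opNorm_le_one_of_projection [DecidableEq n] {P : Matrix n n ℝ} (hPT : Pᵀ = P) (hPP : P * P = P) :
    ‖P‖ ≤ 1 := by
  have h := Matrix.l2_opNorm_conjTranspose_mul_self P
  rw [Matrix.conjTranspose_eq_transpose_of_trivial, hPT, hPP] at h
  nlinarith [norm_nonneg P, sq_nonneg (‖P‖ - 1)]

theorem opNorm_le_one_of_transpose_mul_self [DecidableEq n] {m : Type*} [Fintype m] [DecidableEq m]
    {U : Matrix m n ℝ} (hU : Uᵀ * U = 1) : ‖U‖ ≤ 1 := by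
  refine opNorm_le_of_dotProduct U zero_le_one fun x => ?_
  rw [Matrix.dotProduct_mulVec, Matrix.vecMul_mulVec, hU]
  simp

end Projections

/-! ### Perturbation of singular subspaces and eigenspaces. -/

section Perturbation

/-- A `sin Θ` theorem for leading left singular subspaces which needs no gap in the spectrum of the
perturbed matrix. -/
theorem IsLeadingEigenvectors.frobeniusNorm_sub_sq_le {n q k : ℕ}
    {X S : Matrix (Fin n) (Fin q) ℝ} {U : Matrix (Fin n) (Fin k) ℝ}
    (h : IsLeadingEigenvectors (X * Xᵀ) U) (hS : S.rank ≤ k) {P : Matrix (Fin n) (Fin n) ℝ}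
    {L : Matrix (Fin q) (Fin n) ℝ} (hPT : Pᵀ = P) (hPP : P * P = P) (htr : P.trace = k)
    (hPL : P = S * L) {τ : ℝ} (hL : ‖L‖ ≤ τ) :
    frobeniusNorm (U * Uᵀ - P) ^ 2 ≤ 8 * k * (‖X - S‖ * τ) ^ 2 := by
  have hU := h.transpose_mul_self
  have hQT : (U * Uᵀ)ᵀ = U * Uᵀ := by simp
  have hQQ : U * Uᵀ * (U * Uᵀ) = U * Uᵀ := by
    rw [Matrix.mul_assoc, ← Matrix.mul_assoc Uᵀ, hU, Matrix.one_mul]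
  have hQtr : (U * Uᵀ).trace = k := by rw [Matrix.trace_mul_comm, hU]; simp
  -- Both projections have trace k, so the two one-sided differences have the same Frobenius norm.
  have h1 : frobeniusNorm (U * Uᵀ - P) ^ 2 = 2 * frobeniusNorm ((1 - U * Uᵀ) * P) ^ 2 := by
    rw [frobeniusNorm_sub_sq_of_projections hPT hPP hQT hQQ,
      frobeniusNorm_compl_mul_sq_of_projections hPT hPP hQT hQQ, hQtr, htr]
    ring
  have hPF : frobeniusNorm P ^ 2 = k := by
    rw [frobeniusNorm_sq_eq_trace, hPT, hPP, htr]
  -- Since P = S L, only the part of S outside the span of U matters. The residual of X and the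
  -- error X - S each contribute ‖X - S‖ to it, so no spectral gap is required.
  have h2 : ‖(1 - U * Uᵀ) * P‖ ≤ 2 * (‖X - S‖ * τ) := by
    have h3 : (1 - U * Uᵀ) * S = (1 - U * Uᵀ) * X - (1 - U * Uᵀ) * (X - S) := by
      rw [Matrix.mul_sub]; abel
    have h4 : ‖1 - U * Uᵀ‖ ≤ 1 := opNorm_le_one_of_projection (by simp)
      (by simp [Matrix.sub_mul, Matrix.mul_sub, hQQ])
    have h5 : ‖(1 - U * Uᵀ) * (X - S)‖ ≤ ‖X - S‖ :=
      (Matrix.l2_opNorm_mul _ _).trans (mul_le_of_le_one_left (norm_nonneg _) h4)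
    have h6 : ‖(1 - U * Uᵀ) * S‖ ≤ 2 * ‖X - S‖ := by
      rw [h3]
      linarith [norm_sub_le ((1 - U * Uᵀ) * X) ((1 - U * Uᵀ) * (X - S)),
        h.opNorm_residual_le hS]
    calc ‖(1 - U * Uᵀ) * P‖ = ‖(1 - U * Uᵀ) * S * L‖ := by rw [hPL, Matrix.mul_assoc]
      _ ≤ ‖(1 - U * Uᵀ) * S‖ * ‖L‖ := Matrix.l2_opNorm_mul _ _
      _ ≤ 2 * ‖X - S‖ * τ := mul_le_mul h6 hL (norm_nonneg _) (by positivity)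
      _ = 2 * (‖X - S‖ * τ) := by ring
  have h7 : frobeniusNorm ((1 - U * Uᵀ) * P) ≤ 2 * (‖X - S‖ * τ) * frobeniusNorm P := by
    calc frobeniusNorm ((1 - U * Uᵀ) * P) = frobeniusNorm ((1 - U * Uᵀ) * P * P) := by
          rw [Matrix.mul_assoc, hPP]
      _ ≤ ‖(1 - U * Uᵀ) * P‖ * frobeniusNorm P := frobeniusNorm_mul_le _ _
      _ ≤ _ := mul_le_mul_of_nonneg_right h2 (frobeniusNorm_nonneg _)
  have h8 := pow_le_pow_left₀ (frobeniusNorm_nonneg _) h7 2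
  rw [h1]
  rw [mul_pow, hPF] at h8
  nlinarith

theorem frobeniusNorm_sub_sq_le_of_trace_eq {n k : ℕ} {U : Matrix (Fin n) (Fin k) ℝ}
    (hU : Uᵀ * U = 1) {P : Matrix (Fin n) (Fin n) ℝ} (hPT : Pᵀ = P) (hPP : P * P = P)
    (htr : P.trace = k) : frobeniusNorm (U * Uᵀ - P) ^ 2 ≤ 2 * k := by
  have hQT : (U * Uᵀ)ᵀ = U * Uᵀ := by simp
  have hQQ : U * Uᵀ * (U * Uᵀ) = U * Uᵀ := by
    rw [Matrix.mul_assoc, ← Matrix.mul_assoc Uᵀ, hU, Matrix.one_mul]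
  have hQtr : (U * Uᵀ).trace = k := by rw [Matrix.trace_mul_comm, hU]; simp
  rw [frobeniusNorm_sub_sq_of_projections hPT hPP hQT hQQ, hQtr, htr,
    ← frobeniusNorm_mul_sq_of_projections hPT hPP hQT hQQ]
  nlinarith [sq_nonneg (frobeniusNorm (U * Uᵀ * P))]

/-- The sin Θ bound for ρ ≤ 1 and the trivial bound for ρ ≥ 1 are merged into √ρ. In the application
ρ contains an inverse Gaussian determinant, whose moments are finite only below order one; the
square root makes the bound integrable. -/
theorem IsLeadingEigenvectors.frobeniusNorm_sub_le_sqrt {n q k : ℕ}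
    {X S : Matrix (Fin n) (Fin q) ℝ} {U : Matrix (Fin n) (Fin k) ℝ}
    (h : IsLeadingEigenvectors (X * Xᵀ) U) (hS : S.rank ≤ k) {P : Matrix (Fin n) (Fin n) ℝ}
    {L : Matrix (Fin q) (Fin n) ℝ} (hPT : Pᵀ = P) (hPP : P * P = P) (htr : P.trace = k)
    (hPL : P = S * L) {τ ρ : ℝ} (hL : ‖L‖ ≤ τ) (hρ : ‖X - S‖ * τ ≤ ρ) :
    frobeniusNorm (U * Uᵀ - P) ≤ √(8 * k) * √ρ := by
  have hτ : 0 ≤ τ := (norm_nonneg _).trans hL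
  have hρ0 : 0 ≤ ρ := le_trans (by positivity) hρ
  refine le_of_sq_le_sq ?_ (by positivity)
  rw [mul_pow, Real.sq_sqrt (by positivity), Real.sq_sqrt hρ0]
  rcases le_total ρ 1 with h1 | h1
  · refine (h.frobeniusNorm_sub_sq_le hS hPT hPP htr hPL hL).trans ?_
    refine mul_le_mul_of_nonneg_left ?_ (by positivity)
    have : 0 ≤ ‖X - S‖ * τ := by positivity
    nlinarith
  · refine (frobeniusNorm_sub_sq_le_of_trace_eq h.transpose_mul_self hPT hPP htr).trans ?_
    have : (0 : ℝ) ≤ k := by positivity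
    nlinarith

/-- Squaring preserves the order of nonnegative eigenvalues. This lets the bound for singular
subspaces be applied to an average of projections. -/
theorem IsLeadingEigenvectors.mul_transpose_self {n k : ℕ} {A : Matrix (Fin n) (Fin n) ℝ}
    {U : Matrix (Fin n) (Fin k) ℝ} (h : IsLeadingEigenvectors A U)
    (hA : ∀ x, 0 ≤ x ⬝ᵥ (A *ᵥ x)) : IsLeadingEigenvectors (A * Aᵀ) U := by
  obtain ⟨hk, V, d, hV, hd, rfl, rfl⟩ := h
  have hV1 : Vᵀ * V = 1 := by
    simpa using Matrix.mem_orthogonalGroup_iff' (A := V).1 hV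
  have hd0 : ∀ j, 0 ≤ d j := by
    intro j
    have := hA (V *ᵥ Pi.single j 1)
    rw [Matrix.mulVec_mulVec, Matrix.mul_assoc, hV1, Matrix.mul_one, ← Matrix.mulVec_mulVec,
      Matrix.dotProduct_mulVec, Matrix.vecMul_mulVec, hV1] at this
    simpa using this
  refine ⟨hk, V, fun j => d j * d j, hV,
    fun i j hij => mul_self_le_mul_self (hd0 j) (hd hij), ?_, rfl⟩
  rw [← Matrix.diagonal_mul_diagonal]
  simp only [Matrix.transpose_mul, Matrix.diagonal_transpose, Matrix.transpose_transpose]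
  simp only [Matrix.mul_assoc]
  rw [← Matrix.mul_assoc Vᵀ, hV1, Matrix.one_mul]

theorem isUnit_det_of_le_dotProduct {n : Type*} [Fintype n] [DecidableEq n] {B : Matrix n n ℝ}
    {c : ℝ} (hc : 0 < c) (hB : ∀ x, c ^ 2 * (x ⬝ᵥ x) ≤ (B *ᵥ x) ⬝ᵥ (B *ᵥ x)) : IsUnit B.det := by
  rw [isUnit_iff_ne_zero]
  intro h0
  obtain ⟨v, hv0, hv⟩ := Matrix.exists_mulVec_eq_zero_iff.2 h0
  have := hB v
  rw [hv, dotProduct_zero] at this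
  have h1 : 0 < v ⬝ᵥ v := lt_of_le_of_ne (Finset.sum_nonneg fun j _ => mul_self_nonneg _)
    (fun h => hv0 (dotProduct_self_eq_zero.1 h.symm))
  nlinarith [mul_pos (pow_pos hc 2) h1]

theorem opNorm_inv_le_of_le_dotProduct {n : Type*} [Fintype n] [DecidableEq n] {B : Matrix n n ℝ}
    {c : ℝ} (hc : 0 < c) (hB : ∀ x, c ^ 2 * (x ⬝ᵥ x) ≤ (B *ᵥ x) ⬝ᵥ (B *ᵥ x)) : ‖B⁻¹‖ ≤ c⁻¹ := by
  refine opNorm_le_of_dotProduct _ (inv_nonneg.2 hc.le) fun x => ?_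
  have h := hB (B⁻¹ *ᵥ x)
  rw [Matrix.mulVec_mulVec, Matrix.mul_nonsing_inv _ (isUnit_det_of_le_dotProduct hc hB),
    Matrix.one_mulVec] at h
  rw [inv_pow, ← div_eq_inv_mul, le_div_iff₀' (pow_pos hc 2)]
  exact h

theorem dotProduct_sq_le {n : Type*} [Fintype n] (x y : n → ℝ) :
    (x ⬝ᵥ y) ^ 2 ≤ (x ⬝ᵥ x) * (y ⬝ᵥ y) := by
  simpa [dotProduct, sq] using Finset.sum_mul_sq_le_sq_mul_sq Finset.univ x y

theorem dotProduct_self_nonneg' {n : Type*} [Fintype n] (x : n → ℝ) : 0 ≤ x ⬝ᵥ x :=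
  Finset.sum_nonneg fun _ _ => mul_self_nonneg _

/-- If `A` is close to `U B Uᵀ` with `B` bounded below, its leading eigenspace is close to the
column space of `U`. -/
theorem IsLeadingEigenvectors.frobeniusNorm_sub_le_of_compression {n m : ℕ}
    {A : Matrix (Fin n) (Fin n) ℝ} {U' U : Matrix (Fin n) (Fin m) ℝ}
    (h : IsLeadingEigenvectors A U') (hA : ∀ x, 0 ≤ x ⬝ᵥ (A *ᵥ x)) (hU : Uᵀ * U = 1)
    {B : Matrix (Fin m) (Fin m) ℝ} {c : ℝ} (hc : 0 < c)
    (hB : ∀ x, c * (x ⬝ᵥ x) ≤ x ⬝ᵥ (B *ᵥ x)) :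
    frobeniusNorm (U' * U'ᵀ - U * Uᵀ) ^ 2 ≤
      8 * m * (frobeniusNorm (A - U * B * Uᵀ) * c⁻¹) ^ 2 := by
  -- Cauchy–Schwarz; `B` need not be symmetric.
  have hB' : ∀ x, c ^ 2 * (x ⬝ᵥ x) ≤ (B *ᵥ x) ⬝ᵥ (B *ᵥ x) := by
    intro x
    rcases (dotProduct_self_nonneg' x).eq_or_lt' with h0 | h0
    · rw [h0, mul_zero]; exact dotProduct_self_nonneg' _
    · have h1 := dotProduct_sq_le x (B *ᵥ x)
      have h2 : (c * (x ⬝ᵥ x)) ^ 2 ≤ (x ⬝ᵥ (B *ᵥ x)) ^ 2 :=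
        pow_le_pow_left₀ (by positivity) (hB x) 2
      refine le_of_mul_le_mul_left ?_ h0
      calc _ = (c * (x ⬝ᵥ x)) ^ 2 := by ring
        _ ≤ _ := h2.trans h1
  have hdet := isUnit_det_of_le_dotProduct hc hB'
  have hrank : (U * B * Uᵀ).rank ≤ m := by
    rw [Matrix.mul_assoc]
    exact (Matrix.rank_mul_le_left _ _).trans ((Matrix.rank_le_width U).trans (by simp))
  have hU1 := opNorm_le_one_of_transpose_mul_self hU
  have hL : ‖U * B⁻¹ * Uᵀ‖ ≤ c⁻¹ := by
    have h1 := opNorm_inv_le_of_le_dotProduct hc hB'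
    have h2 : ‖Uᵀ‖ ≤ 1 := by rwa [opNorm_transpose]
    have h3 : ‖U * B⁻¹‖ ≤ c⁻¹ := (Matrix.l2_opNorm_mul _ _).trans
      ((mul_le_of_le_one_left (norm_nonneg _) hU1).trans h1)
    exact (Matrix.l2_opNorm_mul _ _).trans ((mul_le_of_le_one_right (norm_nonneg _) h2).trans h3)
  -- The sin Θ bound is used with A as the perturbed matrix, S = U B Uᵀ, P = U Uᵀ and L = U B⁻¹ Uᵀ.
  refine ((h.mul_transpose_self hA).frobeniusNorm_sub_sq_le hrank (P := U * Uᵀ) (by simp)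
    ?_ ?_ ?_ hL).trans ?_
  · rw [Matrix.mul_assoc, ← Matrix.mul_assoc Uᵀ, hU, Matrix.one_mul]
  · rw [Matrix.trace_mul_comm, hU]; simp
  · calc U * Uᵀ = U * (B * B⁻¹) * Uᵀ := by
          rw [Matrix.mul_nonsing_inv _ hdet, Matrix.mul_one]
      _ = U * B * (Uᵀ * U) * (B⁻¹ * Uᵀ) := by
          rw [hU, Matrix.mul_one]; simp only [Matrix.mul_assoc]
      _ = U * B * Uᵀ * (U * B⁻¹ * Uᵀ) := by simp only [Matrix.mul_assoc]
  · have := opNorm_le_frobeniusNorm (A - U * B * Uᵀ)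
    gcongr

end Perturbation

/-! ### Column projections and normalized Gram matrices. -/

section ColumnProjection

/-- `Q` is the orthogonal projection onto the column space of `A`, which has dimension `k`; the
number `τ` bounds the norm of a generalized inverse of `A`. -/
structure IsColumnProjection {m n : ℕ} (A : Matrix (Fin m) (Fin n) ℝ) (k : ℕ) (τ : ℝ)
    (Q : Matrix (Fin m) (Fin m) ℝ) : Prop where
  symm : Qᵀ = Q
  idem : Q * Q = Q
  trace_eq : Q.trace = k
  mul_eq : Q * A = A
  exists_factor : ∃ M : Matrix (Fin n) (Fin m) ℝ, Q = A * M ∧ ‖M‖ ≤ τ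

/-- A right inverse makes A surjective, so the projection is the identity. -/
theorem exists_isColumnProjection_of_mul_eq_one {m n : ℕ} {A : Matrix (Fin m) (Fin n) ℝ}
    {D : Matrix (Fin n) (Fin m) ℝ} (h : A * D = 1) :
    ∃ Q, IsColumnProjection A m ‖D‖ Q :=
  ⟨1, by simp, by simp, by simp, by simp, D, h.symm, le_rfl⟩

/-- A left inverse D gives full column rank, and the projection is Q = A (AᵀA)⁻¹ Aᵀ. Then Q = A (D
Q), and D Q is no larger than D because Q is a contraction. -/
theorem exists_isColumnProjection_of_mul_eq_one' {m n : ℕ} {A : Matrix (Fin m) (Fin n) ℝ}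
    {D : Matrix (Fin n) (Fin m) ℝ} (h : D * A = 1) :
    ∃ Q, IsColumnProjection A n ‖D‖ Q := by
  have hdet : IsUnit (Aᵀ * A).det := by
    rw [isUnit_iff_ne_zero]
    intro h0
    obtain ⟨v, hv0, hv⟩ := Matrix.exists_mulVec_eq_zero_iff.2 h0
    have h1 : (A *ᵥ v) ⬝ᵥ (A *ᵥ v) = 0 := by
      rw [Matrix.dotProduct_mulVec, Matrix.vecMul_mulVec, ← Matrix.dotProduct_mulVec, hv]
      simp
    have h2 := dotProduct_self_eq_zero.1 h1
    apply hv0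
    rw [← Matrix.one_mulVec v, ← h, ← Matrix.mulVec_mulVec, h2, Matrix.mulVec_zero]
  have hA : A * (Aᵀ * A)⁻¹ * Aᵀ * A = A := by
    rw [Matrix.mul_assoc, Matrix.mul_assoc, Matrix.nonsing_inv_mul _ hdet, Matrix.mul_one]
  have hT : (A * (Aᵀ * A)⁻¹ * Aᵀ)ᵀ = A * (Aᵀ * A)⁻¹ * Aᵀ := by
    simp [Matrix.transpose_mul, Matrix.transpose_nonsing_inv, Matrix.mul_assoc]
  have hQQ : A * (Aᵀ * A)⁻¹ * Aᵀ * (A * (Aᵀ * A)⁻¹ * Aᵀ) = A * (Aᵀ * A)⁻¹ * Aᵀ := by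
    nth_rewrite 1 [← Matrix.mul_assoc, ← Matrix.mul_assoc, hA]
    rfl
  refine ⟨A * (Aᵀ * A)⁻¹ * Aᵀ, hT, hQQ, ?_, hA, D * (A * (Aᵀ * A)⁻¹ * Aᵀ), ?_, ?_⟩
  · rw [Matrix.trace_mul_comm, ← Matrix.mul_assoc, Matrix.mul_nonsing_inv _ hdet]
    simp
  · rw [← Matrix.mul_assoc D, ← Matrix.mul_assoc D, h, Matrix.one_mul, Matrix.mul_assoc]
  · refine (Matrix.l2_opNorm_mul _ _).trans (mul_le_of_le_one_right (norm_nonneg _) ?_)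
    exact opNorm_le_one_of_projection hT hQQ

/-- The matrix `Y Yᵀ / ‖Y‖²`, which depends on `Y` only up to scaling. -/
noncomputable def normalizedGram {m n : ℕ} (Y : Matrix (Fin m) (Fin n) ℝ) : Matrix (Fin m) (Fin m) ℝ :=
  (frobeniusNorm Y ^ 2)⁻¹ • (Y * Yᵀ)

/-- This invariance removes the unknown random scale of the observations. -/
theorem normalizedGram_smul {m n : ℕ} (Y : Matrix (Fin m) (Fin n) ℝ) {s : ℝ} (hs : s ≠ 0) :
    normalizedGram (s • Y) = normalizedGram Y := by
  rw [normalizedGram, normalizedGram, frobeniusNorm_smul, Matrix.transpose_smul,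
    Matrix.smul_mul, Matrix.mul_smul, smul_smul, smul_smul, mul_pow, sq_abs, mul_inv]
  congr 1
  field_simp

theorem dotProduct_normalizedGram {m n : ℕ} (Y : Matrix (Fin m) (Fin n) ℝ) (u : Fin m → ℝ) :
    u ⬝ᵥ (normalizedGram Y *ᵥ u) = (Yᵀ *ᵥ u) ⬝ᵥ (Yᵀ *ᵥ u) / frobeniusNorm Y ^ 2 := by
  rw [normalizedGram, Matrix.smul_mulVec, dotProduct_smul, ← Matrix.mulVec_mulVec,
    Matrix.dotProduct_mulVec, ← Matrix.mulVec_transpose, smul_eq_mul, div_eq_inv_mul]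

theorem transpose_mulVec_dotProduct_le {m n : ℕ} (Y : Matrix (Fin m) (Fin n) ℝ)
    (u : Fin m → ℝ) : (Yᵀ *ᵥ u) ⬝ᵥ (Yᵀ *ᵥ u) ≤ frobeniusNorm Y ^ 2 * (u ⬝ᵥ u) := by
  refine (mulVec_dotProduct_self_le Yᵀ u).trans ?_
  rw [opNorm_transpose]
  have := opNorm_le_frobeniusNorm Y
  have := dotProduct_self_nonneg' u
  gcongr

theorem dotProduct_normalizedGram_le {m n : ℕ} (Y : Matrix (Fin m) (Fin n) ℝ) (u : Fin m → ℝ) :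
    u ⬝ᵥ (normalizedGram Y *ᵥ u) ≤ u ⬝ᵥ u := by
  rw [dotProduct_normalizedGram]
  exact div_le_of_le_mul₀ (sq_nonneg _) (dotProduct_self_nonneg' u)
    ((transpose_mulVec_dotProduct_le Y u).trans_eq (mul_comm _ _))

theorem add_dotProduct_self_le {n : Type*} [Fintype n] (x y : n → ℝ) :
    (x + y) ⬝ᵥ (x + y) ≤ 2 * (x ⬝ᵥ x) + 2 * (y ⬝ᵥ y) := by
  have h := dotProduct_self_nonneg' (x - y)
  have e1 : (x - y) ⬝ᵥ (x - y) = x ⬝ᵥ x - 2 * (x ⬝ᵥ y) + y ⬝ᵥ y := by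
    rw [sub_dotProduct, dotProduct_sub, dotProduct_sub, dotProduct_comm y x]; ring
  have e2 : (x + y) ⬝ᵥ (x + y) = x ⬝ᵥ x + 2 * (x ⬝ᵥ y) + y ⬝ᵥ y := by
    rw [add_dotProduct, dotProduct_add, dotProduct_add, dotProduct_comm y x]; ring
  linarith

theorem IsColumnProjection.dotProduct_mulVec_eq {m n k : ℕ} {A : Matrix (Fin m) (Fin n) ℝ} {τ : ℝ}
    {Q : Matrix (Fin m) (Fin m) ℝ} (hQ : IsColumnProjection A k τ Q) (u : Fin m → ℝ) :
    u ⬝ᵥ (Q *ᵥ u) = (Q *ᵥ u) ⬝ᵥ (Q *ᵥ u) := by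
  rw [Matrix.dotProduct_mulVec (Q *ᵥ u), Matrix.vecMul_mulVec, hQ.symm, hQ.idem,
    Matrix.dotProduct_mulVec]

/-- The column projection of `A` dominates the normalized Gram matrix of a perturbation of `A`. -/
theorem IsColumnProjection.dotProduct_normalizedGram_le {m n k : ℕ}
    {A H : Matrix (Fin m) (Fin n) ℝ} {τ ρ : ℝ} {Q : Matrix (Fin m) (Fin m) ℝ}
    (hQ : IsColumnProjection A k τ Q) (hk : 0 < k) (hρ : ‖H‖ * τ ≤ ρ) (u : Fin m → ℝ) :
    u ⬝ᵥ (normalizedGram (A + H) *ᵥ u) ≤ 2 * (u ⬝ᵥ (Q *ᵥ u)) + 4 * √ρ * (u ⬝ᵥ u) := by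
  obtain ⟨M, hQM, hM⟩ := hQ.exists_factor
  have hτ : 0 ≤ τ := (norm_nonneg _).trans hM
  have hρ0 : 0 ≤ ρ := le_trans (by positivity) hρ
  have huu := dotProduct_self_nonneg' u
  have hQu : 0 ≤ u ⬝ᵥ (Q *ᵥ u) := by
    rw [hQ.dotProduct_mulVec_eq]; exact dotProduct_self_nonneg' _
  -- From 1/16 on, 4√ρ is at least 1, and a normalized Gram matrix never exceeds the identity.
  rcases le_or_gt (1 / 16) ρ with h16 | h16
  · have h1 : 1 / 4 ≤ √ρ := Real.le_sqrt_of_sq_le (by norm_num; linarith)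
    have h2 := _root_.dotProduct_normalizedGram_le (A + H) u
    nlinarith [mul_le_mul_of_nonneg_right h1 huu]
  set Y := A + H with hY
  set y := frobeniusNorm Y with hy
  have hy0 : 0 ≤ y := frobeniusNorm_nonneg Y
  have hQ1 : 1 ≤ ‖Q‖ := by
    have hne : Q ≠ 0 := by
      rintro rfl
      have := hQ.trace_eq
      rw [Matrix.trace_zero] at this
      exact hk.ne (by exact_mod_cast this)
    have h1 : ‖Q‖ ≤ ‖Q‖ * ‖Q‖ := by
      nth_rewrite 1 [← hQ.idem]; exact norm_mul_le _ _
    have h2 : 0 < ‖Q‖ := norm_pos_iff.2 hne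
    nlinarith
  -- A nonzero projection has norm at least 1, hence 1 ≤ ‖A‖ τ; the perturbation costs at most ρ <
  -- 1/16.
  have hyτ : 15 / 16 ≤ y * τ := by
    have h1 : ‖Q‖ ≤ ‖A‖ * τ := by
      rw [hQM]
      exact (Matrix.l2_opNorm_mul _ _).trans (mul_le_mul_of_nonneg_left hM (norm_nonneg _))
    have h2 : ‖A‖ ≤ y + ‖H‖ := by
      have : A = Y - H := by rw [hY]; abel
      calc ‖A‖ = ‖Y - H‖ := by rw [← this]
        _ ≤ ‖Y‖ + ‖H‖ := norm_sub_le _ _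
        _ ≤ _ := by gcongr; exact opNorm_le_frobeniusNorm Y
    nlinarith [mul_le_mul_of_nonneg_right h2 hτ]
  have hypos : 0 < y := by
    rcases hy0.eq_or_lt with h | h
    · rw [← h] at hyτ; norm_num at hyτ
    · exact h
  have hHy : ‖H‖ ^ 2 ≤ 2 * √ρ * y ^ 2 := by
    have h1 : ‖H‖ * (15 / 16) ≤ ρ * y := by
      calc ‖H‖ * (15 / 16) ≤ ‖H‖ * (y * τ) := by gcongr
        _ = ‖H‖ * τ * y := by ring
        _ ≤ _ := by gcongr
    have h2 : √ρ ≤ 1 := Real.sqrt_le_one.2 (by linarith)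
    have h3 : √ρ * √ρ = ρ := Real.mul_self_sqrt hρ0
    have h4 : ρ ≤ √ρ := by nlinarith [Real.sqrt_nonneg ρ]
    have h5 : (‖H‖ * (15 / 16)) ^ 2 ≤ (ρ * y) ^ 2 := pow_le_pow_left₀ (by positivity) h1 2
    have h6 : ρ ^ 2 ≤ √ρ := by nlinarith
    have h7 : ρ ^ 2 * y ^ 2 ≤ √ρ * y ^ 2 := by gcongr
    nlinarith
  set v := Q *ᵥ u with hv
  -- Aᵀ annihilates u - Qu, so off the column space of A only the perturbation H acts.
  have hdecomp : Yᵀ *ᵥ u = Yᵀ *ᵥ v + Hᵀ *ᵥ (u - v) := by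
    have h1 : Aᵀ *ᵥ (u - v) = 0 := by
      have h2 : Aᵀ * Q = Aᵀ := by
        conv_rhs => rw [← hQ.mul_eq, Matrix.transpose_mul, hQ.symm]
      rw [Matrix.mulVec_sub, hv, Matrix.mulVec_mulVec, h2, sub_self]
    have h3 : Yᵀ *ᵥ (u - v) = Hᵀ *ᵥ (u - v) := by
      rw [hY, Matrix.transpose_add, Matrix.add_mulVec, h1, zero_add]
    rw [← h3, ← Matrix.mulVec_add]
    congr 1
    abel
  have hvv : (u - v) ⬝ᵥ (u - v) ≤ u ⬝ᵥ u := by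
    have h1 := hQ.dotProduct_mulVec_eq u
    rw [sub_dotProduct, dotProduct_sub, dotProduct_sub, dotProduct_comm v u, hv]
    rw [← h1]
    linarith
  rw [dotProduct_normalizedGram, ← hy, div_le_iff₀ (by positivity), hdecomp]
  refine (add_dotProduct_self_le _ _).trans ?_
  have h1 := transpose_mulVec_dotProduct_le Y v
  have h2 : (Hᵀ *ᵥ (u - v)) ⬝ᵥ (Hᵀ *ᵥ (u - v)) ≤ ‖H‖ ^ 2 * (u ⬝ᵥ u) := by
    refine (mulVec_dotProduct_self_le Hᵀ _).trans ?_
    rw [opNorm_transpose]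
    gcongr
  rw [← hy] at h1
  have h3 := hQ.dotProduct_mulVec_eq u
  rw [← hv] at h3
  rw [h3]
  have h4 : ‖H‖ ^ 2 * (u ⬝ᵥ u) ≤ 2 * √ρ * y ^ 2 * (u ⬝ᵥ u) := by gcongr
  nlinarith

end ColumnProjection

/-! ### Square roots and eigenvalue bounds. -/

section SquareRoot

variable {n : Type*} [Fintype n] [DecidableEq n]

theorem sqrt_transpose (A : Matrix n n ℝ) : (CFC.sqrt A)ᵀ = CFC.sqrt A := by
  have h := (Matrix.nonneg_iff_posSemidef.1 (CFC.sqrt_nonneg A)).1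
  rwa [Matrix.IsHermitian, Matrix.conjTranspose_eq_transpose_of_trivial] at h

theorem sqrt_mulVec_dotProduct_self {A : Matrix n n ℝ} (hA : A.PosSemidef) (x : n → ℝ) :
    (CFC.sqrt A *ᵥ x) ⬝ᵥ (CFC.sqrt A *ᵥ x) = x ⬝ᵥ (A *ᵥ x) := by
  rw [Matrix.dotProduct_mulVec, Matrix.vecMul_mulVec, sqrt_transpose,
    CFC.sqrt_mul_sqrt_self A hA.nonneg, Matrix.dotProduct_mulVec]

theorem opNorm_sqrt_le {A : Matrix n n ℝ} (hA : A.PosSemidef) {K : ℝ} (hK : 0 ≤ K)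
    (h : ∀ x, x ⬝ᵥ (A *ᵥ x) ≤ K * (x ⬝ᵥ x)) : ‖CFC.sqrt A‖ ≤ √K := by
  refine opNorm_le_of_dotProduct _ (Real.sqrt_nonneg K) fun x => ?_
  rw [sqrt_mulVec_dotProduct_self hA, Real.sq_sqrt hK]
  exact h x

theorem le_sqrt_mulVec_dotProduct_self {A : Matrix n n ℝ} (hA : A.PosSemidef) {c : ℝ} (hc : 0 < c)
    (h : ∀ x, c * (x ⬝ᵥ x) ≤ x ⬝ᵥ (A *ᵥ x)) (x : n → ℝ) :
    √c ^ 2 * (x ⬝ᵥ x) ≤ (CFC.sqrt A *ᵥ x) ⬝ᵥ (CFC.sqrt A *ᵥ x) := by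
  rw [sqrt_mulVec_dotProduct_self hA, Real.sq_sqrt hc.le]
  exact h x

theorem EigenvaluesBetween.dotProduct_mulVec {n : ℕ} {A : Matrix (Fin n) (Fin n) ℝ} {c K : ℝ}
    (h : EigenvaluesBetween A c K) (x : Fin n → ℝ) :
    c * (x ⬝ᵥ x) ≤ x ⬝ᵥ (A *ᵥ x) ∧ x ⬝ᵥ (A *ᵥ x) ≤ K * (x ⬝ᵥ x) := by
  obtain ⟨hA, hj⟩ := h
  set V : Matrix (Fin n) (Fin n) ℝ := (hA.eigenvectorUnitary).1 with hV
  have hV2 : V * Vᵀ = 1 := by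
    simpa using Matrix.mem_orthogonalGroup_iff (A := V).1 hA.eigenvectorUnitary.2
  have hA' : A = V * diagonal hA.eigenvalues * Vᵀ := by
    have := hA.spectral_theorem
    rw [Unitary.conjStarAlgAut_apply] at this
    exact this
  have e1 : x ⬝ᵥ (A *ᵥ x) = ∑ j, hA.eigenvalues j * (Vᵀ *ᵥ x) j ^ 2 := by
    conv_lhs => rw [hA', Matrix.mul_assoc, ← Matrix.mulVec_mulVec, Matrix.dotProduct_mulVec,
      ← Matrix.mulVec_transpose, ← Matrix.mulVec_mulVec]
    simp only [dotProduct, Matrix.mulVec_diagonal]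
    exact Finset.sum_congr rfl fun j _ => by ring
  have e2 : x ⬝ᵥ x = ∑ j, (Vᵀ *ᵥ x) j ^ 2 := by
    have : x ⬝ᵥ x = (Vᵀ *ᵥ x) ⬝ᵥ (Vᵀ *ᵥ x) := by
      rw [Matrix.dotProduct_mulVec, Matrix.vecMul_mulVec, Matrix.transpose_transpose, hV2]
      simp
    rw [this]
    simp [dotProduct, sq]
  rw [e1, e2, Finset.mul_sum, Finset.mul_sum]
  exact ⟨Finset.sum_le_sum fun j _ => mul_le_mul_of_nonneg_right (hj j).1 (sq_nonneg _),
    Finset.sum_le_sum fun j _ => mul_le_mul_of_nonneg_right (hj j).2 (sq_nonneg _)⟩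

end SquareRoot

/-! ### Generalized inverses from an invertible block. -/

section Block

/-- This separates the heavy-tailed factor 1/|det| from the adjugate, which is polynomial in the
entries and has all Gaussian moments. -/
theorem opNorm_inv_le_adjugate {k : ℕ} (W : Matrix (Fin k) (Fin k) ℝ) :
    ‖W⁻¹‖ ≤ |W.det|⁻¹ * ‖W.adjugate‖ := by
  rw [Matrix.inv_def, norm_smul, Ring.inverse_eq_inv', norm_inv, Real.norm_eq_abs]

theorem IsColumnProjection.mono {m n k : ℕ} {A : Matrix (Fin m) (Fin n) ℝ} {τ τ' : ℝ}
    {Q : Matrix (Fin m) (Fin m) ℝ} (hQ : IsColumnProjection A k τ Q) (h : τ ≤ τ') :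
    IsColumnProjection A k τ' Q := by
  obtain ⟨M, h1, h2⟩ := hQ.exists_factor
  exact ⟨hQ.symm, hQ.idem, hQ.trace_eq, hQ.mul_eq, M, h1, h2.trans h⟩

theorem opNorm_mul_le_of_le {l m n : Type*} [Fintype l] [Fintype m] [Fintype n] [DecidableEq m]
    [DecidableEq n] {A : Matrix l m ℝ} {B : Matrix m n ℝ} {a b : ℝ} (hA : ‖A‖ ≤ a) (hB : ‖B‖ ≤ b) :
    ‖A * B‖ ≤ a * b :=
  (Matrix.l2_opNorm_mul _ _).trans
    (mul_le_mul hA hB (norm_nonneg _) ((norm_nonneg _).trans hA))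

/-- The matrix `B₁ W B₂` has full rank if `B₁`, `B₂` and the leading square block of `W` are
invertible. -/
theorem exists_isColumnProjection {m n k : ℕ} (hk : k = min m n)
    {B₁ : Matrix (Fin m) (Fin m) ℝ} {B₂ : Matrix (Fin n) (Fin n) ℝ} (W : Matrix (Fin m) (Fin n) ℝ)
    (h₁ : IsUnit B₁.det) (h₂ : IsUnit B₂.det) {b : ℝ} (hb₁ : ‖B₁⁻¹‖ ≤ b) (hb₂ : ‖B₂⁻¹‖ ≤ b)
    {D : Matrix (Fin k) (Fin k) ℝ}
    (hD : D = W.submatrix (Fin.castLE (hk.trans_le (min_le_left m n)))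
      (Fin.castLE (hk.trans_le (min_le_right m n)))) (hdet : D.det ≠ 0) :
    ∃ Q, IsColumnProjection (B₁ * W * B₂) k (b * b * (|D.det|⁻¹ * ‖D.adjugate‖)) Q := by
  have hb : 0 ≤ b := (norm_nonneg _).trans hb₁
  have hDu : IsUnit D.det := isUnit_iff_ne_zero.2 hdet
  rcases le_total m n with hmn | hmn
  -- `J` selects the first k columns, so W J = D leads to a right inverse of B₁ W B₂. In the other
  -- case J W = D leads to a left inverse.
  · obtain rfl : k = m := by omega
    have hD' : D = W * (1 : Matrix (Fin n) (Fin n) ℝ).submatrix id (Fin.castLE hmn) := by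
      rw [hD]; ext i j; simp [Matrix.mul_apply, Matrix.one_apply]
    set J := (1 : Matrix (Fin n) (Fin n) ℝ).submatrix id (Fin.castLE hmn) with hJ
    have hJ1 : ‖J‖ ≤ 1 := by
      refine opNorm_le_one_of_transpose_mul_self ?_
      ext i j
      simp [hJ, Matrix.mul_apply, Matrix.one_apply]
    have hmul : B₁ * W * B₂ * (B₂⁻¹ * J * D⁻¹ * B₁⁻¹) = 1 := by
      calc _ = B₁ * W * (B₂ * B₂⁻¹) * (J * D⁻¹ * B₁⁻¹) := by simp only [Matrix.mul_assoc]
        _ = B₁ * (W * J * D⁻¹) * B₁⁻¹ := by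
            rw [Matrix.mul_nonsing_inv _ h₂, Matrix.mul_one]; simp only [Matrix.mul_assoc]
        _ = 1 := by
            rw [← hD', Matrix.mul_nonsing_inv _ hDu, Matrix.mul_one, Matrix.mul_nonsing_inv _ h₁]
    obtain ⟨Q, hQ⟩ := exists_isColumnProjection_of_mul_eq_one hmul
    refine ⟨Q, hQ.mono ?_⟩
    refine (opNorm_mul_le_of_le (opNorm_mul_le_of_le (opNorm_mul_le_of_le hb₂ hJ1)
      (opNorm_inv_le_adjugate D)) hb₁).trans_eq ?_
    ring
  · obtain rfl : k = n := by omega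
    have hD' : D = (1 : Matrix (Fin m) (Fin m) ℝ).submatrix (Fin.castLE hmn) id * W := by
      rw [hD]; ext i j; simp [Matrix.mul_apply, Matrix.one_apply]
    set J := (1 : Matrix (Fin m) (Fin m) ℝ).submatrix (Fin.castLE hmn) id with hJ
    have hJ1 : ‖J‖ ≤ 1 := by
      rw [← opNorm_transpose]
      refine opNorm_le_one_of_transpose_mul_self ?_
      ext i j
      simp [hJ, Matrix.mul_apply, Matrix.one_apply]
    have hmul : B₂⁻¹ * D⁻¹ * J * B₁⁻¹ * (B₁ * W * B₂) = 1 := by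
      calc _ = B₂⁻¹ * D⁻¹ * J * (B₁⁻¹ * B₁) * (W * B₂) := by simp only [Matrix.mul_assoc]
        _ = B₂⁻¹ * (D⁻¹ * (J * W)) * B₂ := by
            rw [Matrix.nonsing_inv_mul _ h₁, Matrix.mul_one]; simp only [Matrix.mul_assoc]
        _ = 1 := by
            rw [← hD', Matrix.nonsing_inv_mul _ hDu, Matrix.mul_one, Matrix.nonsing_inv_mul _ h₂]
    obtain ⟨Q, hQ⟩ := exists_isColumnProjection_of_mul_eq_one' hmul
    refine ⟨Q, hQ.mono ?_⟩
    refine (opNorm_mul_le_of_le (opNorm_mul_le_of_le (opNorm_mul_le_of_le hb₂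
      (opNorm_inv_le_adjugate D)) hJ1) hb₁).trans_eq ?_
    ring

end Block

/-! ### Rotations aligning two orthonormal bases. -/

section Rotation

/-- The polar factor of an invertible contraction. -/
theorem exists_orthogonal_le_trace {m : ℕ} {O : Matrix (Fin m) (Fin m) ℝ} (hO : ‖O‖ ≤ 1)
    (hdet : O.det ≠ 0) :
    ∃ H : Matrix.orthogonalGroup (Fin m) ℝ,
      frobeniusNorm O ^ 2 ≤ ((H : Matrix (Fin m) (Fin m) ℝ)ᵀ * O).trace := by
  have hA : (Oᵀ * O).PosSemidef := by
    simpa using Matrix.posSemidef_conjTranspose_mul_self O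
  -- The rotation is H = O S⁻¹, so HᵀO = S. The eigenvalues of S lie in [0, 1], whence the trace of
  -- S is at least its squared Frobenius norm.
  set S := CFC.sqrt (Oᵀ * O) with hS
  have hST : Sᵀ = S := sqrt_transpose _
  have hSS : S * S = Oᵀ * O := CFC.sqrt_mul_sqrt_self _ hA.nonneg
  have hSdet : IsUnit S.det := by
    rw [isUnit_iff_ne_zero]
    intro h0
    have := congrArg Matrix.det hSS
    rw [Matrix.det_mul, Matrix.det_mul, Matrix.det_transpose, h0, zero_mul] at this
    exact hdet (mul_self_eq_zero.1 this.symm)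
  have hSinvT : (S⁻¹)ᵀ = S⁻¹ := by rw [Matrix.transpose_nonsing_inv, hST]
  have hH : O * S⁻¹ ∈ Matrix.orthogonalGroup (Fin m) ℝ := by
    rw [Matrix.mem_orthogonalGroup_iff', Matrix.transpose_mul, hSinvT]
    calc _ = S⁻¹ * (Oᵀ * O) * S⁻¹ := by simp only [Matrix.mul_assoc]
      _ = S⁻¹ * S * (S * S⁻¹) := by rw [← hSS]; simp only [Matrix.mul_assoc]
      _ = 1 := by rw [Matrix.nonsing_inv_mul _ hSdet, Matrix.mul_nonsing_inv _ hSdet, Matrix.one_mul]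
  refine ⟨⟨O * S⁻¹, hH⟩, ?_⟩
  have e1 : ((O * S⁻¹)ᵀ * O).trace = S.trace := by
    rw [Matrix.transpose_mul, hSinvT, Matrix.mul_assoc, ← hSS, ← Matrix.mul_assoc,
      Matrix.nonsing_inv_mul _ hSdet, Matrix.one_mul]
  change _ ≤ ((O * S⁻¹)ᵀ * O).trace
  rw [e1]
  have hSpos : S.PosSemidef := Matrix.nonneg_iff_posSemidef.1 (CFC.sqrt_nonneg _)
  have hS1 : ‖S‖ ≤ 1 := by
    have h1 : ‖S‖ ≤ √1 := opNorm_sqrt_le hA zero_le_one fun x => by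
      rw [← Matrix.mulVec_mulVec, Matrix.dotProduct_mulVec, ← Matrix.mulVec_transpose,
        Matrix.transpose_transpose]
      refine (mulVec_dotProduct_self_le O x).trans ?_
      have := dotProduct_self_nonneg' x
      gcongr
      exact pow_le_one₀ (norm_nonneg _) hO
    simpa using h1
  set B := CFC.sqrt S with hB
  have hBT : Bᵀ = B := sqrt_transpose _
  have hBB : B * B = S := CFC.sqrt_mul_sqrt_self _ hSpos.nonneg
  have hB1 : ‖B‖ ≤ 1 := by
    have h1 := Matrix.l2_opNorm_conjTranspose_mul_self B
    rw [Matrix.conjTranspose_eq_transpose_of_trivial, hBT, hBB] at h1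
    nlinarith [norm_nonneg B]
  calc frobeniusNorm O ^ 2 = frobeniusNorm S ^ 2 := by
        rw [frobeniusNorm_sq_eq_trace, ← hSS, frobeniusNorm_sq_eq_trace, hST]
    _ ≤ frobeniusNorm B ^ 2 := by
        refine pow_le_pow_left₀ (frobeniusNorm_nonneg _) ?_ 2
        rw [← hBB]
        exact (frobeniusNorm_mul_le _ _).trans
          (mul_le_of_le_one_left (frobeniusNorm_nonneg _) hB1)
    _ = S.trace := by rw [frobeniusNorm_sq_eq_trace, hBT, hBB]

theorem frobeniusNorm_sub_mul_sq {n m : ℕ} {U U' : Matrix (Fin n) (Fin m) ℝ} (hU : Uᵀ * U = 1)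
    (hU' : U'ᵀ * U' = 1) (H : Matrix.orthogonalGroup (Fin m) ℝ) :
    frobeniusNorm (U' - U * (H : Matrix (Fin m) (Fin m) ℝ)) ^ 2 =
      2 * m - 2 * ((H : Matrix (Fin m) (Fin m) ℝ)ᵀ * (Uᵀ * U')).trace := by
  have hH : (H : Matrix (Fin m) (Fin m) ℝ)ᵀ * (H : Matrix (Fin m) (Fin m) ℝ) = 1 := by
    exact (Matrix.mem_orthogonalGroup_iff' _ _).1 H.2
  have e1 : (U'ᵀ * (U * (H : Matrix (Fin m) (Fin m) ℝ))).trace =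
      ((H : Matrix (Fin m) (Fin m) ℝ)ᵀ * (Uᵀ * U')).trace := by
    rw [← Matrix.trace_transpose]
    simp [Matrix.transpose_mul, Matrix.mul_assoc]
  have e2 : (U * (H : Matrix (Fin m) (Fin m) ℝ))ᵀ * (U * (H : Matrix (Fin m) (Fin m) ℝ)) = 1 := by
    rw [Matrix.transpose_mul, Matrix.mul_assoc, ← Matrix.mul_assoc Uᵀ, hU, Matrix.one_mul, hH]
  rw [frobeniusNorm_sq_eq_trace, Matrix.transpose_sub, Matrix.sub_mul, Matrix.mul_sub,
    Matrix.mul_sub, hU', e2, Matrix.trace_sub, Matrix.trace_sub, Matrix.trace_sub, e1,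
    Matrix.trace_one, Fintype.card_fin, Matrix.transpose_mul, Matrix.mul_assoc]
  ring

/-- A measurable choice of rotations which almost attains the distance between two subspaces. -/
theorem exists_measurable_rotation (m : ℕ) {ε : ℝ} (hε : 0 < ε) :
    ∃ f : Matrix (Fin m) (Fin m) ℝ → Matrix.orthogonalGroup (Fin m) ℝ,
      (∀ {Ω : Type*} [MeasurableSpace Ω] (O : Ω → Matrix (Fin m) (Fin m) ℝ),
        (∀ a b, Measurable fun ω => O ω a b) →
          ∀ a b, Measurable fun ω => (f (O ω) : Matrix (Fin m) (Fin m) ℝ) a b) ∧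
      ∀ {n : ℕ} (U U' : Matrix (Fin n) (Fin m) ℝ), Uᵀ * U = 1 → U'ᵀ * U' = 1 →
        frobeniusNorm (U' - U * (f (Uᵀ * U') : Matrix (Fin m) (Fin m) ℝ)) ^ 2 ≤
          (4 * m + 1) * frobeniusNorm (U' * U'ᵀ - U * Uᵀ) ^ 2 + ε := by
  classical
  have hsc : SecondCountableTopology (Matrix (Fin m) (Fin m) ℝ) :=
    inferInstanceAs (SecondCountableTopology (Fin m → Fin m → ℝ))
  have hsep : TopologicalSpace.SeparableSpace (Matrix.orthogonalGroup (Fin m) ℝ) := inferInstance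
  -- Taking the first suitable member of a dense sequence makes the rotation a measurable function
  -- of O; the price is the additive ε.
  set h : ℕ → Matrix.orthogonalGroup (Fin m) ℝ := TopologicalSpace.denseSeq _ with hh
  set good : Matrix (Fin m) (Fin m) ℝ → ℕ → Prop := fun O k =>
    frobeniusNorm O ^ 2 - ε / 2 < ((h k : Matrix (Fin m) (Fin m) ℝ)ᵀ * O).trace with hgood
  -- The second alternative makes the search stop at 0 when no index is good.
  have hex : ∀ O, ∃ k, good O k ∨ ∀ j, ¬ good O j := by
    intro O
    by_cases hO : ∃ k, good O k
    · exact ⟨hO.choose, Or.inl hO.choose_spec⟩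
    · exact ⟨0, Or.inr (not_exists.1 hO)⟩
  refine ⟨fun O => h (Nat.find (hex O)), ?_, ?_⟩
  · intro Ω _ O hO a b
    have hg : ∀ k, MeasurableSet {ω | good (O ω) k} := by
      intro k
      refine measurableSet_lt ?_ ?_
      · simp only [frobeniusNorm_sq]
        fun_prop
      · simp only [Matrix.trace, Matrix.diag, Matrix.mul_apply]
        fun_prop
    have hN : Measurable fun ω => Nat.find (hex (O ω)) := by
      refine measurable_find (fun ω => hex (O ω)) fun k => ?_
      refine (hg k).union ?_
      have : {ω | ∀ j, ¬ good (O ω) j} = ⋂ j, {ω | good (O ω) j}ᶜ := by ext; simp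
      change MeasurableSet {ω | ∀ j, ¬ good (O ω) j}
      rw [this]
      exact MeasurableSet.iInter fun j => (hg j).compl
    exact (measurable_from_nat (f := fun k => (h k : Matrix (Fin m) (Fin m) ℝ) a b)).comp hN
  · intro n U U' hU hU'
    dsimp only
    have hUn := opNorm_le_one_of_transpose_mul_self hU
    have hUn' := opNorm_le_one_of_transpose_mul_self hU'
    have hO1 : ‖Uᵀ * U'‖ ≤ 1 := by
      rw [← opNorm_transpose] at hUn
      simpa using opNorm_mul_le_of_le hUn hUn'
    have hUF : frobeniusNorm (Uᵀ * U') ^ 2 = (U' * U'ᵀ * (U * Uᵀ)).trace := by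
      rw [frobeniusNorm_sq_eq_trace, Matrix.transpose_mul, Matrix.transpose_transpose,
        Matrix.mul_assoc, Matrix.trace_mul_comm, Matrix.trace_mul_comm (U' * U'ᵀ)]
      simp only [Matrix.mul_assoc]
    have idem : ∀ {V : Matrix (Fin n) (Fin m) ℝ}, Vᵀ * V = 1 →
        V * Vᵀ * (V * Vᵀ) = V * Vᵀ ∧ (V * Vᵀ).trace = m := by
      intro V hV
      constructor
      · rw [Matrix.mul_assoc, ← Matrix.mul_assoc Vᵀ, hV, Matrix.one_mul]
      · rw [Matrix.trace_mul_comm, hV]; simp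
    have hD := frobeniusNorm_sub_sq_of_projections (P := U * Uᵀ) (Q := U' * U'ᵀ) (by simp)
      (idem hU).1 (by simp) (idem hU').1
    rw [(idem hU).2, (idem hU').2, ← hUF] at hD
    have hD0 := sq_nonneg (frobeniusNorm (U' * U'ᵀ - U * Uᵀ))
    have hm : (0 : ℝ) ≤ m := by positivity
    -- In the singular case some vector in the range of U' is orthogonal to the range of U. The
    -- subspace distance is then at least 1, while every rotation leaves an error of at most 4m.
    by_cases hdet : (Uᵀ * U').det = 0
    · have h1 : 1 ≤ frobeniusNorm (U' * U'ᵀ - U * Uᵀ) ^ 2 := by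
        obtain ⟨v, hv0, hv⟩ := Matrix.exists_mulVec_eq_zero_iff.2 hdet
        have hvv : 0 < (U' *ᵥ v) ⬝ᵥ (U' *ᵥ v) := by
          rw [Matrix.dotProduct_mulVec, Matrix.vecMul_mulVec, hU', Matrix.vecMul_one]
          exact lt_of_le_of_ne (dotProduct_self_nonneg' v)
            (fun h => hv0 (dotProduct_self_eq_zero.1 h.symm))
        have h2 := mulVec_dotProduct_self_le (U' * U'ᵀ - U * Uᵀ) (U' *ᵥ v)
        have h3 : (U' * U'ᵀ - U * Uᵀ) *ᵥ (U' *ᵥ v) = U' *ᵥ v := by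
          rw [Matrix.sub_mulVec, Matrix.mulVec_mulVec, Matrix.mul_assoc, hU', Matrix.mul_one,
            ← Matrix.mulVec_mulVec, Matrix.mulVec_mulVec _ Uᵀ, hv, Matrix.mulVec_zero, sub_zero]
        rw [h3] at h2
        have h4 : 1 ≤ ‖U' * U'ᵀ - U * Uᵀ‖ ^ 2 := by nlinarith
        exact h4.trans (pow_le_pow_left₀ (norm_nonneg _) (opNorm_le_frobeniusNorm _) 2)
      have h5 : frobeniusNorm (U' - U * (h (Nat.find (hex (Uᵀ * U'))) :
          Matrix (Fin m) (Fin m) ℝ)) ^ 2 ≤ 4 * m := by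
        set H := h (Nat.find (hex (Uᵀ * U')))
        have hH : (H : Matrix (Fin m) (Fin m) ℝ)ᵀ * (H : Matrix (Fin m) (Fin m) ℝ) = 1 := by
          exact (Matrix.mem_orthogonalGroup_iff' _ _).1 H.2
        have e0 := sq_nonneg (frobeniusNorm (U' + U * (H : Matrix (Fin m) (Fin m) ℝ)))
        have e1 : frobeniusNorm (U' + U * (H : Matrix (Fin m) (Fin m) ℝ)) ^ 2 +
            frobeniusNorm (U' - U * (H : Matrix (Fin m) (Fin m) ℝ)) ^ 2 = 4 * m := by
          have e2 : (U * (H : Matrix (Fin m) (Fin m) ℝ))ᵀ *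
              (U * (H : Matrix (Fin m) (Fin m) ℝ)) = 1 := by
            rw [Matrix.transpose_mul, Matrix.mul_assoc, ← Matrix.mul_assoc Uᵀ, hU,
              Matrix.one_mul, hH]
          rw [frobeniusNorm_sq_eq_trace, frobeniusNorm_sq_eq_trace, ← Matrix.trace_add,
            Matrix.transpose_sub, Matrix.transpose_add, Matrix.add_mul, Matrix.mul_add,
            Matrix.mul_add, Matrix.sub_mul, Matrix.mul_sub, Matrix.mul_sub, hU', e2]
          simp only [Matrix.trace_add, Matrix.trace_sub, Matrix.trace_one, Fintype.card_fin]
          ring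
        linarith
      nlinarith
    · obtain ⟨H, hH⟩ := exists_orthogonal_le_trace hO1 hdet
      have hexg : ∃ k, good (Uᵀ * U') k := by
        have hcont : Continuous fun H : Matrix.orthogonalGroup (Fin m) ℝ =>
            ((H : Matrix (Fin m) (Fin m) ℝ)ᵀ * (Uᵀ * U')).trace := by fun_prop
        exact (TopologicalSpace.denseRange_denseSeq
          (Matrix.orthogonalGroup (Fin m) ℝ)).exists_mem_open
            (isOpen_Ioi.preimage hcont (t := Set.Ioi (frobeniusNorm (Uᵀ * U') ^ 2 - ε / 2)))
            ⟨H, show frobeniusNorm (Uᵀ * U') ^ 2 - ε / 2 <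
              ((H : Matrix (Fin m) (Fin m) ℝ)ᵀ * (Uᵀ * U')).trace by linarith⟩
      have hfind := (Nat.find_spec (hex (Uᵀ * U'))).resolve_right
        (fun hn => hn _ hexg.choose_spec)
      -- With O = UᵀU', this error is 2m - 2 tr(HᵀO), and the squared subspace distance is 2m -
      -- 2‖O‖² in Frobenius norm; goodness of the index compares the two.
      rw [frobeniusNorm_sub_mul_sq hU hU']
      have hfind' := hfind
      simp only [hgood] at hfind'
      nlinarith

end Rotation

/-! ### Standard Gaussian coordinates. -/

section GaussianVectors

/-- The law of finitely many independent standard Gaussian variables. -/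
noncomputable abbrev stdGaussianPi (κ : Type*) [Fintype κ] : Measure (κ → ℝ) :=
  Measure.pi fun _ => gaussianReal 0 1

theorem map_comp_stdGaussianPi {κ α : Type*} [Fintype κ] [Fintype α] {e : α → κ}
    (he : Function.Injective e) :
    (stdGaussianPi κ).map (fun z a => z (e a)) = stdGaussianPi α := by
  have h1 : iIndepFun (fun (k : κ) (z : κ → ℝ) => z k) (stdGaussianPi κ) :=
    iIndepFun_pi (X := fun _ => id) fun _ => aemeasurable_id
  have h2 := (iIndepFun_iff_map_fun_eq_pi_map (fun a => (measurable_pi_apply (e a)).aemeasurable)).1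
    (h1.precomp he)
  rw [h2]
  congr 1
  ext1 a
  exact (measurePreserving_eval (fun _ : κ => gaussianReal 0 1) (e a)).map_eq

theorem lintegral_comp_stdGaussianPi {κ α : Type*} [Fintype κ] [Fintype α] {e : α → κ}
    (he : Function.Injective e) {f : (α → ℝ) → ℝ≥0∞} (hf : Measurable f) :
    ∫⁻ z, f (fun a => z (e a)) ∂stdGaussianPi κ = ∫⁻ w, f w ∂stdGaussianPi α := by
  rw [← map_comp_stdGaussianPi he, lintegral_map hf (by fun_prop)]

theorem lintegral_exp_linear_stdGaussianPi {α : Type*} [Fintype α] (a : α → ℝ) :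
    ∫⁻ w, ENNReal.ofReal (Real.exp (∑ i, a i * w i)) ∂stdGaussianPi α =
      ENNReal.ofReal (Real.exp (∑ i, a i ^ 2 / 2)) := by
  have h1 : ∀ i, Integrable (fun x => Real.exp (a i * x)) (gaussianReal 0 1) :=
    fun i => integrable_exp_mul_gaussianReal (a i)
  have h2 : Integrable (fun w : α → ℝ => ∏ i, Real.exp (a i * w i)) (stdGaussianPi α) :=
    Integrable.fintype_prod h1
  simp only [Real.exp_sum]
  rw [← ofReal_integral_eq_lintegral_ofReal h2 (ae_of_all _ fun w => by positivity)]
  congr 1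
  rw [integral_fintype_prod_eq_prod (fun i x => Real.exp (a i * x))]
  refine Finset.prod_congr rfl fun i _ => ?_
  have := congrFun (mgf_fun_id_gaussianReal (μ := 0) (v := 1)) (a i)
  simp only [mgf] at this
  rw [this]
  simp

end GaussianVectors

/-! ### Negative moments of Gaussian determinants. -/

section SmallBall

/-- Any order below 1 is integrable at 0. The order 3/4 also exceeds the 1/2 needed later, which
leaves room to multiply by other factors. -/
theorem lintegral_Icc_enorm_rpow_lt_top :
    ∫⁻ u in Set.Icc (-1 : ℝ) 1, ‖u‖ₑ ^ (-(3 / 4) : ℝ) < ∞ := by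
  have h0 : ∫⁻ u in Set.Ioc (0 : ℝ) 1, ‖u‖ₑ ^ (-(3 / 4) : ℝ) < ∞ := by
    have h1 : IntegrableOn (fun x : ℝ => x ^ (-(3 / 4) : ℝ)) (Set.Ioc 0 1) :=
      (intervalIntegrable_iff_integrableOn_Ioc_of_le zero_le_one).1
        (intervalIntegral.intervalIntegrable_rpow' (by norm_num))
    refine lt_of_le_of_lt (lintegral_mono_ae ?_) h1.2
    filter_upwards [ae_restrict_mem measurableSet_Ioc] with x hx
    rw [Real.enorm_eq_ofReal_abs, Real.enorm_eq_ofReal_abs, abs_of_pos hx.1,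
      abs_of_pos (Real.rpow_pos_of_pos hx.1 _), ENNReal.ofReal_rpow_of_pos hx.1]
  have hsub : Set.Icc (-1 : ℝ) 1 ⊆ (Set.Ioc 0 1 ∪ (fun x => -x) ⁻¹' Set.Ioc (0 : ℝ) 1) ∪ {0} := by
    intro x hx
    rcases lt_trichotomy x 0 with h | h | h
    · left; right; exact ⟨by linarith, by linarith [hx.1]⟩
    · right; exact h
    · left; left; exact ⟨h, hx.2⟩
  refine lt_of_le_of_lt (lintegral_mono_set hsub) ?_
  refine lt_of_le_of_lt (lintegral_union_le _ _ _) (ENNReal.add_lt_top.2 ⟨?_, by simp⟩)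
  refine lt_of_le_of_lt (lintegral_union_le _ _ _) (ENNReal.add_lt_top.2 ⟨h0, ?_⟩)
  have h3 := (Measure.measurePreserving_neg (volume : Measure ℝ)).setLIntegral_comp_preimage
    (s := Set.Ioc 0 1) measurableSet_Ioc (f := fun u => ‖u‖ₑ ^ (-(3 / 4) : ℝ)) (by fun_prop)
  simp only [enorm_neg] at h3
  rw [show (Neg.neg : ℝ → ℝ) = fun x => -x from rfl] at h3
  rw [h3]
  exact h0

/-- A uniform bound for negative moments of shifted Gaussian variables. -/
theorem exists_lintegral_enorm_add_rpow_le : ∃ K : ℝ≥0∞, 1 ≤ K ∧ K ≠ ∞ ∧ ∀ m : ℝ,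
    ∫⁻ y, ‖y + m‖ₑ ^ (-(3 / 4) : ℝ) ∂gaussianReal 0 1 ≤ K := by
  refine ⟨(∫⁻ u in Set.Icc (-1 : ℝ) 1, ‖u‖ₑ ^ (-(3 / 4) : ℝ)) + 1, le_add_self,
    (ENNReal.add_lt_top.2 ⟨lintegral_Icc_enorm_rpow_lt_top, ENNReal.one_lt_top⟩).ne, fun m => ?_⟩
  -- Outside [-1, 1] the integrand is at most 1. Inside, the Gaussian density is at most 1, and
  -- translation invariance of Lebesgue measure makes the bound uniform in m.
  set f : ℝ → ℝ≥0∞ := (Set.Icc (-1 : ℝ) 1).indicator fun u => ‖u‖ₑ ^ (-(3 / 4) : ℝ) with hf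
  have hfm : Measurable f := (by fun_prop : Measurable fun u : ℝ =>
    ‖u‖ₑ ^ (-(3 / 4) : ℝ)).indicator measurableSet_Icc
  have h1 : ∀ y : ℝ, ‖y + m‖ₑ ^ (-(3 / 4) : ℝ) ≤ f (y + m) + 1 := by
    intro y
    by_cases hy : y + m ∈ Set.Icc (-1 : ℝ) 1
    · rw [hf, Set.indicator_of_mem hy]; exact le_self_add
    · refine le_trans ?_ le_add_self
      have h2 : 1 ≤ ‖y + m‖ₑ := by
        rw [Real.enorm_eq_ofReal_abs, ENNReal.one_le_ofReal]
        by_contra! h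
        exact hy ⟨(abs_lt.1 h).1.le, (abs_lt.1 h).2.le⟩
      exact ENNReal.rpow_le_one_of_one_le_of_neg h2 (by norm_num)
  calc _ ≤ ∫⁻ y, f (y + m) + 1 ∂gaussianReal 0 1 := lintegral_mono h1
    _ = (∫⁻ y, f (y + m) ∂gaussianReal 0 1) + 1 := by
        rw [lintegral_add_right _ measurable_const]; simp
    _ ≤ _ := by
        refine add_le_add ?_ le_rfl
        rw [gaussianReal_of_var_ne_zero _ one_ne_zero,
          lintegral_withDensity_eq_lintegral_mul _ (measurable_gaussianPDF _ _) (by fun_prop)]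
        calc _ ≤ ∫⁻ y, f (y + m) := by
              refine lintegral_mono fun y => ?_
              refine mul_le_of_le_one_left (zero_le) ?_
              rw [gaussianPDF, ENNReal.ofReal_le_one, gaussianPDFReal]
              have h3 : 1 ≤ √(2 * Real.pi * ((1 : NNReal) : ℝ)) := by
                rw [Real.one_le_sqrt]
                have := Real.pi_gt_three
                simp only [NNReal.coe_one]
                linarith
              have h4 : Real.exp (-(y - 0) ^ 2 / (2 * ((1 : NNReal) : ℝ))) ≤ 1 := by
                rw [Real.exp_le_one_iff]
                have := sq_nonneg (y - 0)
                simp only [NNReal.coe_one]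
                linarith
              exact mul_le_one₀ (inv_le_one_of_one_le₀ h3) (Real.exp_pos _).le h4
          _ = ∫⁻ y, f y := lintegral_add_right_eq_self f m
          _ = _ := by rw [hf, lintegral_indicator measurableSet_Icc]

/-- Integrating over coordinate k alone, the slope c factors out and leaves a shifted Gaussian
variable. Where c vanishes the right side is infinite, since 0 to a negative power is ∞ and K ≥ 1.
-/
theorem lintegral_enorm_affine_rpow_le {κ : Type*} [Fintype κ] [DecidableEq κ] {K : ℝ≥0∞}
    (hK1 : 1 ≤ K) (hK : ∀ m : ℝ, ∫⁻ y, ‖y + m‖ₑ ^ (-(3 / 4) : ℝ) ∂gaussianReal 0 1 ≤ K)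
    (k : κ) {c d : (κ → ℝ) → ℝ} (hc : Measurable c) (hd : Measurable d)
    (hcu : ∀ z y, c (Function.update z k y) = c z) (hdu : ∀ z y, d (Function.update z k y) = d z) :
    ∫⁻ z, ‖z k * c z + d z‖ₑ ^ (-(3 / 4) : ℝ) ∂stdGaussianPi κ ≤
      K * ∫⁻ z, ‖c z‖ₑ ^ (-(3 / 4) : ℝ) ∂stdGaussianPi κ := by
  rw [← lintegral_const_mul _ (by fun_prop)]
  refine lintegral_le_of_lmarginal_le {k} (by fun_prop) (by fun_prop) ?_
  rw [lmarginal_singleton, lmarginal_singleton]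
  intro z
  simp only [hcu, hdu, Function.update_self]
  rw [lintegral_const, measure_univ, mul_one]
  by_cases h0 : c z = 0
  · rw [h0, enorm_zero, ENNReal.zero_rpow_of_neg (by norm_num),
      ENNReal.mul_top (zero_lt_one.trans_le hK1).ne']
    exact le_top
  · calc _ = ∫⁻ y, ‖y + d z / c z‖ₑ ^ (-(3 / 4) : ℝ) * ‖c z‖ₑ ^ (-(3 / 4) : ℝ)
          ∂gaussianReal 0 1 := by
          refine lintegral_congr fun y => ?_
          rw [← ENNReal.mul_rpow_of_ne_top enorm_ne_top enorm_ne_top, ← enorm_mul, add_mul,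
            div_mul_cancel₀ _ h0]
      _ = (∫⁻ y, ‖y + d z / c z‖ₑ ^ (-(3 / 4) : ℝ) ∂gaussianReal 0 1) *
          ‖c z‖ₑ ^ (-(3 / 4) : ℝ) := lintegral_mul_const _ (by fun_prop)
      _ ≤ _ := by gcongr; exact hK _

/-- Negative moments of the determinant of a Gaussian matrix. -/
theorem lintegral_enorm_det_rpow_le {K : ℝ≥0∞}
    (hK1 : 1 ≤ K) (hK : ∀ m : ℝ, ∫⁻ y, ‖y + m‖ₑ ^ (-(3 / 4) : ℝ) ∂gaussianReal 0 1 ≤ K)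
    {κ : Type*} [Fintype κ] (n : ℕ) (e : Fin n × Fin n → κ) (he : Function.Injective e) :
    ∫⁻ z, ‖(Matrix.of fun i j => z (e (i, j))).det‖ₑ ^ (-(3 / 4) : ℝ) ∂stdGaussianPi κ ≤
      K ^ n := by
  classical
  induction n with
  | zero => simp
  | succ n ih =>
    set e' : Fin n × Fin n → κ := fun a => e (a.1.succ, a.2.succ) with he'
    have he'i : Function.Injective e' := by
      intro a b hab
      have := he hab
      simp only [Prod.mk.injEq, Fin.succ_inj] at this
      exact Prod.ext this.1 this.2
    -- Laplace expansion along the first row: the determinant is affine in the entry (0, 0), its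
    -- slope c is the complementary minor, and neither c nor d involves that entry.
    set c : (κ → ℝ) → ℝ := fun z => (Matrix.of fun i j => z (e' (i, j))).det with hc
    set d : (κ → ℝ) → ℝ := fun z => ∑ j : Fin n, (-1) ^ ((j.succ : Fin (n + 1)) : ℕ) *
      z (e (0, j.succ)) * ((Matrix.of fun i j => z (e (i, j))).submatrix Fin.succ
        j.succ.succAbove).det with hd
    have hdet : ∀ z : κ → ℝ, (Matrix.of fun i j => z (e (i, j))).det =
        z (e (0, 0)) * c z + d z := by
      intro z
      rw [Matrix.det_succ_row_zero, Fin.sum_univ_succ]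
      simp only [hc, hd, he']
      congr 1
      simp only [Fin.val_zero, pow_zero, one_mul, Matrix.of_apply]
      congr 1
    have hcm : Measurable c := by
      have : Continuous c := by
        refine Continuous.matrix_det ?_
        exact continuous_matrix fun i j => continuous_apply _
      exact this.measurable
    have hdm : Measurable d := by
      have : Continuous d := by
        refine continuous_finsetSum _ fun j _ => (continuous_const.mul (continuous_apply _)).mul ?_
        refine Continuous.matrix_det ?_
        exact continuous_matrix fun i j => continuous_apply _
      exact this.measurable
    have hne : ∀ a : Fin (n + 1) × Fin (n + 1), a ≠ (0, 0) → ∀ (z : κ → ℝ) y,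
        Function.update z (e (0, 0)) y (e a) = z (e a) := by
      intro a ha z y
      exact Function.update_of_ne (fun h => ha (he h)) _ _
    have h1 := lintegral_enorm_affine_rpow_le hK1 hK (e (0, 0)) hcm hdm
      (fun z y => by
        simp only [hc, he']
        congr 2
        ext i j
        exact hne _ (by simp) z y)
      (fun z y => by
        simp only [hd]
        refine Finset.sum_congr rfl fun j _ => ?_
        rw [hne _ (by simp)]
        congr 2
        ext i j'
        exact hne _ (by simp) z y)
    simp only [hdet]
    refine h1.trans ?_
    rw [pow_succ']
    gcongr
    exact ih e' he'i

end SmallBall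

/-! ### Operator norm of a Gaussian matrix. -/

section OperatorNormMoments

variable {p q : ℕ}

/-- The matrix whose entries are listed by `w`. -/
def entryMatrix {p q : ℕ} (w : Fin p × Fin q → ℝ) : Matrix (Fin p) (Fin q) ℝ :=
  Matrix.of fun i j => w (i, j)

theorem continuous_entryMatrix : Continuous (entryMatrix : (Fin p × Fin q → ℝ) → Matrix _ _ ℝ) :=
  continuous_matrix fun i j => continuous_apply (i, j)

theorem measurable_opNorm_entryMatrix : Measurable fun w : Fin p × Fin q → ℝ => ‖entryMatrix w‖ :=
  (continuous_norm.comp continuous_entryMatrix).measurable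

theorem inner_toEuclideanLin_entryMatrix (w : Fin p × Fin q → ℝ) (u : EuclideanSpace ℝ (Fin p))
    (v : EuclideanSpace ℝ (Fin q)) :
    inner ℝ u (Matrix.toEuclideanLin (entryMatrix w) v) = ∑ a : Fin p × Fin q, u a.1 * v a.2 * w a := by
  rw [Fintype.sum_prod_type]
  simp only [PiLp.inner_apply, Matrix.ofLp_toLpLin, Matrix.toLin'_apply, entryMatrix, mulVec, dotProduct,
    Matrix.of_apply, RCLike.inner_apply, conj_trivial, Finset.sum_mul]
  exact Finset.sum_congr rfl fun i _ => Finset.sum_congr rfl fun j _ => by ring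

/-- Around a pair of leading singular vectors the bilinear form of a matrix is comparable to its
norm. -/
theorem exists_le_inner_of_mem_ball (A : Matrix (Fin p) (Fin q) ℝ) :
    ∃ (u₀ : EuclideanSpace ℝ (Fin p)) (v₀ : EuclideanSpace ℝ (Fin q)), ‖u₀‖ ≤ 1 ∧ ‖v₀‖ ≤ 1 ∧
      ∀ u ∈ Metric.ball u₀ (1 / 4), ∀ v ∈ Metric.ball v₀ (1 / 4),
        ‖A‖ / 4 ≤ inner ℝ u (Matrix.toEuclideanLin A v) := by
  set f := LinearMap.toContinuousLinearMap (Matrix.toEuclideanLin A) with hf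
  have hfn : ‖A‖ = ‖f‖ := rfl
  have hfa : ∀ v, Matrix.toEuclideanLin A v = f v := fun v => rfl
  rcases (norm_nonneg A).eq_or_lt with h0 | h0
  · refine ⟨0, 0, by simp, by simp, fun u _ v _ => ?_⟩
    have : f = 0 := norm_eq_zero.1 (hfn.symm.trans h0.symm)
    rw [hfa, this, ← h0]
    simp
  -- The value 15/16 survives the moves of u and v: they cost at most 1/4 and 5/16 of ‖A‖, leaving
  -- 3/8.
  obtain ⟨v₀, hv₀, hv⟩ := f.exists_lt_apply_of_lt_opNorm (r := 15 / 16 * ‖A‖)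
    (by rw [← hfn]; linarith)
  have hpos : 0 < ‖f v₀‖ := lt_trans (by positivity) hv
  refine ⟨‖f v₀‖⁻¹ • f v₀, v₀, ?_, hv₀.le, fun u hu v hv' => ?_⟩
  · rw [norm_smul, norm_inv, norm_norm, inv_mul_cancel₀ hpos.ne']
  set u₀ := ‖f v₀‖⁻¹ • f v₀ with hu₀
  have hu₀1 : ‖u₀‖ = 1 := by rw [norm_smul, norm_inv, norm_norm, inv_mul_cancel₀ hpos.ne']
  rw [Metric.mem_ball, dist_eq_norm] at hu hv'
  have e0 : inner ℝ u₀ (f v₀) = ‖f v₀‖ := by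
    rw [hu₀, real_inner_smul_left, real_inner_self_eq_norm_sq]
    field_simp
  have e1 : inner ℝ u (f v) = inner ℝ u₀ (f v₀) + inner ℝ u₀ (f (v - v₀)) +
      inner ℝ (u - u₀) (f v) := by
    rw [map_sub, inner_sub_right, inner_sub_left]; ring
  have hvn : ‖v‖ ≤ 5 / 4 := by
    have : ‖v‖ ≤ ‖v - v₀‖ + ‖v₀‖ := by simpa using norm_add_le (v - v₀) v₀
    linarith
  have e2 : |inner ℝ u₀ (f (v - v₀))| ≤ ‖A‖ * (1 / 4) := by
    refine (abs_real_inner_le_norm _ _).trans ?_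
    rw [hu₀1, one_mul]
    exact (f.le_opNorm _).trans (mul_le_mul_of_nonneg_left hv'.le (norm_nonneg _))
  have e3 : |inner ℝ (u - u₀) (f v)| ≤ 1 / 4 * (‖A‖ * (5 / 4)) := by
    refine (abs_real_inner_le_norm _ _).trans ?_
    exact mul_le_mul hu.le ((f.le_opNorm _).trans (mul_le_mul_of_nonneg_left hvn (norm_nonneg _)))
      (norm_nonneg _) (by norm_num)
  rw [hfa, e1, e0]
  linarith [(abs_le.1 e2).1, (abs_le.1 e3).1]

/-- The bilinear form is Gaussian with variance ‖u‖²‖v‖² ≤ 16. -/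
theorem lintegral_exp_inner_le {t : ℝ} {u : EuclideanSpace ℝ (Fin p)} (hu : ‖u‖ ≤ 2)
    {v : EuclideanSpace ℝ (Fin q)} (hv : ‖v‖ ≤ 2) :
    ∫⁻ w, ENNReal.ofReal (Real.exp (t * inner ℝ u (Matrix.toEuclideanLin (entryMatrix w) v)))
        ∂stdGaussianPi (Fin p × Fin q) ≤ ENNReal.ofReal (Real.exp (8 * t ^ 2)) := by
  have h1 : ∀ w : Fin p × Fin q → ℝ, t * inner ℝ u (Matrix.toEuclideanLin (entryMatrix w) v) =
      ∑ a, (t * (u a.1 * v a.2)) * w a := by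
    intro w
    rw [inner_toEuclideanLin_entryMatrix, Finset.mul_sum]
    exact Finset.sum_congr rfl fun a _ => by ring
  simp only [h1]
  rw [lintegral_exp_linear_stdGaussianPi]
  refine ENNReal.ofReal_le_ofReal (Real.exp_le_exp.2 ?_)
  have h2 : ∑ a : Fin p × Fin q, (t * (u a.1 * v a.2)) ^ 2 / 2 =
      t ^ 2 / 2 * (‖u‖ ^ 2 * ‖v‖ ^ 2) := by
    rw [EuclideanSpace.real_norm_sq_eq, EuclideanSpace.real_norm_sq_eq, Finset.sum_mul_sum,
      Fintype.sum_prod_type, Finset.mul_sum]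
    refine Finset.sum_congr rfl fun i _ => ?_
    rw [Finset.mul_sum]
    exact Finset.sum_congr rfl fun j _ => by ring
  rw [h2]
  have h3 : ‖u‖ ^ 2 ≤ 4 := by nlinarith [norm_nonneg u]
  have h4 : ‖v‖ ^ 2 ≤ 4 := by nlinarith [norm_nonneg v]
  have h5 : ‖u‖ ^ 2 * ‖v‖ ^ 2 ≤ 4 * 4 := mul_le_mul h3 h4 (by positivity) (by norm_num)
  nlinarith [sq_nonneg t]

theorem volume_ball_two (n : ℕ) (x : EuclideanSpace ℝ (Fin n)) :
    volume (Metric.ball (0 : EuclideanSpace ℝ (Fin n)) 2) =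
      8 ^ n * volume (Metric.ball x (1 / 4)) := by
  rw [Measure.addHaar_ball_of_pos _ _ two_pos, Measure.addHaar_ball_of_pos _ x (by norm_num),
    ← mul_assoc]
  congr 1
  rw [finrank_euclideanSpace_fin, show (8 : ℝ≥0∞) ^ n = ENNReal.ofReal (8 ^ n) by
    rw [ENNReal.ofReal_pow (by norm_num)]; simp, ← ENNReal.ofReal_mul (by positivity), ← mul_pow]
  norm_num

/-- Exponential moments of the operator norm of a Gaussian matrix, by a volume comparison. -/
theorem lintegral_exp_opNorm_le {t : ℝ} (ht : 0 ≤ t) :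
    ∫⁻ w, ENNReal.ofReal (Real.exp (t * (‖(entryMatrix w : Matrix (Fin p) (Fin q) ℝ)‖ / 4)))
        ∂stdGaussianPi (Fin p × Fin q) ≤
      8 ^ (p + q) * ENNReal.ofReal (Real.exp (8 * t ^ 2)) := by
  set bp := volume (Metric.ball (0 : EuclideanSpace ℝ (Fin p)) (1 / 4)) with hbp
  set bq := volume (Metric.ball (0 : EuclideanSpace ℝ (Fin q)) (1 / 4)) with hbq
  have hball : ∀ (n : ℕ) (x : EuclideanSpace ℝ (Fin n)), volume (Metric.ball x (1 / 4)) =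
      volume (Metric.ball (0 : EuclideanSpace ℝ (Fin n)) (1 / 4)) :=
    fun n x => Measure.addHaar_ball_center _ _ _
  -- Integrating over u and v in place of a supremum over a net: the radius-2 balls contain the
  -- 1/4-balls around any leading pair, and the volume ratio is 8^(p+q).
  set B : Set (EuclideanSpace ℝ (Fin p) × EuclideanSpace ℝ (Fin q)) := Metric.ball 0 2 ×ˢ Metric.ball 0 2 with hB
  have hBm : MeasurableSet B := measurableSet_ball.prod measurableSet_ball
  set F : (Fin p × Fin q → ℝ) → EuclideanSpace ℝ (Fin p) × EuclideanSpace ℝ (Fin q) → ℝ≥0∞ := fun w x =>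
    ENNReal.ofReal (Real.exp (t * inner ℝ x.1 (Matrix.toEuclideanLin (entryMatrix w) x.2))) with hF
  have hFm : Measurable (Function.uncurry F) := by
    simp only [hF, Function.uncurry_def, inner_toEuclideanLin_entryMatrix]
    fun_prop
  have hlow : ∀ w, ENNReal.ofReal (Real.exp (t * (‖entryMatrix w‖ / 4))) * (bp * bq) ≤
      ∫⁻ x in B, F w x := by
    intro w
    obtain ⟨u₀, v₀, hu₀, hv₀, h⟩ := exists_le_inner_of_mem_ball (entryMatrix w)
    have hsub : Metric.ball u₀ (1 / 4) ×ˢ Metric.ball v₀ (1 / 4) ⊆ B := by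
      refine Set.prod_mono ?_ ?_
      · exact Metric.ball_subset_ball' (by rw [dist_zero_right]; linarith)
      · exact Metric.ball_subset_ball' (by rw [dist_zero_right]; linarith)
    refine le_trans ?_ (lintegral_mono_set hsub)
    have h1 : bp * bq = (volume : Measure (EuclideanSpace ℝ (Fin p) × EuclideanSpace ℝ (Fin q)))
        (Metric.ball u₀ (1 / 4) ×ˢ Metric.ball v₀ (1 / 4)) := by
      rw [Measure.volume_eq_prod, Measure.prod_prod, hball p, hball q]
    rw [h1, ← setLIntegral_const]
    refine setLIntegral_mono' (measurableSet_ball.prod measurableSet_ball) fun x hx => ?_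
    exact ENNReal.ofReal_le_ofReal (Real.exp_le_exp.2
      (mul_le_mul_of_nonneg_left (h _ hx.1 _ hx.2) ht))
  have hup : ∫⁻ x in B, ∫⁻ w, F w x ∂stdGaussianPi (Fin p × Fin q) ≤
      ENNReal.ofReal (Real.exp (8 * t ^ 2)) * (8 ^ (p + q) * (bp * bq)) := by
    have h1 : (volume : Measure (EuclideanSpace ℝ (Fin p) × EuclideanSpace ℝ (Fin q))) B = 8 ^ (p + q) * (bp * bq) := by
      rw [Measure.volume_eq_prod, hB, Measure.prod_prod, volume_ball_two p 0, volume_ball_two q 0,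
        pow_add]
      ring
    rw [← h1, ← setLIntegral_const]
    refine setLIntegral_mono' hBm fun x hx => ?_
    exact lintegral_exp_inner_le (by simpa using (Metric.mem_ball.1 hx.1).le)
      (by simpa using (Metric.mem_ball.1 hx.2).le)
  have hb0 : bp * bq ≠ 0 := mul_ne_zero (Metric.measure_ball_pos _ _ (by norm_num)).ne'
    (Metric.measure_ball_pos _ _ (by norm_num)).ne'
  have hbt : bp * bq ≠ ∞ := ENNReal.mul_ne_top measure_ball_lt_top.ne measure_ball_lt_top.ne
  rw [← ENNReal.mul_le_mul_iff_left hb0 hbt, ← lintegral_mul_const _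
    (by have := measurable_opNorm_entryMatrix (p := p) (q := q); fun_prop)]
  calc _ ≤ ∫⁻ w, (∫⁻ x in B, F w x) ∂stdGaussianPi (Fin p × Fin q) := lintegral_mono hlow
    _ = ∫⁻ x in B, ∫⁻ w, F w x ∂stdGaussianPi (Fin p × Fin q) :=
        lintegral_lintegral_swap hFm.aemeasurable
    _ ≤ _ := hup
    _ = _ := by ring

/-- The second moment of the operator norm of a Gaussian matrix is of the order of its size. -/
theorem lintegral_opNorm_sq_le (hp : 0 < p) :
    ∫⁻ w, ENNReal.ofReal (‖(entryMatrix w : Matrix (Fin p) (Fin q) ℝ)‖ ^ 2)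
        ∂stdGaussianPi (Fin p × Fin q) ≤ ENNReal.ofReal (3936 * (p + q)) := by
  set N : ℝ := p + q with hN
  have hN1 : 1 ≤ N := by
    have : (1 : ℝ) ≤ p := by exact_mod_cast hp
    have : (0 : ℝ) ≤ q := by positivity
    linarith
  have hN0 : 0 < N := by linarith
  -- The parameter t = √N makes both exponents linear in N: 8^(p+q) ≤ e^{3N} and e^{8t²} = e^{8N},
  -- together e^{11N}.
  set E : (Fin p × Fin q → ℝ) → ℝ := fun w =>
    √N * (‖(entryMatrix w : Matrix (Fin p) (Fin q) ℝ)‖ / 4) with hE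
  have hEm : Measurable E := by
    have := measurable_opNorm_entryMatrix (p := p) (q := q); fun_prop
  have hexp : ∫⁻ w, ENNReal.ofReal (Real.exp (E w - 11 * N)) ∂stdGaussianPi (Fin p × Fin q) ≤ 1 := by
    have h1 := lintegral_exp_opNorm_le (p := p) (q := q) (Real.sqrt_nonneg N)
    rw [Real.sq_sqrt hN0.le] at h1
    have h2 : (8 : ℝ≥0∞) ^ (p + q) ≤ ENNReal.ofReal (Real.exp (3 * N)) := by
      rw [show (8 : ℝ≥0∞) ^ (p + q) = ENNReal.ofReal (8 ^ (p + q)) by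
        rw [ENNReal.ofReal_pow (by norm_num)]; simp]
      refine ENNReal.ofReal_le_ofReal ?_
      have h3 : (8 : ℝ) ≤ Real.exp 3 := by
        have h4 : (2 : ℝ) ≤ Real.exp 1 := by
          have := Real.add_one_le_exp (1 : ℝ); linarith
        calc (8 : ℝ) = 2 ^ 3 := by norm_num
          _ ≤ Real.exp 1 ^ 3 := by gcongr
          _ = Real.exp 3 := by rw [← Real.exp_nat_mul]; norm_num
      calc (8 : ℝ) ^ (p + q) ≤ Real.exp 3 ^ (p + q) := by gcongr
        _ = Real.exp (3 * N) := by
            rw [← Real.exp_nat_mul, hN]; push_cast; ring_nf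
    calc _ = ∫⁻ w, ENNReal.ofReal (Real.exp (E w)) * ENNReal.ofReal (Real.exp (-(11 * N)))
          ∂stdGaussianPi (Fin p × Fin q) := by
          refine lintegral_congr fun w => ?_
          rw [← ENNReal.ofReal_mul (Real.exp_pos _).le, ← Real.exp_add, sub_eq_add_neg]
      _ = (∫⁻ w, ENNReal.ofReal (Real.exp (E w)) ∂stdGaussianPi (Fin p × Fin q)) *
          ENNReal.ofReal (Real.exp (-(11 * N))) := lintegral_mul_const _ (by fun_prop)
      _ ≤ ENNReal.ofReal (Real.exp (3 * N)) * ENNReal.ofReal (Real.exp (8 * N)) *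
          ENNReal.ofReal (Real.exp (-(11 * N))) := by
          gcongr
          exact h1.trans (mul_le_mul_left h2 _)
      _ = 1 := by
          rw [← ENNReal.ofReal_mul (Real.exp_pos _).le, ← ENNReal.ofReal_mul (by positivity),
            ← Real.exp_add, ← Real.exp_add]
          ring_nf
          simp
  -- Beyond 11N, E² ≤ 2(11N)² + 2(E - 11N)², and the last square is at most twice the exponential of
  -- E - 11N.
  have hpt : ∀ w, ‖(entryMatrix w : Matrix (Fin p) (Fin q) ℝ)‖ ^ 2 ≤
      16 / N * (242 * N ^ 2) + 16 / N * (4 * Real.exp (E w - 11 * N)) := by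
    intro w
    have h1 : ‖(entryMatrix w : Matrix (Fin p) (Fin q) ℝ)‖ ^ 2 = 16 / N * E w ^ 2 := by
      simp only [hE]
      rw [mul_pow, Real.sq_sqrt hN0.le]
      field_simp
      ring
    have hE0 : 0 ≤ E w := by simp only [hE]; positivity
    rw [h1, ← mul_add]
    refine mul_le_mul_of_nonneg_left ?_ (by positivity)
    have h2 := Real.exp_pos (E w - 11 * N)
    rcases le_total (E w) (11 * N) with h | h
    · nlinarith
    · have h3 := Real.quadratic_le_exp_of_nonneg (sub_nonneg.2 h)
      nlinarith [sq_nonneg (E w - 22 * N)]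
  calc _ ≤ ∫⁻ w, ENNReal.ofReal (16 / N * (242 * N ^ 2)) +
        ENNReal.ofReal (16 / N * 4) * ENNReal.ofReal (Real.exp (E w - 11 * N))
        ∂stdGaussianPi (Fin p × Fin q) := by
        refine lintegral_mono fun w => ?_
        rw [← ENNReal.ofReal_mul (by positivity), ← ENNReal.ofReal_add (by positivity)
          (by positivity)]
        exact ENNReal.ofReal_le_ofReal ((hpt w).trans_eq (by ring))
    _ = ENNReal.ofReal (16 / N * (242 * N ^ 2)) + ENNReal.ofReal (16 / N * 4) *
        ∫⁻ w, ENNReal.ofReal (Real.exp (E w - 11 * N)) ∂stdGaussianPi (Fin p × Fin q) := by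
        rw [lintegral_add_left measurable_const, lintegral_const, measure_univ, mul_one,
          lintegral_const_mul _ (by fun_prop)]
    _ ≤ ENNReal.ofReal (16 / N * (242 * N ^ 2)) + ENNReal.ofReal (16 / N * 4) * 1 := by gcongr
    _ ≤ ENNReal.ofReal (3936 * N) := by
        rw [mul_one, ← ENNReal.ofReal_add (by positivity) (by positivity)]
        refine ENNReal.ofReal_le_ofReal ?_
        have h1 : 16 / N * (242 * N ^ 2) = 3872 * N := by field_simp; ring
        have h2 : 16 / N * 4 ≤ 64 := by
          have : 16 / N ≤ 16 := div_le_self (by norm_num) hN1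
          linarith
        linarith

end OperatorNormMoments

/-! ### Moments of the relative perturbation. -/

section GaussianMoments

theorem lintegral_one_add_norm_pow_lt_top {α : Type*} [Fintype α] (n : ℕ) :
    ∫⁻ w, ENNReal.ofReal ((1 + ‖WithLp.toLp 2 w‖) ^ n) ∂stdGaussianPi α < ∞ := by
  have h1 : ∫⁻ w, ENNReal.ofReal ((1 + ‖WithLp.toLp 2 w‖) ^ n) ∂stdGaussianPi α =
      ∫⁻ y, ENNReal.ofReal ((1 + ‖y‖) ^ n) ∂stdGaussian (EuclideanSpace ℝ α) := by
    rw [← map_pi_eq_stdGaussian, lintegral_map (by fun_prop) (by fun_prop)]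
  have h2 : MemLp (fun y : EuclideanSpace ℝ α => 1 + ‖y‖) n
      (stdGaussian (EuclideanSpace ℝ α)) :=
    (memLp_const (1 : ℝ)).add (IsGaussian.memLp_id _ _ (by simp)).norm
  have h3 := h2.integrable_norm_pow'.2
  rw [h1]
  refine lt_of_le_of_lt (lintegral_mono fun y => ?_) h3
  rw [Real.enorm_eq_ofReal_abs]
  refine ENNReal.ofReal_le_ofReal (le_trans ?_ (le_abs_self _))
  simp only [Real.norm_eq_abs, abs_of_nonneg (by positivity : 0 ≤ 1 + ‖y‖), le_refl]

theorem abs_apply_le_norm_toLp {α : Type*} [Fintype α] (w : α → ℝ) (a : α) :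
    |w a| ≤ ‖WithLp.toLp 2 w‖ := by
  simpa using PiLp.norm_apply_le (WithLp.toLp 2 w) a

theorem lintegral_opNorm_adjugate_pow_lt_top (k : ℕ) :
    ∫⁻ w, ENNReal.ofReal (‖(entryMatrix w : Matrix (Fin k) (Fin k) ℝ).adjugate‖ ^ 6)
      ∂stdGaussianPi (Fin k × Fin k) < ∞ := by
  have h1 : ∀ w : Fin k × Fin k → ℝ, ‖(entryMatrix w).adjugate‖ ≤
      (k * k.factorial) * (1 + ‖WithLp.toLp 2 w‖) ^ k := by
    intro w
    set x := 1 + ‖WithLp.toLp 2 w‖ with hx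
    have hx1 : 1 ≤ x := by simp [hx]
    -- Each adjugate entry is a determinant with entries bounded by x, hence at most k! x^k.
    have h2 : ∀ i j, |(entryMatrix w).adjugate i j| ≤ k.factorial * x ^ k := by
      intro i j
      rw [Matrix.adjugate_apply]
      have h3 := Matrix.det_le (A := (entryMatrix w).updateRow j (Pi.single i 1))
        (abv := IsAbsoluteValue.toAbsoluteValue (abs : ℝ → ℝ)) (x := x) ?_
      · simpa [IsAbsoluteValue.toAbsoluteValue] using h3
      · intro a b
        change |_| ≤ x
        rw [Matrix.updateRow_apply]
        split_ifs
        · rw [Pi.single_apply]; split_ifs <;> simp [hx1] ; linarith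
        · refine (abs_apply_le_norm_toLp w (a, b)).trans ?_
          simp [hx]
    refine (opNorm_le_frobeniusNorm _).trans (le_of_sq_le_sq ?_ (by positivity))
    rw [frobeniusNorm_sq]
    calc _ ≤ ∑ _i : Fin k, ∑ _j : Fin k, (k.factorial * x ^ k) ^ 2 :=
          Finset.sum_le_sum fun i _ => Finset.sum_le_sum fun j _ => by
            rw [← sq_abs]; exact pow_le_pow_left₀ (abs_nonneg _) (h2 i j) 2
      _ = _ := by simp; ring
  calc _ ≤ ∫⁻ w, ENNReal.ofReal ((k * k.factorial) ^ 6) *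
        ENNReal.ofReal ((1 + ‖WithLp.toLp 2 w‖) ^ (k * 6)) ∂stdGaussianPi (Fin k × Fin k) := by
        refine lintegral_mono fun w => ?_
        rw [← ENNReal.ofReal_mul (by positivity)]
        refine ENNReal.ofReal_le_ofReal ((pow_le_pow_left₀ (norm_nonneg _) (h1 w) 6).trans_eq ?_)
        rw [mul_pow, ← pow_mul]
    _ < ∞ := by
        rw [lintegral_const_mul _ (by fun_prop)]
        exact ENNReal.mul_lt_top ENNReal.ofReal_lt_top (lintegral_one_add_norm_pow_lt_top _)

/-- Weighted AM–GM with weights 1/4, 1/12, 2/3. It splits the noise norm, the adjugate and the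
inverse determinant into separate expectations without using independence between them. -/
theorem sqrt_mul_sqrt_mul_sqrt_le {a b c : ℝ} (ha : 0 ≤ a) (hb : 0 ≤ b) (hc : 0 ≤ c) :
    √a * √b * √c ≤ a ^ 2 + b ^ 6 + c ^ (3 / 4 : ℝ) := by
  have h := Real.geom_mean_le_arith_mean3_weighted (w₁ := 1 / 4) (w₂ := 1 / 12) (w₃ := 2 / 3)
    (by norm_num) (by norm_num) (by norm_num) (pow_nonneg ha 2) (pow_nonneg hb 6)
    (Real.rpow_nonneg hc (3 / 4)) (by norm_num)
  rw [← Real.rpow_natCast a, ← Real.rpow_natCast b, ← Real.rpow_mul ha, ← Real.rpow_mul hb,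
    ← Real.rpow_mul hc] at h
  norm_num at h
  rw [Real.sqrt_eq_rpow, Real.sqrt_eq_rpow, Real.sqrt_eq_rpow]
  have h1 : 0 ≤ a ^ 2 := by positivity
  have h2 : 0 ≤ b ^ 6 := by positivity
  have h3 : 0 ≤ c ^ (3 / 4 : ℝ) := by positivity
  linarith

theorem continuous_entryMatrix_comp {p q : ℕ} {κ : Type*} (f : Fin p × Fin q → κ) :
    Continuous fun z : κ → ℝ => (entryMatrix fun a => z (f a)) :=
  continuous_entryMatrix.comp (continuous_pi fun a => continuous_apply (f a))

/-- A uniform bound for the expected square root of the relative perturbation. -/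
theorem exists_lintegral_sqrt_le (k : ℕ) : ∃ K : ℝ≥0∞, K ≠ ∞ ∧
    ∀ {p q : ℕ}, 0 < p → ∀ {κ : Type} [Fintype κ] {e : Fin k × Fin k → κ}
      {f : Fin p × Fin q → κ}, Function.Injective e → Function.Injective f →
      ∫⁻ z, ENNReal.ofReal (√(‖entryMatrix fun a => z (f a)‖ / √(p + q)) *
        √‖(entryMatrix fun a => z (e a)).adjugate‖ * √(|(entryMatrix fun a => z (e a)).det|⁻¹))
        ∂stdGaussianPi κ ≤ K := by
  obtain ⟨K₀, hK1, hKt, hK⟩ := exists_lintegral_enorm_add_rpow_le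
  refine ⟨ENNReal.ofReal 3936 + ∫⁻ w, ENNReal.ofReal
    (‖(entryMatrix w : Matrix (Fin k) (Fin k) ℝ).adjugate‖ ^ 6) ∂stdGaussianPi (Fin k × Fin k) +
    K₀ ^ k, ?_, ?_⟩
  · exact (ENNReal.add_lt_top.2 ⟨ENNReal.add_lt_top.2 ⟨ENNReal.ofReal_lt_top,
      lintegral_opNorm_adjugate_pow_lt_top k⟩, ENNReal.pow_lt_top hKt.lt_top⟩).ne
  intro p q hp κ _ e f he hf
  have hN : (0 : ℝ) < p + q := by
    have : (0 : ℝ) < p := by exact_mod_cast hp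
    positivity
  have m1 : Measurable fun z : κ → ℝ =>
      ENNReal.ofReal ((‖entryMatrix fun a => z (f a)‖ / √((p : ℝ) + q)) ^ 2) := by
    have : Measurable fun z : κ → ℝ => ‖entryMatrix fun a => z (f a)‖ :=
      (continuous_norm.comp (continuous_entryMatrix_comp f)).measurable
    fun_prop
  have m2' : Measurable fun w : Fin k × Fin k → ℝ => ENNReal.ofReal
      (‖(entryMatrix w : Matrix (Fin k) (Fin k) ℝ).adjugate‖ ^ 6) := by
    have : Measurable fun w : Fin k × Fin k → ℝ => ‖(entryMatrix w).adjugate‖ :=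
      (continuous_norm.comp (Continuous.matrix_adjugate continuous_entryMatrix)).measurable
    fun_prop
  have m2 : Measurable fun z : κ → ℝ => ENNReal.ofReal
      (‖(entryMatrix fun a => z (e a)).adjugate‖ ^ 6) :=
    m2'.comp (measurable_pi_lambda _ fun a => measurable_pi_apply (e a))
  have hpt : ∀ z : κ → ℝ, ENNReal.ofReal (√(‖entryMatrix fun a => z (f a)‖ / √(p + q)) *
        √‖(entryMatrix fun a => z (e a)).adjugate‖ *
          √(|(entryMatrix fun a => z (e a)).det|⁻¹)) ≤
      ENNReal.ofReal ((‖entryMatrix fun a => z (f a)‖ / √(p + q)) ^ 2) +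
      ENNReal.ofReal (‖(entryMatrix fun a => z (e a)).adjugate‖ ^ 6) +
      ‖(entryMatrix fun a => z (e a)).det‖ₑ ^ (-(3 / 4) : ℝ) := by
    intro z
    refine (ENNReal.ofReal_le_ofReal (sqrt_mul_sqrt_mul_sqrt_le (by positivity) (norm_nonneg _)
      (by positivity))).trans ?_
    rw [ENNReal.ofReal_add (by positivity) (by positivity),
      ENNReal.ofReal_add (by positivity) (by positivity)]
    refine add_le_add le_rfl ?_
    set x := (entryMatrix fun a => z (e a)).det
    by_cases hx : x = 0
    · rw [hx, enorm_zero, ENNReal.zero_rpow_of_neg (by norm_num)]; exact le_top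
    · have hx' : 0 < |x| := abs_pos.2 hx
      rw [Real.enorm_eq_ofReal_abs, ENNReal.ofReal_rpow_of_pos hx', Real.rpow_neg hx'.le,
        Real.inv_rpow hx'.le]
  refine (lintegral_mono hpt).trans ?_
  rw [lintegral_add_left (by exact m1.add m2), lintegral_add_left m1]
  refine add_le_add (add_le_add ?_ ?_) (lintegral_enorm_det_rpow_le hK1 hK k e he)
  · have h1 := lintegral_comp_stdGaussianPi hf (f := fun w : Fin p × Fin q → ℝ =>
      ENNReal.ofReal ((‖entryMatrix w‖ / √((p : ℝ) + q)) ^ 2))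
      (by have := measurable_opNorm_entryMatrix (p := p) (q := q); fun_prop)
    rw [h1]
    calc _ = ∫⁻ w, ENNReal.ofReal ((p + q : ℝ)⁻¹) *
          ENNReal.ofReal (‖(entryMatrix w : Matrix (Fin p) (Fin q) ℝ)‖ ^ 2)
          ∂stdGaussianPi (Fin p × Fin q) := by
          refine lintegral_congr fun w => ?_
          rw [← ENNReal.ofReal_mul (by positivity), div_pow, Real.sq_sqrt hN.le, div_eq_inv_mul]
      _ = ENNReal.ofReal ((p + q : ℝ)⁻¹) * ∫⁻ w,
          ENNReal.ofReal (‖(entryMatrix w : Matrix (Fin p) (Fin q) ℝ)‖ ^ 2)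
          ∂stdGaussianPi (Fin p × Fin q) := lintegral_const_mul _
            (by have := measurable_opNorm_entryMatrix (p := p) (q := q); fun_prop)
      _ ≤ ENNReal.ofReal ((p + q : ℝ)⁻¹) * ENNReal.ofReal (3936 * (p + q)) := by
          gcongr; exact lintegral_opNorm_sq_le hp
      _ = _ := by
          rw [← ENNReal.ofReal_mul (by positivity)]
          congr 1
          field_simp
  · exact (lintegral_comp_stdGaussianPi he m2').le

/-- A linear functional of a standard Gaussian vector is a centred Gaussian variable with standard
deviation the length of x. -/
theorem integral_abs_sum_stdGaussianPi {α : Type*} [Fintype α] (x : α → ℝ) :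
    ∫ w, |∑ i, x i * w i| ∂stdGaussianPi α = √(x ⬝ᵥ x) * ∫ y, |y| ∂gaussianReal 0 1 := by
  have h1 : ∫ w, |∑ i, x i * w i| ∂stdGaussianPi α =
      ∫ y, |y| ∂(stdGaussian (EuclideanSpace ℝ α)).map (innerSL ℝ (WithLp.toLp 2 x)) := by
    rw [integral_map (by fun_prop) (by fun_prop), ← map_pi_eq_stdGaussian,
      integral_map (by fun_prop) (by fun_prop)]
    refine integral_congr_ae (ae_of_all _ fun w => ?_)
    simp [PiLp.inner_apply, mul_comm]
  rw [h1, IsGaussian.map_eq_gaussianReal, integral_strongDual_stdGaussian, variance_dual_stdGaussian,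
    innerSL_apply_norm, toLp_norm_sq]
  have h2 := gaussianReal_map_const_mul (μ := 0) (v := 1) (√(x ⬝ᵥ x))
  have h3 : gaussianReal 0 (x ⬝ᵥ x).toNNReal =
      (gaussianReal 0 1).map (√(x ⬝ᵥ x) * ·) := by
    rw [h2]
    congr 1
    · simp
    · ext
      simp [Real.sq_sqrt (dotProduct_self_nonneg' x), dotProduct_self_nonneg' x]
  rw [h3, integral_map (by fun_prop) (by fun_prop), ← integral_const_mul]
  refine integral_congr_ae (ae_of_all _ fun y => ?_)
  simp [abs_mul, abs_of_nonneg (Real.sqrt_nonneg _)]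

theorem integral_abs_gaussianReal_pos : 0 < ∫ y, |y| ∂gaussianReal 0 1 := by
  have hint : Integrable (fun y : ℝ => |y|) (gaussianReal 0 1) :=
    ((memLp_id_gaussianReal 1).integrable le_rfl).abs
  rw [integral_pos_iff_support_of_nonneg (fun y => abs_nonneg y) hint]
  have : Function.support (fun y : ℝ => |y|) = {0}ᶜ := by
    ext y; simp
  rw [this, prob_compl_eq_one_sub (measurableSet_singleton 0)]
  have h0 : gaussianReal 0 1 {(0 : ℝ)} = 0 :=
    gaussianReal_absolutelyContinuous 0 one_ne_zero (by simp)
  rw [h0]; simp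

end GaussianMoments

/-! ### Lower bound for the mean of the normalized Gram matrix. -/

section GramLowerBound

theorem measurable_normalizedGram_apply {Ω : Type*} [MeasurableSpace Ω] {m n : ℕ}
    {Y : Ω → Matrix (Fin m) (Fin n) ℝ} (hY : ∀ a b, Measurable fun ω => Y ω a b) (a b : Fin m) :
    Measurable fun ω => normalizedGram (Y ω) a b := by
  simp only [normalizedGram, frobeniusNorm_sq, Matrix.smul_apply, Matrix.mul_apply,
    Matrix.transpose_apply, smul_eq_mul]
  fun_prop

theorem frobeniusNorm_mul_mul_sq_le {m n : ℕ} {B₁ : Matrix (Fin m) (Fin m) ℝ}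
    {B₂ : Matrix (Fin n) (Fin n) ℝ} (W : Matrix (Fin m) (Fin n) ℝ) {b : ℝ} (h₁ : ‖B₁‖ ≤ b)
    (h₂ : ‖B₂‖ ≤ b) : frobeniusNorm (B₁ * W * B₂) ^ 2 ≤ b ^ 4 * frobeniusNorm W ^ 2 := by
  have hb : 0 ≤ b := (norm_nonneg _).trans h₁
  have h3 : frobeniusNorm (B₁ * W * B₂) ≤ b * frobeniusNorm W * b :=
    (frobeniusNorm_mul_le' _ _).trans (mul_le_mul ((frobeniusNorm_mul_le _ _).trans
      (mul_le_mul_of_nonneg_right h₁ (frobeniusNorm_nonneg _))) h₂ (norm_nonneg _)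
      (mul_nonneg hb (frobeniusNorm_nonneg _)))
  calc _ ≤ (b * frobeniusNorm W * b) ^ 2 := pow_le_pow_left₀ (frobeniusNorm_nonneg _) h3 2
    _ = _ := by ring

theorem frobeniusNorm_add_sq_le {m n : ℕ} (A H : Matrix (Fin m) (Fin n) ℝ) :
    frobeniusNorm (A + H) ^ 2 ≤ 2 * frobeniusNorm A ^ 2 + 2 * (m * ‖H‖ ^ 2) := by
  have h1 := frobeniusNorm_add_le A H
  have h2 : frobeniusNorm H ^ 2 ≤ m * ‖H‖ ^ 2 := by
    have h3 := frobeniusNorm_mul_le' (1 : Matrix (Fin m) (Fin m) ℝ) H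
    rw [Matrix.one_mul] at h3
    have h4 := pow_le_pow_left₀ (frobeniusNorm_nonneg _) h3 2
    rwa [mul_pow, frobeniusNorm_one, Fintype.card_fin] at h4
  nlinarith [frobeniusNorm_nonneg (A + H), frobeniusNorm_nonneg A, frobeniusNorm_nonneg H,
    sq_nonneg (frobeniusNorm A - frobeniusNorm H)]

/-- The inequality a²/y² ≥ 2τa - τ²y² replaces a random quotient by terms whose expectations can be
controlled. -/
theorem le_dotProduct_normalizedGram {m n : ℕ} (Y : Matrix (Fin m) (Fin n) ℝ) (u : Fin m → ℝ)
    (τ : ℝ) : 2 * τ * √((Yᵀ *ᵥ u) ⬝ᵥ (Yᵀ *ᵥ u)) - τ ^ 2 * frobeniusNorm Y ^ 2 ≤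
      u ⬝ᵥ (normalizedGram Y *ᵥ u) := by
  have h0 := dotProduct_self_nonneg' (Yᵀ *ᵥ u)
  rw [dotProduct_normalizedGram]
  set y := frobeniusNorm Y with hy
  set a := √((Yᵀ *ᵥ u) ⬝ᵥ (Yᵀ *ᵥ u)) with ha
  have ha2 : (Yᵀ *ᵥ u) ⬝ᵥ (Yᵀ *ᵥ u) = a ^ 2 := (Real.sq_sqrt h0).symm
  rcases (frobeniusNorm_nonneg Y).eq_or_lt with h | h
  · have h1 := transpose_mulVec_dotProduct_le Y u
    rw [← h] at h1
    have h2 : a = 0 := by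
      rw [ha, Real.sqrt_eq_zero']
      simpa using h1
    rw [h2, hy, ← h]
    simp
  · rw [ha2, le_div_iff₀ (by positivity)]
    nlinarith [sq_nonneg (a - τ * y ^ 2)]

theorem sqrt_dotProduct_add_ge {n : Type*} [Fintype n] (x y : n → ℝ) :
    √(x ⬝ᵥ x) - √(y ⬝ᵥ y) ≤ √((x + y) ⬝ᵥ (x + y)) := by
  have h : ∀ x : n → ℝ, √(x ⬝ᵥ x) = ‖WithLp.toLp 2 x‖ := fun x => by
    rw [← toLp_norm_sq, Real.sqrt_sq (norm_nonneg _)]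
  rw [h, h, h, WithLp.toLp_add]
  have := norm_sub_norm_le (WithLp.toLp 2 x) (-WithLp.toLp 2 y)
  rwa [norm_neg, sub_neg_eq_add] at this

theorem integrable_sq_apply_stdGaussianPi {κ : Type*} [Fintype κ] (k : κ) :
    Integrable (fun z : κ → ℝ => z k ^ 2) (stdGaussianPi κ) := by
  have h1 : Integrable (fun y : ℝ => y ^ 2) (gaussianReal 0 1) :=
    (memLp_id_gaussianReal 2).integrable_sq
  exact (measurePreserving_eval (fun _ : κ => gaussianReal 0 1) k).integrable_comp_of_integrable h1

theorem integral_sq_apply_stdGaussianPi {κ : Type*} [Fintype κ] (k : κ) :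
    ∫ z, z k ^ 2 ∂stdGaussianPi κ = ∫ y, y ^ 2 ∂gaussianReal 0 1 := by
  have h := (measurePreserving_eval (fun _ : κ => gaussianReal 0 1) k).map_eq
  conv_rhs => rw [← h]
  rw [integral_map (measurable_pi_apply k).aemeasurable (by fun_prop)]

theorem integrable_apply_stdGaussianPi {κ : Type*} [Fintype κ] (k : κ) :
    Integrable (fun z : κ → ℝ => z k) (stdGaussianPi κ) := by
  have h1 : Integrable (fun y : ℝ => y) (gaussianReal 0 1) :=
    (memLp_id_gaussianReal 1).integrable le_rfl
  exact (measurePreserving_eval (fun _ : κ => gaussianReal 0 1) k).integrable_comp_of_integrable h1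

/-- A pointwise bound for the normalized Gram matrix of a perturbed factor matrix. -/
theorem le_dotProduct_normalizedGram_add {m n : ℕ} {c b κ₁ τ h : ℝ} (hc : 0 < c) (hκ : 0 < κ₁)
    (hτ : 0 ≤ τ) {B₁ : Matrix (Fin m) (Fin m) ℝ} {B₂ : Matrix (Fin n) (Fin n) ℝ} (j₀ : Fin n)
    (hB₂ : ∀ y, c * (y ⬝ᵥ y) ≤ (B₂ᵀ *ᵥ y) ⬝ᵥ (B₂ᵀ *ᵥ y)) (h₁ : ‖B₁‖ ≤ b) (h₂ : ‖B₂‖ ≤ b)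
    (W H : Matrix (Fin m) (Fin n) ℝ) (hH : ‖H‖ ≤ h) (u : Fin m → ℝ) :
    2 * τ * √(u ⬝ᵥ u) * (√c * |∑ i, (B₁ᵀ *ᵥ u) i * W i j₀| -
        √(u ⬝ᵥ u) * (κ₁ / 4 + h ^ 2 / κ₁)) -
      τ ^ 2 * (u ⬝ᵥ u) * (2 * b ^ 4 * frobeniusNorm W ^ 2 + 2 * m * h ^ 2) ≤
    u ⬝ᵥ (normalizedGram (B₁ * W * B₂ + H) *ᵥ u) := by
  set r := √(u ⬝ᵥ u) with hr
  have hr0 : 0 ≤ r := Real.sqrt_nonneg _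
  have hr2 : u ⬝ᵥ u = r ^ 2 := (Real.sq_sqrt (dotProduct_self_nonneg' u)).symm
  have hh0 : 0 ≤ h := (norm_nonneg _).trans hH
  refine le_trans ?_ (le_dotProduct_normalizedGram (B₁ * W * B₂ + H) u (τ * r))
  set x := B₁ᵀ *ᵥ u with hx
  -- A single column of W already gives enough mass.
  have e1 : √c * |∑ i, x i * W i j₀| ≤
      √(((B₁ * W * B₂)ᵀ *ᵥ u) ⬝ᵥ ((B₁ * W * B₂)ᵀ *ᵥ u)) := by
    have h3 : (B₁ * W * B₂)ᵀ *ᵥ u = B₂ᵀ *ᵥ (Wᵀ *ᵥ x) := by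
      rw [hx, Matrix.mulVec_mulVec, Matrix.mulVec_mulVec, Matrix.transpose_mul,
        Matrix.transpose_mul, Matrix.mul_assoc]
    have h4 : (∑ i, x i * W i j₀) ^ 2 ≤ (Wᵀ *ᵥ x) ⬝ᵥ (Wᵀ *ᵥ x) := by
      have h5 : ∑ i, x i * W i j₀ = (Wᵀ *ᵥ x) j₀ := by
        simp [mulVec, dotProduct, mul_comm]
      rw [h5, dotProduct, sq]
      exact Finset.single_le_sum (f := fun j => (Wᵀ *ᵥ x) j * (Wᵀ *ᵥ x) j)
        (fun j _ => mul_self_nonneg _) (Finset.mem_univ j₀)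
    rw [h3, ← Real.sqrt_sq_eq_abs, ← Real.sqrt_mul hc.le]
    exact Real.sqrt_le_sqrt ((mul_le_mul_of_nonneg_left h4 hc.le).trans (hB₂ _))
  have e2 : √((Hᵀ *ᵥ u) ⬝ᵥ (Hᵀ *ᵥ u)) ≤ h * r := by
    refine Real.sqrt_le_iff.2 ⟨by positivity, ?_⟩
    refine (mulVec_dotProduct_self_le Hᵀ u).trans ?_
    rw [opNorm_transpose, hr2, mul_pow]
    gcongr
  have e3 := sqrt_dotProduct_add_ge ((B₁ * W * B₂)ᵀ *ᵥ u) (Hᵀ *ᵥ u)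
  rw [← Matrix.add_mulVec, ← Matrix.transpose_add] at e3
  -- This trades h for h², since only the second moment of the perturbation is controlled.
  have e4 : h ≤ κ₁ / 4 + h ^ 2 / κ₁ := by
    have : h ^ 2 / κ₁ * κ₁ = h ^ 2 := div_mul_cancel₀ _ hκ.ne'
    have h6 : 0 ≤ h ^ 2 / κ₁ := by positivity
    nlinarith [sq_nonneg (h - κ₁ / 2)]
  have e5 : frobeniusNorm (B₁ * W * B₂ + H) ^ 2 ≤
      2 * b ^ 4 * frobeniusNorm W ^ 2 + 2 * m * h ^ 2 := by
    refine (frobeniusNorm_add_sq_le _ _).trans ?_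
    have h7 := frobeniusNorm_mul_mul_sq_le W h₁ h₂
    have h8 : ‖H‖ ^ 2 ≤ h ^ 2 := pow_le_pow_left₀ (norm_nonneg _) hH 2
    have h9 : (m : ℝ) * ‖H‖ ^ 2 ≤ m * h ^ 2 := by gcongr
    linarith
  have e6 : √c * |∑ i, x i * W i j₀| - r * (κ₁ / 4 + h ^ 2 / κ₁) ≤
      √(((B₁ * W * B₂ + H)ᵀ *ᵥ u) ⬝ᵥ ((B₁ * W * B₂ + H)ᵀ *ᵥ u)) := by
    have := mul_le_mul_of_nonneg_left e4 hr0
    linarith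
  have e7 := mul_le_mul_of_nonneg_left e6 (by positivity : 0 ≤ 2 * τ * r)
  have e8 := mul_le_mul_of_nonneg_left e5 (by positivity : 0 ≤ τ ^ 2 * r ^ 2)
  rw [hr2, mul_pow]
  rw [show 2 * (τ * r) = 2 * τ * r by ring]
  linarith

/-- The expected normalized Gram matrix of a slightly perturbed Gaussian factor matrix is
uniformly positive definite. -/
theorem exists_le_integral_normalizedGram (m : ℕ) {n : ℕ} (hn : 0 < n) {c b : ℝ} (hc : 0 < c) :
    ∃ c₀ : ℝ, 0 < c₀ ∧ ∃ η : ℝ, 0 < η ∧ ∀ {κ : Type} [Fintype κ] {e : Fin m × Fin n → κ},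
      Function.Injective e → ∀ {B₁ : Matrix (Fin m) (Fin m) ℝ} {B₂ : Matrix (Fin n) (Fin n) ℝ},
      (∀ y, c * (y ⬝ᵥ y) ≤ (B₁ᵀ *ᵥ y) ⬝ᵥ (B₁ᵀ *ᵥ y)) →
      (∀ y, c * (y ⬝ᵥ y) ≤ (B₂ᵀ *ᵥ y) ⬝ᵥ (B₂ᵀ *ᵥ y)) → ‖B₁‖ ≤ b → ‖B₂‖ ≤ b →
      ∀ {H : (κ → ℝ) → Matrix (Fin m) (Fin n) ℝ} {h : (κ → ℝ) → ℝ},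
      (∀ i j, Measurable fun z => H z i j) → Measurable h → (∀ z, ‖H z‖ ≤ h z) →
      ∫⁻ z, ENNReal.ofReal (h z ^ 2) ∂stdGaussianPi κ ≤ ENNReal.ofReal η →
      ∀ u : Fin m → ℝ, c₀ * (u ⬝ᵥ u) ≤
        ∫ z, u ⬝ᵥ (normalizedGram (B₁ * (entryMatrix fun a => z (e a)) * B₂ + H z) *ᵥ u)
          ∂stdGaussianPi κ := by
  set κ₀ := ∫ y, |y| ∂gaussianReal 0 1 with hκ₀
  have hκ₀pos : 0 < κ₀ := integral_abs_gaussianReal_pos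
  set v₂ := ∫ y, y ^ 2 ∂gaussianReal 0 1 with hv₂
  have hv₂0 : 0 ≤ v₂ := integral_nonneg fun y => sq_nonneg y
  set κ₁ := c * κ₀ with hκ₁
  have hκ₁pos : 0 < κ₁ := mul_pos hc hκ₀pos
  -- With this η the mean of h²/κ₁ is at most κ₁/4, so half of κ₁ survives. Then Γ bounds the mean
  -- squared size, and τ maximizes τκ₁ - τ²Γ, with maximum κ₁²/(4Γ).
  set η := κ₁ ^ 2 / 4 with hη
  set Γ := 2 * b ^ 4 * (m * n * v₂) + 2 * m * η + 1 with hΓ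
  have hΓpos : 0 < Γ := by
    have : 0 ≤ 2 * b ^ 4 * (m * n * v₂) := by positivity
    have : 0 ≤ 2 * m * η := by positivity
    linarith
  set τ := κ₁ / (2 * Γ) with hτ
  have hτ0 : 0 < τ := by positivity
  refine ⟨κ₁ ^ 2 / (4 * Γ), by positivity, η, by positivity, ?_⟩
  intro κ _ e he B₁ B₂ hB₁ hB₂ h₁ h₂ H h hHm hm hH hle u
  set r := √(u ⬝ᵥ u) with hr
  have hr0 : 0 ≤ r := Real.sqrt_nonneg _
  have hr2 : u ⬝ᵥ u = r ^ 2 := (Real.sq_sqrt (dotProduct_self_nonneg' u)).symm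
  set j₀ : Fin n := ⟨0, hn⟩
  set x := B₁ᵀ *ᵥ u with hx
  set ξ : (κ → ℝ) → ℝ := fun z => |∑ i, x i * z (e (i, j₀))| with hξ
  set w₂ : (κ → ℝ) → ℝ := fun z => ∑ i, ∑ j, z (e (i, j)) ^ 2 with hw₂
  have hh2 : Integrable (fun z => h z ^ 2) (stdGaussianPi κ) := by
    refine ⟨by fun_prop, ?_⟩
    refine lt_of_le_of_lt (lintegral_mono fun z => ?_) (hle.trans_lt ENNReal.ofReal_lt_top)
    rw [Real.enorm_eq_ofReal_abs, abs_of_nonneg (sq_nonneg _)]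
  have hh2le : ∫ z, h z ^ 2 ∂stdGaussianPi κ ≤ η := by
    rw [integral_eq_lintegral_of_nonneg_ae (ae_of_all _ fun z => sq_nonneg _)
      hh2.aestronglyMeasurable]
    exact ENNReal.toReal_le_of_le_ofReal (by positivity) hle
  have hξi : Integrable ξ (stdGaussianPi κ) :=
    (integrable_finsetSum _ fun i _ =>
      (integrable_apply_stdGaussianPi (e (i, j₀))).const_mul (x i)).abs
  have hξint : ∫ z, ξ z ∂stdGaussianPi κ = √(x ⬝ᵥ x) * κ₀ := by
    rw [hκ₀, ← integral_abs_sum_stdGaussianPi, ← map_comp_stdGaussianPi (e := fun i => e (i, j₀))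
      (fun a a' haa => by simpa using he haa), integral_map
      (measurable_pi_lambda _ fun _ => measurable_pi_apply _).aemeasurable
      (Measurable.aestronglyMeasurable (by fun_prop))]
  have hξlow : √c * r * κ₀ ≤ ∫ z, ξ z ∂stdGaussianPi κ := by
    rw [hξint, hr, ← Real.sqrt_mul hc.le]
    exact mul_le_mul_of_nonneg_right (Real.sqrt_le_sqrt (hB₁ u)) hκ₀pos.le
  have hw₂i : Integrable w₂ (stdGaussianPi κ) :=
    integrable_finsetSum _ fun i _ => integrable_finsetSum _ fun j _ =>
      integrable_sq_apply_stdGaussianPi _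
  have hw₂int : ∫ z, w₂ z ∂stdGaussianPi κ = m * n * v₂ := by
    simp only [hw₂]
    rw [integral_finsetSum _ fun i _ => integrable_finsetSum _ fun j _ =>
      integrable_sq_apply_stdGaussianPi _]
    simp_rw [integral_finsetSum _ fun j _ => integrable_sq_apply_stdGaussianPi _,
      integral_sq_apply_stdGaussianPi]
    simp [hv₂, mul_assoc]
  set L : (κ → ℝ) → ℝ := fun z => 2 * τ * r * √c * ξ z - 2 * τ * r ^ 2 * (κ₁ / 4) -
    2 * τ * r ^ 2 / κ₁ * h z ^ 2 - τ ^ 2 * r ^ 2 * (2 * b ^ 4) * w₂ z -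
    τ ^ 2 * r ^ 2 * (2 * m) * h z ^ 2 with hL
  have hLi : Integrable L (stdGaussianPi κ) :=
    ((((hξi.const_mul _).sub (integrable_const _)).sub (hh2.const_mul _)).sub
      (hw₂i.const_mul _)).sub (hh2.const_mul _)
  have hLint : ∫ z, L z ∂stdGaussianPi κ = 2 * τ * r * √c * ∫ z, ξ z ∂stdGaussianPi κ -
      2 * τ * r ^ 2 * (κ₁ / 4) - 2 * τ * r ^ 2 / κ₁ * ∫ z, h z ^ 2 ∂stdGaussianPi κ -
      τ ^ 2 * r ^ 2 * (2 * b ^ 4) * ∫ z, w₂ z ∂stdGaussianPi κ -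
      τ ^ 2 * r ^ 2 * (2 * m) * ∫ z, h z ^ 2 ∂stdGaussianPi κ := by
    simp only [hL]
    rw [integral_sub (by exact (((hξi.const_mul _).sub (integrable_const _)).sub
      (hh2.const_mul _)).sub (hw₂i.const_mul _)) (hh2.const_mul _), integral_sub
      (by exact ((hξi.const_mul _).sub (integrable_const _)).sub (hh2.const_mul _))
      (hw₂i.const_mul _),
      integral_sub (by exact (hξi.const_mul _).sub (integrable_const _)) (hh2.const_mul _),
      integral_sub (hξi.const_mul _) (integrable_const _)]
    simp only [integral_const_mul, integral_const, probReal_univ, one_smul]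
  have hSm : Measurable fun z : κ → ℝ =>
      u ⬝ᵥ (normalizedGram (B₁ * (entryMatrix fun a => z (e a)) * B₂ + H z) *ᵥ u) := by
    have h3 : ∀ a b, Measurable fun z : κ → ℝ =>
        normalizedGram (B₁ * (entryMatrix fun a => z (e a)) * B₂ + H z) a b := by
      refine measurable_normalizedGram_apply fun a b => ?_
      simp only [Matrix.add_apply, Matrix.mul_apply, entryMatrix, Matrix.of_apply]
      fun_prop
    simp only [dotProduct, mulVec]
    fun_prop
  have hSi : Integrable (fun z : κ → ℝ =>
      u ⬝ᵥ (normalizedGram (B₁ * (entryMatrix fun a => z (e a)) * B₂ + H z) *ᵥ u))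
      (stdGaussianPi κ) := by
    refine Integrable.of_bound hSm.aestronglyMeasurable (u ⬝ᵥ u) (ae_of_all _ fun z => ?_)
    rw [Real.norm_eq_abs, abs_of_nonneg]
    · exact dotProduct_normalizedGram_le _ u
    · rw [dotProduct_normalizedGram]
      exact div_nonneg (dotProduct_self_nonneg' _) (sq_nonneg _)
  refine le_trans ?_ (integral_mono hLi hSi fun z => ?_)
  · rw [hLint, hw₂int, hr2]
    have hcc : √c * √c = c := Real.mul_self_sqrt hc.le
    have f1 : 2 * τ * r * √c * (√c * r * κ₀) ≤ 2 * τ * r * √c * ∫ z, ξ z ∂stdGaussianPi κ := by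
      gcongr
    have f1' : 2 * τ * r * √c * (√c * r * κ₀) = 2 * τ * r ^ 2 * κ₁ := by
      rw [show 2 * τ * r * √c * (√c * r * κ₀) = 2 * τ * r ^ 2 * (√c * √c * κ₀) by ring, hcc]
    have f2 : 2 * τ * r ^ 2 / κ₁ * ∫ z, h z ^ 2 ∂stdGaussianPi κ ≤ 2 * τ * r ^ 2 / κ₁ * η := by
      gcongr
    have f2' : 2 * τ * r ^ 2 / κ₁ * η = 2 * τ * r ^ 2 * (κ₁ / 4) := by
      rw [hη]; field_simp
    have f3 : τ ^ 2 * r ^ 2 * (2 * m) * ∫ z, h z ^ 2 ∂stdGaussianPi κ ≤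
        τ ^ 2 * r ^ 2 * (2 * m) * η := by gcongr
    have f4 : τ ^ 2 * r ^ 2 * Γ = τ ^ 2 * r ^ 2 * (2 * b ^ 4) * (m * n * v₂) +
        τ ^ 2 * r ^ 2 * (2 * m) * η + τ ^ 2 * r ^ 2 := by rw [hΓ]; ring
    have f5 : 0 ≤ τ ^ 2 * r ^ 2 := by positivity
    have f6 : κ₁ ^ 2 / (4 * Γ) * r ^ 2 = τ * r ^ 2 * κ₁ - τ ^ 2 * r ^ 2 * Γ := by
      rw [hτ]; field_simp; ring
    linarith
  · have h4 := le_dotProduct_normalizedGram_add (b := b) hc hκ₁pos hτ0.le j₀ hB₂ h₁ h₂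
      (entryMatrix fun a => z (e a)) (H z) (hH z) u
    refine le_trans (le_of_eq ?_) h4
    have h5 : frobeniusNorm (entryMatrix fun a => z (e a)) ^ 2 = w₂ z := by
      rw [frobeniusNorm_sq]; rfl
    have h6 : |∑ i, (B₁ᵀ *ᵥ u) i * (entryMatrix fun a => z (e a)) i j₀| = ξ z := rfl
    rw [h5, h6, ← hr, hr2]
    simp only [hL]
    ring

end GramLowerBound

/-! ### Averages over time and the leading eigenspace. -/

section Averages

variable {Ω : Type*} [MeasurableSpace Ω] {P : Measure Ω} [IsProbabilityMeasure P]

/-- Chebyshev's inequality for averages of independent variables with values in `[-1, 1]`. -/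
theorem measure_abs_average_sub_ge_le {T : ℕ} (hT : 0 < T) {ξ : Fin T → Ω → ℝ}
    (hm : ∀ t, AEMeasurable (ξ t) P) (hb : ∀ t ω, |ξ t ω| ≤ 1) (hi : iIndepFun ξ P) {δ : ℝ}
    (hδ : 0 < δ) :
    P {ω | δ ≤ |(T : ℝ)⁻¹ * ∑ t, ξ t ω - (T : ℝ)⁻¹ * ∑ t, ∫ ω', ξ t ω' ∂P|} ≤
      ENNReal.ofReal (1 / (T * δ ^ 2)) := by
  have hT' : (0 : ℝ) < T := by exact_mod_cast hT
  have hL : ∀ t, MemLp (ξ t) 2 P := fun t =>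
    MemLp.of_bound (hm t).aestronglyMeasurable 1 (ae_of_all _ fun ω => hb t ω)
  have hvar1 : ∀ t, variance (ξ t) P ≤ 1 := by
    intro t
    have := variance_le_sq_of_bounded (a := -1) (b := 1) (X := ξ t) (μ := P)
      (ae_of_all _ fun ω => abs_le.1 (hb t ω)) (hm t)
    norm_num at this
    exact this
  have hsum : variance (∑ t, ξ t) P ≤ T := by
    rw [IndepFun.variance_sum (fun t _ => hL t) (fun i _ j _ hij => hi.indepFun hij)]
    exact (Finset.sum_le_sum fun t _ => hvar1 t).trans (by simp)
  have hmean : ∫ ω, (∑ t, ξ t) ω ∂P = ∑ t, ∫ ω, ξ t ω ∂P := by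
    simp only [Finset.sum_apply]
    exact integral_finsetSum _ fun t _ => (hL t).integrable one_le_two
  have h := meas_ge_le_variance_div_sq (memLp_finsetSum' Finset.univ fun t _ => hL t)
    (mul_pos hT' hδ)
  rw [hmean] at h
  refine le_trans (measure_mono fun ω hω => ?_) (h.trans (ENNReal.ofReal_le_ofReal ?_))
  · simp only [Set.mem_ofPred_eq] at hω ⊢
    rw [← mul_sub, abs_mul, abs_of_pos (inv_pos.2 hT'), inv_mul_eq_div, le_div_iff₀' hT'] at hω
    simpa using hω
  · calc _ ≤ (T : ℝ) / (T * δ) ^ 2 := by gcongr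
      _ = _ := by field_simp

theorem abs_normalizedGram_apply_le {m n : ℕ} (Y : Matrix (Fin m) (Fin n) ℝ) (a b : Fin m) :
    |normalizedGram Y a b| ≤ 1 := by
  have h0 : ∀ c, ∑ j, Y c j ^ 2 ≤ frobeniusNorm Y ^ 2 := by
    intro c
    rw [frobeniusNorm_sq]
    exact Finset.single_le_sum (f := fun c => ∑ j, Y c j ^ 2)
      (fun i _ => Finset.sum_nonneg fun j _ => sq_nonneg _) (Finset.mem_univ c)
  have h1 : |(Y * Yᵀ) a b| ≤ frobeniusNorm Y ^ 2 := by
    rw [Matrix.mul_apply]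
    refine (Finset.abs_sum_le_sum_abs _ _).trans ?_
    calc ∑ j, |Y a j * Yᵀ j b| ≤ ∑ j, (Y a j ^ 2 / 2 + Y b j ^ 2 / 2) := by
          refine Finset.sum_le_sum fun j _ => ?_
          rw [Matrix.transpose_apply, abs_le]
          constructor <;> nlinarith [sq_nonneg (Y a j - Y b j), sq_nonneg (Y a j + Y b j)]
      _ = (∑ j, Y a j ^ 2) / 2 + (∑ j, Y b j ^ 2) / 2 := by
          rw [Finset.sum_add_distrib, Finset.sum_div, Finset.sum_div]
      _ ≤ _ := by linarith [h0 a, h0 b]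
  rw [normalizedGram, Matrix.smul_apply, smul_eq_mul, abs_mul, abs_inv, abs_of_nonneg (sq_nonneg _),
    inv_mul_eq_div]
  exact div_le_one_of_le₀ h1 (sq_nonneg _)

/-- Entrywise deviations, to which Chebyshev's inequality applies, become a deviation of quadratic
forms at the cost of a factor m. -/
theorem abs_dotProduct_mulVec_le {m : ℕ} {A : Matrix (Fin m) (Fin m) ℝ} {δ : ℝ}
    (hA : ∀ a b, |A a b| ≤ δ) (u : Fin m → ℝ) : |u ⬝ᵥ (A *ᵥ u)| ≤ m * δ * (u ⬝ᵥ u) := by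
  have h1 : u ⬝ᵥ (A *ᵥ u) = ∑ a, ∑ b, u a * (A a b * u b) := by
    simp only [dotProduct, mulVec, Finset.mul_sum]
  rw [h1]
  refine (Finset.abs_sum_le_sum_abs _ _).trans ?_
  calc _ ≤ ∑ a, ∑ b, δ * (u a ^ 2 / 2 + u b ^ 2 / 2) := by
        refine Finset.sum_le_sum fun a _ => (Finset.abs_sum_le_sum_abs _ _).trans
          (Finset.sum_le_sum fun b _ => ?_)
        rw [abs_mul, abs_mul]
        have h2 := hA a b
        have h3 : 0 ≤ δ := (abs_nonneg _).trans h2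
        have h4 : |u a| * |u b| ≤ u a ^ 2 / 2 + u b ^ 2 / 2 := by
          have := sq_nonneg (|u a| - |u b|)
          rw [← sq_abs (u a), ← sq_abs (u b)]; nlinarith
        calc |u a| * (|A a b| * |u b|) = |A a b| * (|u a| * |u b|) := by ring
          _ ≤ δ * (u a ^ 2 / 2 + u b ^ 2 / 2) :=
              mul_le_mul h2 h4 (by positivity) h3
    _ = _ := by
        simp only [← Finset.mul_sum, Finset.sum_add_distrib, Finset.sum_const, Finset.card_univ,
          Fintype.card_fin, nsmul_eq_mul, dotProduct, ← Finset.sum_div]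
        simp only [← sq]
        ring

theorem average_mulVec_dotProduct {m T : ℕ} (A : Fin T → Matrix (Fin m) (Fin m) ℝ)
    (u : Fin m → ℝ) : u ⬝ᵥ (((T : ℝ)⁻¹ • ∑ t, A t) *ᵥ u) = (T : ℝ)⁻¹ * ∑ t, u ⬝ᵥ (A t *ᵥ u) := by
  rw [Matrix.smul_mulVec, dotProduct_smul, smul_eq_mul, Matrix.sum_mulVec, dotProduct_sum]

/-- The leading eigenspace of an average of projections close to `U Γ_t Uᵀ` is close to the column
space of `U`, provided that the `Γ_t` dominate independent matrices with expectation bounded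
below. -/
theorem measure_subspace_distance_le {p m T : ℕ} (hT : 0 < T) (hm : 0 < m)
    {U : Matrix (Fin p) (Fin m) ℝ} (hU : Uᵀ * U = 1)
    {S : Fin T → Ω → Matrix (Fin m) (Fin m) ℝ} (hSm : ∀ t a b, AEMeasurable (fun ω => S t ω a b) P)
    (hSb : ∀ t ω a b, |S t ω a b| ≤ 1) (hSi : ∀ a b, iIndepFun (fun t ω => S t ω a b) P)
    {c₀ : ℝ} (hc₀ : 0 < c₀) (hS : ∀ t u, c₀ * (u ⬝ᵥ u) ≤ ∫ ω, u ⬝ᵥ (S t ω *ᵥ u) ∂P)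
    {g : Fin T → Ω → ℝ} (hgm : ∀ t, AEMeasurable (g t) P) {G : ℝ}
    (hG : ∀ t, ∫⁻ ω, ENNReal.ofReal (g t ω) ∂P ≤ ENNReal.ofReal G)
    {U' : Ω → Matrix (Fin p) (Fin m) ℝ} {Q : Fin T → Ω → Matrix (Fin p) (Fin p) ℝ}
    (hQ : ∀ᵐ ω ∂P, ∀ t x, 0 ≤ x ⬝ᵥ (Q t ω *ᵥ x))
    (hlead : ∀ᵐ ω ∂P, IsLeadingEigenvectors ((T : ℝ)⁻¹ • ∑ t, Q t ω) (U' ω))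
    (hΓ : ∀ᵐ ω ∂P, ∀ t, ∃ Γ : Matrix (Fin m) (Fin m) ℝ,
      frobeniusNorm (Q t ω - U * Γ * Uᵀ) ≤ g t ω ∧
        ∀ u, u ⬝ᵥ (S t ω *ᵥ u) ≤ 2 * (u ⬝ᵥ (Γ *ᵥ u)) + g t ω * (u ⬝ᵥ u))
    {η : ℝ} (hη : 0 < η) (hηc : η ≤ c₀ / 4) :
    P {ω | 8 * m * (4 * η / c₀) ^ 2 < frobeniusNorm (U' ω * (U' ω)ᵀ - U * Uᵀ) ^ 2} ≤
      ENNReal.ofReal (G / η) + ENNReal.ofReal (16 * m ^ 4 / (T * c₀ ^ 2)) := by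
  have hT' : (0 : ℝ) < T := by exact_mod_cast hT
  have hm' : (0 : ℝ) < m := by exact_mod_cast hm
  -- Entrywise accuracy δ changes quadratic forms by at most mδ = c₀/4. The union over m² entries
  -- gives m²/(Tδ²) = 16m⁴/(Tc₀²).
  set δ : ℝ := c₀ / (4 * m) with hδ
  have hδ0 : 0 < δ := by positivity
  set E₁ : Set Ω := {ω | ENNReal.ofReal η ≤ ENNReal.ofReal (T : ℝ)⁻¹ *
    ∑ t, ENNReal.ofReal (g t ω)} with hE₁
  set E₂ : Fin m → Fin m → Set Ω := fun a b =>
    {ω | δ ≤ |(T : ℝ)⁻¹ * ∑ t, S t ω a b - (T : ℝ)⁻¹ * ∑ t, ∫ ω', S t ω' a b ∂P|} with hE₂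
  have hP₁ : P E₁ ≤ ENNReal.ofReal (G / η) := by
    have h1 := meas_ge_le_lintegral_div (μ := P) (f := fun ω => ENNReal.ofReal (T : ℝ)⁻¹ *
      ∑ t, ENNReal.ofReal (g t ω)) (by fun_prop) (ENNReal.ofReal_pos.2 hη).ne' ENNReal.ofReal_ne_top
    refine h1.trans ?_
    rw [lintegral_const_mul' _ _ ENNReal.ofReal_ne_top, lintegral_finsetSum' _ (by fun_prop),
      ENNReal.ofReal_div_of_pos hη]
    refine ENNReal.div_le_div_right ?_ _
    calc _ ≤ ENNReal.ofReal (T : ℝ)⁻¹ * ∑ _t : Fin T, ENNReal.ofReal G := by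
          gcongr with t; exact hG t
      _ = ENNReal.ofReal G := by
          rw [Finset.sum_const, Finset.card_univ, Fintype.card_fin, nsmul_eq_mul, ← mul_assoc,
            ENNReal.ofReal_inv_of_pos hT', ENNReal.ofReal_natCast,
            ENNReal.inv_mul_cancel (by simpa using hT.ne') (ENNReal.natCast_ne_top T), one_mul]
  have hP₂ : P (⋃ a, ⋃ b, E₂ a b) ≤ ENNReal.ofReal (16 * m ^ 4 / (T * c₀ ^ 2)) := by
    refine (measure_iUnion_fintype_le _ _).trans ?_
    calc _ ≤ ∑ _a : Fin m, ∑ _b : Fin m, ENNReal.ofReal (1 / (T * δ ^ 2)) := by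
          refine Finset.sum_le_sum fun a _ => (measure_iUnion_fintype_le _ _).trans
            (Finset.sum_le_sum fun b _ => ?_)
          exact measure_abs_average_sub_ge_le hT (fun t => hSm t a b) (fun t ω => hSb t ω a b)
            (hSi a b) hδ0
      _ = _ := by
          simp only [Finset.sum_const, Finset.card_univ, Fintype.card_fin, nsmul_eq_mul]
          rw [← ENNReal.ofReal_natCast, ← ENNReal.ofReal_mul (by positivity),
            ← ENNReal.ofReal_mul (by positivity)]
          congr 1
          rw [hδ]; field_simp; ring
  have hSint : ∀ t a b, Integrable (fun ω => S t ω a b) P := fun t a b =>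
    Integrable.of_bound (hSm t a b).aestronglyMeasurable 1 (ae_of_all _ fun ω => hSb t ω a b)
  have hmain : ∀ᵐ ω ∂P, ω ∉ E₁ → ω ∉ (⋃ a, ⋃ b, E₂ a b) →
      frobeniusNorm (U' ω * (U' ω)ᵀ - U * Uᵀ) ^ 2 ≤ 8 * m * (4 * η / c₀) ^ 2 := by
    filter_upwards [hQ, hlead, hΓ] with ω hQω hleadω hΓω hω₁ hω₂
    choose Γ hΓ₁ hΓ₂ using hΓω
    have hg0 : ∀ t, 0 ≤ g t ω := fun t => (frobeniusNorm_nonneg _).trans (hΓ₁ t)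
    have hgbar : (T : ℝ)⁻¹ * ∑ t, g t ω < η := by
      rw [hE₁, Set.mem_ofPred_eq, not_le, ← ENNReal.ofReal_sum_of_nonneg (fun t _ => hg0 t),
        ← ENNReal.ofReal_mul (by positivity), ENNReal.ofReal_lt_ofReal_iff hη] at hω₁
      exact hω₁
    set B := (T : ℝ)⁻¹ • ∑ t, Γ t with hB
    have hdist : frobeniusNorm ((T : ℝ)⁻¹ • ∑ t, Q t ω - U * B * Uᵀ) ≤ η := by
      have e1 : (T : ℝ)⁻¹ • ∑ t, Q t ω - U * B * Uᵀ =
          (T : ℝ)⁻¹ • ∑ t, (Q t ω - U * Γ t * Uᵀ) := by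
        rw [hB, Finset.sum_sub_distrib, smul_sub, Matrix.mul_smul, Matrix.smul_mul,
          Matrix.mul_sum, Matrix.sum_mul]
      rw [e1, frobeniusNorm_smul, abs_of_pos (inv_pos.2 hT')]
      refine le_trans ?_ hgbar.le
      gcongr
      exact (frobeniusNorm_sum_le _ _).trans (Finset.sum_le_sum fun t _ => hΓ₁ t)
    -- The average of the S_t is at least c₀ - c₀/4 and at most 2B + η with η ≤ c₀/4, which leaves
    -- 2B ≥ c₀/2.
    have hBlow : ∀ u, c₀ / 4 * (u ⬝ᵥ u) ≤ u ⬝ᵥ (B *ᵥ u) := by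
      intro u
      have huu := dotProduct_self_nonneg' u
      set Sbar := (T : ℝ)⁻¹ • ∑ t, S t ω with hSbar
      set Mbar : Matrix (Fin m) (Fin m) ℝ :=
        (T : ℝ)⁻¹ • ∑ t, Matrix.of fun a b => ∫ ω', S t ω' a b ∂P with hMbar
      have e1 : c₀ * (u ⬝ᵥ u) ≤ u ⬝ᵥ (Mbar *ᵥ u) := by
        rw [hMbar, average_mulVec_dotProduct]
        have e2 : ∀ t, u ⬝ᵥ ((Matrix.of fun a b => ∫ ω', S t ω' a b ∂P) *ᵥ u) =
            ∫ ω', u ⬝ᵥ (S t ω' *ᵥ u) ∂P := by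
          intro t
          simp only [dotProduct, mulVec, Matrix.of_apply, Finset.mul_sum]
          rw [integral_finsetSum _ fun a _ => integrable_finsetSum _ fun b _ =>
            ((hSint t a b).mul_const _).const_mul _]
          refine Finset.sum_congr rfl fun a _ => ?_
          rw [integral_finsetSum _ fun b _ => ((hSint t a b).mul_const _).const_mul _]
          refine Finset.sum_congr rfl fun b _ => ?_
          rw [integral_const_mul, integral_mul_const]
        calc c₀ * (u ⬝ᵥ u) = (T : ℝ)⁻¹ * ∑ _t : Fin T, c₀ * (u ⬝ᵥ u) := by
              simp only [Finset.sum_const, Finset.card_univ, Fintype.card_fin, nsmul_eq_mul]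
              field_simp
          _ ≤ _ := by
              gcongr with t
              rw [e2]; exact hS t u
      have e3 : |u ⬝ᵥ ((Sbar - Mbar) *ᵥ u)| ≤ m * δ * (u ⬝ᵥ u) := by
        refine abs_dotProduct_mulVec_le (fun a b => ?_) u
        have h1 : ω ∉ E₂ a b := fun h => hω₂ (Set.mem_iUnion.2 ⟨a, Set.mem_iUnion.2 ⟨b, h⟩⟩)
        rw [hE₂, Set.mem_ofPred_eq, not_le] at h1
        refine le_trans (le_of_eq ?_) h1.le
        simp [hSbar, hMbar, Matrix.sum_apply]
      rw [Matrix.sub_mulVec, dotProduct_sub] at e3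
      have e4 : m * δ = c₀ / 4 := by rw [hδ]; field_simp
      rw [e4] at e3
      have e5 : u ⬝ᵥ (Sbar *ᵥ u) ≤ 2 * (u ⬝ᵥ (B *ᵥ u)) + η * (u ⬝ᵥ u) := by
        rw [hSbar, hB, average_mulVec_dotProduct, average_mulVec_dotProduct]
        calc _ ≤ (T : ℝ)⁻¹ * ∑ t, (2 * (u ⬝ᵥ (Γ t *ᵥ u)) + g t ω * (u ⬝ᵥ u)) := by
              gcongr with t; exact hΓ₂ t u
          _ = 2 * ((T : ℝ)⁻¹ * ∑ t, u ⬝ᵥ (Γ t *ᵥ u)) + (T : ℝ)⁻¹ * (∑ t, g t ω) * (u ⬝ᵥ u) := by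
              rw [Finset.sum_add_distrib, ← Finset.mul_sum, ← Finset.sum_mul]; ring
          _ ≤ _ := by gcongr
      have e6 : η * (u ⬝ᵥ u) ≤ c₀ / 4 * (u ⬝ᵥ u) := by gcongr
      linarith [(abs_le.1 e3).1]
    have hpsd : ∀ x, 0 ≤ x ⬝ᵥ (((T : ℝ)⁻¹ • ∑ t, Q t ω) *ᵥ x) := by
      intro x
      rw [average_mulVec_dotProduct]
      exact mul_nonneg (inv_nonneg.2 hT'.le) (Finset.sum_nonneg fun t _ => hQω t x)
    refine (hleadω.frobeniusNorm_sub_le_of_compression hpsd hU (by positivity) hBlow).trans ?_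
    have h2 : frobeniusNorm ((T : ℝ)⁻¹ • ∑ t, Q t ω - U * B * Uᵀ) * (c₀ / 4)⁻¹ ≤ 4 * η / c₀ := by
      rw [inv_div, show 4 * η / c₀ = η * (4 / c₀) by ring]
      gcongr
    have h3 := frobeniusNorm_nonneg ((T : ℝ)⁻¹ • ∑ t, Q t ω - U * B * Uᵀ)
    gcongr
  -- Monotonicity of the outer measure suffices, so `U'` and `Q` need not be measurable.
  calc _ ≤ P (E₁ ∪ ⋃ a, ⋃ b, E₂ a b) := by
        refine measure_mono_ae ?_
        filter_upwards [hmain] with ω hω hlt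
        by_contra hnot
        have h1 : ω ∉ E₁ := fun h => hnot (Or.inl h)
        have h2 : ω ∉ ⋃ a, ⋃ b, E₂ a b := fun h => hnot (Or.inr h)
        exact absurd (hω h1 h2) (not_le.2 hlt)
    _ ≤ _ := (measure_union_le _ _).trans (add_le_add hP₁ hP₂)

end Averages

/-! ### One side of the estimator for a single model. -/

theorem opNorm_transpose_mul_mul_le {p q m n : ℕ} {U : Matrix (Fin p) (Fin m) ℝ}
    {V : Matrix (Fin q) (Fin n) ℝ} (hU : Uᵀ * U = 1) (hV : Vᵀ * V = 1)
    (N : Matrix (Fin p) (Fin q) ℝ) : ‖Uᵀ * N * V‖ ≤ ‖N‖ := by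
  have hU1 : ‖Uᵀ‖ ≤ 1 := (opNorm_transpose U).trans_le (opNorm_le_one_of_transpose_mul_self hU)
  have h := opNorm_mul_le_of_le (opNorm_mul_le_of_le hU1 (le_refl ‖N‖))
    (opNorm_le_one_of_transpose_mul_self hV)
  simpa using h

theorem transpose_mul_factor_mul {p q m n : ℕ} {U : Matrix (Fin p) (Fin m) ℝ}
    {V : Matrix (Fin q) (Fin n) ℝ} (hU : Uᵀ * U = 1) (hV : Vᵀ * V = 1)
    (A : Matrix (Fin m) (Fin n) ℝ) (N : Matrix (Fin p) (Fin q) ℝ) :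
    Uᵀ * (U * A * Vᵀ + N) * V = A + Uᵀ * N * V := by
  rw [Matrix.mul_add, Matrix.add_mul]
  congr 1
  calc _ = (Uᵀ * U) * A * (Vᵀ * V) := by simp only [Matrix.mul_assoc]
    _ = A := by rw [hU, hV, Matrix.one_mul, Matrix.mul_one]

/-- The leading eigenvectors of a perturbed low-rank matrix span almost the column space of the
low-rank part. -/
theorem IsLeadingEigenvectors.factor_bound {p q m n k : ℕ} (hk : k = min m n) (hk0 : 0 < k)
    {U : Matrix (Fin p) (Fin m) ℝ} {V : Matrix (Fin q) (Fin n) ℝ} (hU : Uᵀ * U = 1)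
    (hV : Vᵀ * V = 1) {A : Matrix (Fin m) (Fin n) ℝ} {Γ : Matrix (Fin m) (Fin m) ℝ} {τ : ℝ}
    (hΓ : IsColumnProjection A k τ Γ) {N : Matrix (Fin p) (Fin q) ℝ} {ρ : ℝ} (hρ : ‖N‖ * τ ≤ ρ)
    {s : ℝ} (hs : 0 < s) {X : Matrix (Fin p) (Fin q) ℝ} (hX : X = s • (U * A * Vᵀ + N))
    {R : Matrix (Fin p) (Fin k) ℝ} (h : IsLeadingEigenvectors (X * Xᵀ) R) :
    frobeniusNorm (R * Rᵀ - U * Γ * Uᵀ) ≤ √(8 * k) * √ρ ∧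
      ∀ u, u ⬝ᵥ (normalizedGram (Uᵀ * X * V) *ᵥ u) ≤
        2 * (u ⬝ᵥ (Γ *ᵥ u)) + 4 * √ρ * (u ⬝ᵥ u) := by
  obtain ⟨M, hM, hMτ⟩ := hΓ.exists_factor
  have hτ : 0 ≤ τ := (norm_nonneg _).trans hMτ
  constructor
  -- The scale s multiplies the low-rank part and the noise, and s⁻¹ multiplies the generalized
  -- inverse, so ρ is scale-free.
  · refine h.frobeniusNorm_sub_le_sqrt (S := s • (U * A * Vᵀ)) (L := s⁻¹ • (V * M * Uᵀ))
      (τ := s⁻¹ * τ) ?_ ?_ ?_ ?_ ?_ ?_ ?_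
    · have e : s • (U * A * Vᵀ) = U * (A * (s • Vᵀ)) := by
        rw [Matrix.mul_smul, Matrix.mul_smul, Matrix.mul_assoc]
      rw [e, hk]
      refine (Matrix.rank_mul_le_right _ _).trans ((Matrix.rank_mul_le_left _ _).trans ?_)
      exact le_min ((Matrix.rank_le_height A)) (Matrix.rank_le_width A)
    · rw [Matrix.transpose_mul, Matrix.transpose_mul, Matrix.transpose_transpose, hΓ.symm,
        Matrix.mul_assoc]
    · calc _ = U * (Γ * (Uᵀ * U) * Γ) * Uᵀ := by simp only [Matrix.mul_assoc]
        _ = _ := by rw [hU, Matrix.mul_one, hΓ.idem]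
    · rw [Matrix.trace_mul_comm, ← Matrix.mul_assoc, hU, Matrix.one_mul, hΓ.trace_eq]
    · rw [Matrix.smul_mul, Matrix.mul_smul, smul_smul, mul_inv_cancel₀ hs.ne', one_smul]
      calc _ = U * (A * M) * Uᵀ := by rw [hM]
        _ = U * A * (Vᵀ * V) * M * Uᵀ := by rw [hV, Matrix.mul_one]; simp only [Matrix.mul_assoc]
        _ = U * A * Vᵀ * (V * M * Uᵀ) := by simp only [Matrix.mul_assoc]
    · rw [norm_smul, Real.norm_eq_abs, abs_of_pos (inv_pos.2 hs)]
      gcongr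
      have hU1 : ‖Uᵀ‖ ≤ 1 :=
        (opNorm_transpose U).trans_le (opNorm_le_one_of_transpose_mul_self hU)
      have := opNorm_mul_le_of_le
        (opNorm_mul_le_of_le (opNorm_le_one_of_transpose_mul_self hV) hMτ) hU1
      simpa using this
    · have e : X - s • (U * A * Vᵀ) = s • N := by rw [hX, smul_add, add_sub_cancel_left]
      rw [e, norm_smul, Real.norm_eq_abs, abs_of_pos hs]
      refine le_trans (le_of_eq ?_) hρ
      field_simp
  · intro u
    have e : Uᵀ * X * V = s • (A + Uᵀ * N * V) := by
      rw [hX, Matrix.mul_smul, Matrix.smul_mul, transpose_mul_factor_mul hU hV]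
    rw [e, normalizedGram_smul _ hs.ne']
    refine hΓ.dotProduct_normalizedGram_le hk0 (le_trans ?_ hρ) u
    exact mul_le_mul_of_nonneg_right (opNorm_transpose_mul_mul_le hU hV N) hτ

/-- The Gaussian noise term of the factor model, scaled by the square root of the dimensions. -/
noncomputable def noiseMatrix {p q : ℕ} {κ : Type*} (D₁ : Matrix (Fin p) (Fin p) ℝ)
    (D₂ : Matrix (Fin q) (Fin q) ℝ) (f : Fin p × Fin q → κ) (z : κ → ℝ) :
    Matrix (Fin p) (Fin q) ℝ :=
  (√((p : ℝ) * q))⁻¹ • (D₁ * (entryMatrix fun a => z (f a)) * D₂)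

theorem norm_noiseMatrix_le {p q : ℕ} {κ : Type*} {D₁ : Matrix (Fin p) (Fin p) ℝ}
    {D₂ : Matrix (Fin q) (Fin q) ℝ} {d : ℝ} (h₁ : ‖D₁‖ ≤ d) (h₂ : ‖D₂‖ ≤ d)
    (f : Fin p × Fin q → κ) (z : κ → ℝ) :
    ‖noiseMatrix D₁ D₂ f z‖ ≤ d ^ 2 * (√((p : ℝ) * q))⁻¹ * ‖entryMatrix fun a => z (f a)‖ := by
  rw [noiseMatrix, norm_smul, Real.norm_eq_abs, abs_of_nonneg (inv_nonneg.2 (Real.sqrt_nonneg _))]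
  have := opNorm_mul_le_of_le
    (opNorm_mul_le_of_le h₁ (le_refl ‖entryMatrix fun a => z (f a)‖)) h₂
  calc _ ≤ (√((p : ℝ) * q))⁻¹ * (d * ‖entryMatrix fun a => z (f a)‖ * d) := by gcongr
    _ = _ := by ring

/-- A finite negative moment excludes a zero determinant, because 0 to the power -3/4 is ∞. -/
theorem ae_det_entryMatrix_ne_zero {κ : Type*} [Fintype κ] {k : ℕ} {e : Fin k × Fin k → κ}
    (he : Function.Injective e) :
    ∀ᵐ z ∂stdGaussianPi κ, (entryMatrix fun a => z (e a)).det ≠ 0 := by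
  obtain ⟨K, hK1, hKt, hK⟩ := exists_lintegral_enorm_add_rpow_le
  have h := lintegral_enorm_det_rpow_le hK1 hK k e he
  have h2 := ae_lt_top' (μ := stdGaussianPi κ)
    (f := fun z => ‖(entryMatrix fun a => z (e a)).det‖ₑ ^ (-(3 / 4) : ℝ)) (by
      have : Measurable fun z : κ → ℝ => (entryMatrix fun a => z (e a)).det :=
        (continuous_entryMatrix_comp e).matrix_det.measurable
      exact (this.enorm.pow_const _).aemeasurable)
    (ne_top_of_le_ne_top (ENNReal.pow_ne_top hKt) h)
  filter_upwards [h2] with z hz h0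
  rw [h0] at hz
  simp at hz

theorem measurable_noiseMatrix_apply {p q : ℕ} {κ : Type*} [Fintype κ]
    (D₁ : Matrix (Fin p) (Fin p) ℝ) (D₂ : Matrix (Fin q) (Fin q) ℝ) (f : Fin p × Fin q → κ)
    (i : Fin p) (j : Fin q) : Measurable fun z : κ → ℝ => noiseMatrix D₁ D₂ f z i j := by
  simp only [noiseMatrix, entryMatrix, Matrix.smul_apply, Matrix.mul_apply, Matrix.of_apply,
    smul_eq_mul]
  fun_prop

/-- The relative size of the noise: the square root of the perturbation bound. -/
theorem exists_lintegral_sqrt_perturbation_le (k : ℕ) : ∃ K : ℝ, 0 < K ∧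
    ∀ {p q : ℕ}, 0 < p → 0 < q → ∀ {κ : Type} [Fintype κ] {e : Fin k × Fin k → κ}
      {f : Fin p × Fin q → κ}, Function.Injective e → Function.Injective f → ∀ {d β : ℝ},
      0 ≤ β → 0 ≤ d →
      ∫⁻ z, ENNReal.ofReal √(d ^ 2 * (√((p : ℝ) * q))⁻¹ * ‖entryMatrix fun a => z (f a)‖ *
        (β * β * (|(entryMatrix fun a => z (e a)).det|⁻¹ *
          ‖(entryMatrix fun a => z (e a)).adjugate‖))) ∂stdGaussianPi κ ≤
      ENNReal.ofReal (K * (d * β * √(√(p + q) / √((p : ℝ) * q)))) := by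
  obtain ⟨K, hKt, hK⟩ := exists_lintegral_sqrt_le k
  refine ⟨K.toReal + 1, by positivity, ?_⟩
  intro p q hp hq κ _ e f he hf d β hβ hd
  have hp' : (0 : ℝ) < p := by exact_mod_cast hp
  have hq' : (0 : ℝ) < q := by exact_mod_cast hq
  have h1 := hK hp he hf
  set x := √((p : ℝ) + q) / √((p : ℝ) * q) with hx
  have e1 : ∀ z : κ → ℝ, √(d ^ 2 * (√((p : ℝ) * q))⁻¹ * ‖entryMatrix fun a => z (f a)‖ *
        (β * β * (|(entryMatrix fun a => z (e a)).det|⁻¹ *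
          ‖(entryMatrix fun a => z (e a)).adjugate‖))) =
      d * β * √x * (√(‖entryMatrix fun a => z (f a)‖ / √(p + q)) *
        √‖(entryMatrix fun a => z (e a)).adjugate‖ * √(|(entryMatrix fun a => z (e a)).det|⁻¹)) := by
    intro z
    have hpq : 0 < √((p : ℝ) + q) := Real.sqrt_pos.2 (by positivity)
    have e2 : d ^ 2 * (√((p : ℝ) * q))⁻¹ * ‖entryMatrix fun a => z (f a)‖ *
        (β * β * (|(entryMatrix fun a => z (e a)).det|⁻¹ *
          ‖(entryMatrix fun a => z (e a)).adjugate‖)) =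
        (d * β) ^ 2 * x * (‖entryMatrix fun a => z (f a)‖ / √(p + q) *
          ‖(entryMatrix fun a => z (e a)).adjugate‖ * |(entryMatrix fun a => z (e a)).det|⁻¹) := by
      rw [hx]; field_simp
    rw [e2, Real.sqrt_mul (by positivity), Real.sqrt_mul (by positivity), Real.sqrt_mul (by positivity),
      Real.sqrt_mul (by positivity), Real.sqrt_sq (by positivity)]
  simp only [e1]
  have hc : 0 ≤ d * β * √x := by positivity
  simp only [ENNReal.ofReal_mul hc]
  rw [lintegral_const_mul' _ _ ENNReal.ofReal_ne_top, mul_comm (K.toReal + 1), ENNReal.ofReal_mul hc]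
  gcongr
  refine h1.trans ?_
  rw [ENNReal.le_ofReal_iff_toReal_le hKt (by positivity)]
  linarith

/-- Consistency of one side of the estimator for a fixed model, with explicit probability bound. -/
theorem exists_measure_subspace_distance_le {m n k : ℕ} (hm : 0 < m) (hn : 0 < n)
    (hk : k = min m n) {c b d : ℝ} (hc : 0 < c) (hd : 0 ≤ d) :
    ∃ K : ℝ, 0 < K ∧ ∃ c₀ : ℝ, 0 < c₀ ∧ ∃ x₀ : ℝ, 0 < x₀ ∧
    ∀ {p q T : ℕ}, 0 < p → 0 < q → 0 < T → √(p + q) / √((p : ℝ) * q) ≤ x₀ →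
    ∀ {κ : Type} [Fintype κ] {e : Fin m × Fin n → κ} {f : Fin p × Fin q → κ},
    Function.Injective e → Function.Injective f →
    ∀ {U : Matrix (Fin p) (Fin m) ℝ} {V : Matrix (Fin q) (Fin n) ℝ}, Uᵀ * U = 1 → Vᵀ * V = 1 →
    ∀ {B₁ : Matrix (Fin m) (Fin m) ℝ} {B₂ : Matrix (Fin n) (Fin n) ℝ}
      {D₁ : Matrix (Fin p) (Fin p) ℝ} {D₂ : Matrix (Fin q) (Fin q) ℝ},
    B₁ᵀ = B₁ → B₂ᵀ = B₂ →
    (∀ x, c ^ 2 * (x ⬝ᵥ x) ≤ (B₁ *ᵥ x) ⬝ᵥ (B₁ *ᵥ x)) →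
    (∀ x, c ^ 2 * (x ⬝ᵥ x) ≤ (B₂ *ᵥ x) ⬝ᵥ (B₂ *ᵥ x)) →
    ‖B₁‖ ≤ b → ‖B₂‖ ≤ b → ‖D₁‖ ≤ d → ‖D₂‖ ≤ d →
    ∀ {Ω : Type*} [MeasurableSpace Ω] {P : Measure Ω} [IsProbabilityMeasure P]
      {Z : Fin T → Ω → κ → ℝ} {X : Fin T → Ω → Matrix (Fin p) (Fin q) ℝ},
    (∀ t, HasLaw (Z t) (stdGaussianPi κ) P) →
    (∀ t, ∀ᵐ ω ∂P, ∃ s : ℝ, 0 < s ∧ X t ω =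
      s • (U * (B₁ * (entryMatrix fun a => Z t ω (e a)) * B₂) * Vᵀ + noiseMatrix D₁ D₂ f (Z t ω))) →
    iIndepFun (fun t ω (a : Fin p × Fin q) => X t ω a.1 a.2) P →
    ∀ {U' : Ω → Matrix (Fin p) (Fin m) ℝ},
    (∀ᵐ ω ∂P, ∃ Rt : Fin T → Matrix (Fin p) (Fin k) ℝ,
      (∀ t, IsLeadingEigenvectors (X t ω * (X t ω)ᵀ) (Rt t)) ∧
        IsLeadingEigenvectors ((T : ℝ)⁻¹ • ∑ t, Rt t * (Rt t)ᵀ) (U' ω)) →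
    ∀ {η : ℝ}, 0 < η → η ≤ c₀ / 4 →
    P {ω | 8 * m * (4 * η / c₀) ^ 2 < frobeniusNorm (U' ω * (U' ω)ᵀ - U * Uᵀ) ^ 2} ≤
      ENNReal.ofReal (K * √(√(p + q) / √((p : ℝ) * q)) / η) +
        ENNReal.ofReal (16 * m ^ 4 / (T * c₀ ^ 2)) := by
  classical
  have hk0 : 0 < k := by omega
  obtain ⟨K, hK0, hK⟩ := exists_lintegral_sqrt_perturbation_le k
  obtain ⟨c₀, hc₀, η₀, hη₀, hlow⟩ := exists_le_integral_normalizedGram m hn (b := b)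
    (pow_pos hc 2)
  -- One constant serves both uses of √ρ: √(8k) from the distance of projections and 4 from the
  -- domination of the Gram matrix.
  set γ : ℝ := √(8 * k) + 4 with hγ
  have hγ0 : 0 < γ := by positivity
  -- The threshold on x makes the second moment 3936 d⁴ x² of the noise bound at most η₀; the
  -- summands 1 cover d = 0.
  refine ⟨γ * (K * (d * c⁻¹)) + 1, by positivity, c₀, hc₀, √(η₀ / (3936 * d ^ 4 + 1)),
    by positivity, ?_⟩
  intro p q T hp hq hT hx κ _ e f he hf U V hU hV B₁ B₂ D₁ D₂ hB₁T hB₂T hB₁ hB₂ hB₁b hB₂b hD₁ hD₂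
    Ω _ P _ Z X hZ hX hXi U' hU' η hη hηc
  have hp' : (0 : ℝ) < p := by exact_mod_cast hp
  have hq' : (0 : ℝ) < q := by exact_mod_cast hq
  set x := √((p : ℝ) + q) / √((p : ℝ) * q) with hxdef
  have hx0 : 0 ≤ x := by positivity
  set e' : Fin k × Fin k → κ := fun a =>
    e (Fin.castLE (hk.trans_le (min_le_left m n)) a.1,
      Fin.castLE (hk.trans_le (min_le_right m n)) a.2) with he'
  have he'i : Function.Injective e' := by
    intro a a' h
    have := he h
    simp only [Prod.mk.injEq, Fin.castLE_inj] at this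
    exact Prod.ext this.1 this.2
  set ρ : (κ → ℝ) → ℝ := fun z => d ^ 2 * (√((p : ℝ) * q))⁻¹ * ‖entryMatrix fun a => z (f a)‖ *
        (c⁻¹ * c⁻¹ * (|(entryMatrix fun a => z (e' a)).det|⁻¹ *
          ‖(entryMatrix fun a => z (e' a)).adjugate‖)) with hρ
  have hρm : Measurable ρ := by
    have h1 : Measurable fun z : κ → ℝ => ‖entryMatrix fun a => z (f a)‖ :=
      (continuous_entryMatrix_comp f).norm.measurable
    have h2 : Measurable fun z : κ → ℝ => (entryMatrix fun a => z (e' a)).det :=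
      (continuous_entryMatrix_comp e').matrix_det.measurable
    have h3 : Measurable fun z : κ → ℝ => ‖(entryMatrix fun a => z (e' a)).adjugate‖ :=
      (continuous_entryMatrix_comp e').matrix_adjugate.norm.measurable
    rw [hρ]
    fun_prop
  have hX' : ∀ᵐ ω ∂P, ∀ t, ∃ s : ℝ, 0 < s ∧ X t ω =
      s • (U * (B₁ * (entryMatrix fun a => Z t ω (e a)) * B₂) * Vᵀ +
        noiseMatrix D₁ D₂ f (Z t ω)) := ae_all_iff.2 hX
  set H : (κ → ℝ) → Matrix (Fin m) (Fin n) ℝ := fun z => Uᵀ * noiseMatrix D₁ D₂ f z * V with hH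
  set A : (κ → ℝ) → Matrix (Fin m) (Fin n) ℝ := fun z =>
    B₁ * (entryMatrix fun a => z (e a)) * B₂ with hA
  have hHm : ∀ i j, Measurable fun z => H z i j := by
    intro i j
    have h1 := measurable_noiseMatrix_apply D₁ D₂ f
    simp only [hH, Matrix.mul_apply]
    fun_prop
  have hAm : ∀ i j, Measurable fun z => A z i j := by
    intro i j
    simp only [hA, entryMatrix, Matrix.mul_apply, Matrix.of_apply]
    fun_prop
  have hSm : ∀ a b, Measurable fun z => normalizedGram (A z + H z) a b :=
    measurable_normalizedGram_apply fun i j => (hAm i j).add (hHm i j)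
  have hSeq : ∀ t, ∀ᵐ ω ∂P,
      normalizedGram (Uᵀ * X t ω * V) = normalizedGram (A (Z t ω) + H (Z t ω)) := by
    intro t
    filter_upwards [hX t] with ω ⟨s, hs, hω⟩
    rw [hω, Matrix.mul_smul, Matrix.smul_mul, transpose_mul_factor_mul hU hV,
      normalizedGram_smul _ hs.ne']
  have hdet : ∀ᵐ ω ∂P, ∀ t, (entryMatrix fun a => Z t ω (e' a)).det ≠ 0 := by
    refine ae_all_iff.2 fun t => ?_
    have h := ae_det_entryMatrix_ne_zero he'i
    rw [← (hZ t).map_eq] at h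
    exact ae_of_ae_map (hZ t).aemeasurable h
  have hB₁i := isUnit_det_of_le_dotProduct hc hB₁
  have hB₂i := isUnit_det_of_le_dotProduct hc hB₂
  have hmain := measure_subspace_distance_le (P := P) hT hm hU
    -- A function of the observation alone, so it inherits independence over time; independence of
    -- the Z_t is not assumed.
    (S := fun t ω => normalizedGram (Uᵀ * X t ω * V))
    (g := fun t ω => γ * √(ρ (Z t ω))) (G := γ * (K * (d * c⁻¹ * √x))) (U' := U')
    -- The projections are chosen separately for each ω, with value 0 on the null set where the
    -- estimator conditions fail.
    (Q := fun t ω => if h : ∃ Rt : Fin T → Matrix (Fin p) (Fin k) ℝ,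
      (∀ t, IsLeadingEigenvectors (X t ω * (X t ω)ᵀ) (Rt t)) ∧
        IsLeadingEigenvectors ((T : ℝ)⁻¹ • ∑ t, Rt t * (Rt t)ᵀ) (U' ω)
      then h.choose t * (h.choose t)ᵀ else 0)
    (fun t a b => ?_) (fun t ω a b => abs_normalizedGram_apply_le _ a b) (fun a b => ?_) hc₀
    (fun t u => ?_) (fun t => ?_) (fun t => ?_) ?_ ?_ ?_ hη hηc
  · refine hmain.trans ?_
    have h1 : γ * (K * (d * c⁻¹ * √x)) ≤ (γ * (K * (d * c⁻¹)) + 1) * √x := by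
      linarith [Real.sqrt_nonneg x]
    gcongr
  · refine (((hSm a b).comp_aemeasurable (hZ t).aemeasurable)).congr ?_
    filter_upwards [hSeq t] with ω hω
    rw [hω]; rfl
  · have h := hXi.comp (fun _ (w : Fin p × Fin q → ℝ) =>
      normalizedGram (Uᵀ * entryMatrix w * V) a b) (fun _ => by
        refine measurable_normalizedGram_apply (fun i j => ?_) a b
        simp only [entryMatrix, Matrix.mul_apply, Matrix.of_apply]
        fun_prop)
    exact h
  · have h1 : ∫ ω, u ⬝ᵥ (normalizedGram (Uᵀ * X t ω * V) *ᵥ u) ∂P =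
        ∫ z, u ⬝ᵥ (normalizedGram (A z + H z) *ᵥ u) ∂stdGaussianPi κ := by
      rw [← (hZ t).map_eq, integral_map (hZ t).aemeasurable]
      · refine integral_congr_ae ?_
        filter_upwards [hSeq t] with ω hω
        rw [hω]
      · refine Measurable.aestronglyMeasurable ?_
        simp only [dotProduct, mulVec]
        fun_prop
    rw [h1]
    refine hlow he (by rwa [hB₁T]) (by rwa [hB₂T]) hB₁b hB₂b hHm
      (h := fun z => d ^ 2 * (√((p : ℝ) * q))⁻¹ * ‖entryMatrix fun a => z (f a)‖) ?_ (fun z => ?_)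
      ?_ u
    · exact ((continuous_entryMatrix_comp f).norm.measurable).const_mul _
    · exact (opNorm_transpose_mul_mul_le hU hV _).trans (norm_noiseMatrix_le hD₁ hD₂ f z)
    · have h2 : ∫⁻ z, ENNReal.ofReal (‖entryMatrix fun a => z (f a)‖ ^ 2) ∂stdGaussianPi κ ≤
          ENNReal.ofReal (3936 * (p + q)) := by
        refine le_trans (le_of_eq ?_) (lintegral_opNorm_sq_le (p := p) (q := q) hp)
        exact lintegral_comp_stdGaussianPi hf
          (f := fun w => ENNReal.ofReal (‖entryMatrix w‖ ^ 2)) (by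
            exact (continuous_entryMatrix.norm.pow 2).measurable.ennreal_ofReal)
      simp only [mul_pow _ ‖_‖]
      simp only [ENNReal.ofReal_mul (show 0 ≤ (d ^ 2 * (√((p : ℝ) * q))⁻¹) ^ 2 by positivity)]
      rw [lintegral_const_mul' _ _ ENNReal.ofReal_ne_top]
      refine (mul_le_mul_right h2 _).trans ?_
      rw [← ENNReal.ofReal_mul (by positivity)]
      refine ENNReal.ofReal_le_ofReal ?_
      have hx2 : x ^ 2 ≤ η₀ / (3936 * d ^ 4 + 1) := by
        have := pow_le_pow_left₀ hx0 hx 2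
        rwa [Real.sq_sqrt (by positivity)] at this
      have e1 : (d ^ 2 * (√((p : ℝ) * q))⁻¹) ^ 2 * (3936 * (p + q)) = 3936 * d ^ 4 * x ^ 2 := by
        rw [hxdef, div_pow, Real.sq_sqrt (by positivity : (0 : ℝ) ≤ p + q), mul_pow, inv_pow]
        ring
      rw [e1]
      rw [le_div_iff₀ (by positivity)] at hx2
      nlinarith [sq_nonneg x]
  · exact ((hρm.sqrt.const_mul γ).comp_aemeasurable (hZ t).aemeasurable)
  · have h1 : ∫⁻ ω, ENNReal.ofReal (γ * √(ρ (Z t ω))) ∂P =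
        ∫⁻ z, ENNReal.ofReal (γ * √(ρ z)) ∂stdGaussianPi κ :=
      (hZ t).lintegral_comp (f := fun z => ENNReal.ofReal (γ * √(ρ z)))
        (hρm.sqrt.const_mul γ).ennreal_ofReal.aemeasurable
    rw [h1]
    simp only [ENNReal.ofReal_mul hγ0.le]
    rw [lintegral_const_mul' _ _ ENNReal.ofReal_ne_top]
    gcongr
    exact hK hp hq he'i hf (inv_nonneg.2 hc.le) hd
  · refine ae_of_all _ fun ω t y => ?_
    split_ifs with h
    · rw [← Matrix.mulVec_mulVec, Matrix.dotProduct_mulVec, ← Matrix.mulVec_transpose]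
      exact dotProduct_self_nonneg' _
    · simp
  · filter_upwards [hU'] with ω h
    simp only [dif_pos h]
    exact h.choose_spec.2
  · filter_upwards [hU', hX', hdet] with ω h hXω hdω t
    simp only [dif_pos h]
    obtain ⟨s, hs, hXs⟩ := hXω t
    obtain ⟨Γ, hΓ⟩ := exists_isColumnProjection hk (entryMatrix fun a => Z t ω (e a)) hB₁i hB₂i
      (opNorm_inv_le_of_le_dotProduct hc hB₁) (opNorm_inv_le_of_le_dotProduct hc hB₂)
      (D := entryMatrix fun a => Z t ω (e' a)) rfl (hdω t)
    have hρt : ‖noiseMatrix D₁ D₂ f (Z t ω)‖ * (c⁻¹ * c⁻¹ *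
        (|(entryMatrix fun a => Z t ω (e' a)).det|⁻¹ *
          ‖(entryMatrix fun a => Z t ω (e' a)).adjugate‖)) ≤ ρ (Z t ω) :=
      mul_le_mul_of_nonneg_right (norm_noiseMatrix_le hD₁ hD₂ f _) (by positivity)
    obtain ⟨h1, h2⟩ := (h.choose_spec.1 t).factor_bound hk hk0 hU hV hΓ hρt hs hXs
    refine ⟨Γ, h1.trans ?_, fun u => (h2 u).trans ?_⟩
    · gcongr; rw [hγ]; linarith
    · have := dotProduct_self_nonneg' u
      gcongr; rw [hγ]; linarith [Real.sqrt_nonneg (8 * k : ℝ)]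

/-! ### Rates along a family of models. -/

theorem sqrt_add_div_sqrt_mul_le {p q : ℕ} (hp : 0 < p) (hq : 0 < q) :
    √((p : ℝ) + q) / √((p : ℝ) * q) ≤ (p : ℝ) ^ (-(1 / 2) : ℝ) + (q : ℝ) ^ (-(1 / 2) : ℝ) := by
  have hp' : (0 : ℝ) < p := by exact_mod_cast hp
  have hq' : (0 : ℝ) < q := by exact_mod_cast hq
  have h1 : √((p : ℝ) + q) ≤ √p + √q := by
    rw [Real.sqrt_le_left (by positivity), add_sq, Real.sq_sqrt hp'.le, Real.sq_sqrt hq'.le]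
    have : 0 ≤ √(p : ℝ) * √q := by positivity
    linarith
  rw [Real.rpow_neg hp'.le, Real.rpow_neg hq'.le, ← Real.sqrt_eq_rpow, ← Real.sqrt_eq_rpow,
    Real.sqrt_mul hp'.le]
  have hp2 : 0 < √(p : ℝ) := Real.sqrt_pos.2 hp'
  have hq2 : 0 < √(q : ℝ) := Real.sqrt_pos.2 hq'
  calc _ ≤ (√(p : ℝ) + √q) / (√p * √q) := by gcongr
    _ = _ := by field_simp; ring

/-- An explicit bound for the distance of subspaces at every level yields a rate for the rotated
loadings. -/
theorem exists_rotation_isBigOInProb {m : ℕ} {ι : Type*} {l : Filter ι} {p T : ι → ℕ}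
    {x a : ι → ℝ} (hp : ∀ᶠ i in l, 0 < p i) (hT : Tendsto T l atTop) (hx0 : ∀ᶠ i in l, 0 < x i)
    (hx : Tendsto x l (nhds 0)) (hxa : ∀ᶠ i in l, x i ≤ a i) {Ω : ι → Type*}
    [∀ i, MeasurableSpace (Ω i)] (P : ∀ i, Measure (Ω i))
    (R : ∀ i, Matrix (Fin (p i)) (Fin m) ℝ) (Rhat : ∀ i, Ω i → Matrix (Fin (p i)) (Fin m) ℝ)
    (hR : ∀ᶠ i in l, ((√(p i : ℝ))⁻¹ • R i)ᵀ * ((√(p i : ℝ))⁻¹ • R i) = 1)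
    (hRhat : ∀ᶠ i in l, ∀ᵐ ω ∂P i,
      ((√(p i : ℝ))⁻¹ • Rhat i ω)ᵀ * ((√(p i : ℝ))⁻¹ • Rhat i ω) = 1)
    {K c₀ : ℝ} (hK : 0 < K) (hc₀ : 0 < c₀)
    (h : ∀ᶠ i in l, ∀ η : ℝ, 0 < η → η ≤ c₀ / 4 →
      P i {ω | 8 * m * (4 * η / c₀) ^ 2 <
        frobeniusNorm (((√(p i : ℝ))⁻¹ • Rhat i ω) * ((√(p i : ℝ))⁻¹ • Rhat i ω)ᵀ -
          ((√(p i : ℝ))⁻¹ • R i) * ((√(p i : ℝ))⁻¹ • R i)ᵀ) ^ 2} ≤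
      ENNReal.ofReal (K * √(x i) / η) + ENNReal.ofReal (16 * m ^ 4 / (T i * c₀ ^ 2))) :
    ∃ H : ∀ i, Ω i → Matrix.orthogonalGroup (Fin m) ℝ,
      (∀ i, (∀ b c, Measurable fun ω => Rhat i ω b c) →
        ∀ b c, Measurable fun ω => (H i ω : Matrix (Fin m) (Fin m) ℝ) b c) ∧
      IsBigOInProb l P (fun i ω => frobeniusNorm
        (Rhat i ω - R i * (H i ω : Matrix (Fin m) (Fin m) ℝ)) ^ 2 / (p i : ℝ)) a := by
  have hε : ∀ i, 0 < if 0 < a i then a i else 1 := fun i => by split_ifs <;> positivity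
  choose f hfm hf using fun i => exists_measurable_rotation m (hε i)
  refine ⟨fun i ω => f i (((√(p i : ℝ))⁻¹ • R i)ᵀ * ((√(p i : ℝ))⁻¹ • Rhat i ω)),
    fun i hm => ?_, fun ε hε0 => ?_⟩
  · refine hfm i _ fun b c => ?_
    simp only [Matrix.mul_apply, Matrix.smul_apply, smul_eq_mul]
    fun_prop
  -- The level η = (2K/ε)√x makes the first probability equal to ε/2 and the squared distance at
  -- most L x; the second probability tends to 0 with 1/T.
  · set L : ℝ := 8 * m * (4 * (2 * K / ε) / c₀) ^ 2 with hL
    have hL0 : 0 ≤ L := by positivity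
    refine ⟨(4 * m + 1) * L + 1, by positivity, ?_⟩
    have hη : Tendsto (fun i => 2 * K / ε * √(x i)) l (nhds 0) := by
      have := (hx.sqrt).const_mul (2 * K / ε)
      simpa using this
    have hTt : Tendsto (fun i => 16 * (m : ℝ) ^ 4 / (T i * c₀ ^ 2)) l (nhds 0) :=
      ((tendsto_natCast_atTop_atTop.comp hT).atTop_mul_const (by positivity)).const_div_atTop _
    filter_upwards [hp, hx0, hxa, hR, hRhat, h, hη.eventually_le_const (by positivity : 0 < c₀ / 4),
      hTt.eventually_le_const (half_pos hε0)] with i hpi hxi hxai hRi hRhati hi hηi hTi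
    have hp' : (0 : ℝ) < p i := by exact_mod_cast hpi
    have hsp : 0 < √(p i : ℝ) := Real.sqrt_pos.2 hp'
    have hsx : 0 < √(x i) := Real.sqrt_pos.2 hxi
    have hai : 0 < a i := hxi.trans_le hxai
    have h1 := hi _ (by positivity) hηi
    have e1 : K * √(x i) / (2 * K / ε * √(x i)) = ε / 2 := by field_simp
    rw [e1] at h1
    have h2 : ENNReal.ofReal (ε / 2) + ENNReal.ofReal (16 * m ^ 4 / (T i * c₀ ^ 2)) ≤
        ENNReal.ofReal ε := by
      rw [← ENNReal.ofReal_add (by positivity) (by positivity)]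
      exact ENNReal.ofReal_le_ofReal (by linarith)
    refine le_trans (measure_mono_ae ?_) (h1.trans h2)
    filter_upwards [hRhati] with ω hω hbad
    have hbad' : ((4 * m + 1) * L + 1) * |a i| < |frobeniusNorm (Rhat i ω - R i *
      (f i (((√(p i : ℝ))⁻¹ • R i)ᵀ * ((√(p i : ℝ))⁻¹ • Rhat i ω)) :
        Matrix (Fin m) (Fin m) ℝ)) ^ 2 / (p i : ℝ)| := hbad
    by_contra hnot
    have hle : frobeniusNorm (((√(p i : ℝ))⁻¹ • Rhat i ω) * ((√(p i : ℝ))⁻¹ • Rhat i ω)ᵀ -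
          ((√(p i : ℝ))⁻¹ • R i) * ((√(p i : ℝ))⁻¹ • R i)ᵀ) ^ 2 ≤ L * x i := by
      refine (not_lt.1 hnot).trans (le_of_eq ?_)
      have : (√(x i)) ^ 2 = x i := Real.sq_sqrt hxi.le
      rw [hL, show 4 * (2 * K / ε * √(x i)) / c₀ = 4 * (2 * K / ε) / c₀ * √(x i) by ring,
        mul_pow, this]
      ring
    have h3 := hf i _ _ hRi hω
    rw [if_pos hai] at h3
    set O : Matrix (Fin m) (Fin m) ℝ :=
      (f i (((√(p i : ℝ))⁻¹ • R i)ᵀ * ((√(p i : ℝ))⁻¹ • Rhat i ω)) : Matrix (Fin m) (Fin m) ℝ)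
      with hO
    have e2 : frobeniusNorm ((√(p i : ℝ))⁻¹ • Rhat i ω - (√(p i : ℝ))⁻¹ • R i * O) ^ 2 =
        frobeniusNorm (Rhat i ω - R i * O) ^ 2 / (p i : ℝ) := by
      rw [Matrix.smul_mul, ← smul_sub, frobeniusNorm_smul, mul_pow, sq_abs, inv_pow,
        Real.sq_sqrt hp'.le, inv_mul_eq_div]
    rw [e2] at h3
    rw [abs_of_pos hai, abs_of_nonneg (div_nonneg (sq_nonneg _) hp'.le)] at hbad'
    have h4 : (4 * (m : ℝ) + 1) * frobeniusNorm (((√(p i : ℝ))⁻¹ • Rhat i ω) *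
        ((√(p i : ℝ))⁻¹ • Rhat i ω)ᵀ -
          ((√(p i : ℝ))⁻¹ • R i) * ((√(p i : ℝ))⁻¹ • R i)ᵀ) ^ 2 ≤ (4 * m + 1) * (L * a i) := by
      have : L * x i ≤ L * a i := by gcongr
      gcongr
      exact hle.trans this
    linarith

/-! ### From the elliptical model to Gaussian matrices. -/

theorem hasLaw_ofLp_stdGaussianPi {κ Ω : Type*} [Fintype κ] [MeasurableSpace Ω] {P : Measure Ω}
    {Z : Ω → EuclideanSpace ℝ κ} (hZ : HasLaw Z (stdGaussian _) P) :
    HasLaw (fun ω => WithLp.ofLp (Z ω)) (stdGaussianPi κ) P where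
  aemeasurable := (WithLp.measurable_ofLp 2 _).comp_aemeasurable hZ.aemeasurable
  map_eq := by
    have h1 := AEMeasurable.map_map_of_aemeasurable (μ := P)
      (WithLp.measurable_ofLp 2 (κ → ℝ)).aemeasurable hZ.aemeasurable
    have h2 : (fun ω => WithLp.ofLp (Z ω)) = WithLp.ofLp ∘ Z := rfl
    rw [h2, ← h1, hZ.map_eq, ← map_pi_eq_stdGaussian,
      Measure.map_map (WithLp.measurable_ofLp 2 _) (by fun_prop)]
    exact Measure.map_id

theorem noiseMatrix_transpose {p q : ℕ} {κ : Type*} {D₁ : Matrix (Fin p) (Fin p) ℝ}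
    {D₂ : Matrix (Fin q) (Fin q) ℝ} (h₁ : D₁ᵀ = D₁) (h₂ : D₂ᵀ = D₂) (f : Fin p × Fin q → κ)
    (z : κ → ℝ) : (noiseMatrix D₁ D₂ f z)ᵀ = noiseMatrix D₂ D₁ (fun a => f a.swap) z := by
  rw [noiseMatrix, noiseMatrix, Matrix.transpose_smul, Matrix.transpose_mul, Matrix.transpose_mul,
    h₁, h₂, mul_comm (p : ℝ), Matrix.mul_assoc]
  rfl

namespace MatrixEllipticalFactorModel

variable {Ω : Type*} [MeasurableSpace Ω] {P : Measure Ω} {p q p₀ q₀ T : ℕ}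

theorem ae_exists_X_eq (M : MatrixEllipticalFactorModel P p q p₀ q₀ T) (hp : 0 < p) (hq : 0 < q)
    (t : Fin T) : ∀ᵐ ω ∂P, ∃ s : ℝ, 0 < s ∧ M.X t ω =
      s • (((√(p : ℝ))⁻¹ • M.R) * (CFC.sqrt M.Sig₁ *
        (entryMatrix fun a => M.Z t ω (Sum.inl (a.2, a.1))) * CFC.sqrt M.Sig₂) *
        ((√(q : ℝ))⁻¹ • M.C)ᵀ +
      noiseMatrix (CFC.sqrt M.Om₁) (CFC.sqrt M.Om₂) (fun a => Sum.inr (a.2, a.1))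
        (WithLp.ofLp (M.Z t ω))) := by
  have hp' : (0 : ℝ) < p := by exact_mod_cast hp
  have hq' : (0 : ℝ) < q := by exact_mod_cast hq
  -- One coordinate of the noise block, viewed as a 1 × 1 determinant, is almost surely nonzero.
  have hZ0 : ∀ᵐ ω ∂P, M.Z t ω ≠ 0 := by
    have h := ae_det_entryMatrix_ne_zero (k := 1)
      (e := fun _ => (Sum.inr (⟨0, hq⟩, ⟨0, hp⟩) : (Fin q₀ × Fin p₀) ⊕ (Fin q × Fin p)))
      (fun a b _ => Subsingleton.elim a b)
    rw [← (hasLaw_ofLp_stdGaussianPi (M.hasLaw_Z t)).map_eq] at h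
    filter_upwards [ae_of_ae_map (hasLaw_ofLp_stdGaussianPi (M.hasLaw_Z t)).aemeasurable h]
      with ω hω h0
    simp [h0, entryMatrix] at hω
  filter_upwards [M.elliptical t, M.r_pos t, hZ0] with ω hω hr hZ
  have hs : 0 < M.r t ω * ‖M.Z t ω‖⁻¹ := mul_pos hr (inv_pos.2 (norm_pos_iff.2 hZ))
  set s := M.r t ω * ‖M.Z t ω‖⁻¹ with hsdef
  -- The factor √(pq) undoes the normalization of both loadings and of the noise matrix.
  refine ⟨s * √((p : ℝ) * q), by positivity, ?_⟩
  set W : Matrix (Fin p₀) (Fin q₀) ℝ := entryMatrix fun a => M.Z t ω (Sum.inl (a.2, a.1)) with hW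
  set G : Matrix (Fin p) (Fin q) ℝ := entryMatrix fun a => M.Z t ω (Sum.inr (a.2, a.1)) with hG
  have hWv : WithLp.ofLp (M.Z t ω) ∘ Sum.inl = vec W := rfl
  have hGv : WithLp.ofLp (M.Z t ω) ∘ Sum.inr = vec G := rfl
  rw [Matrix.mulVec_smul, smul_smul, ← hsdef, Matrix.fromBlocks_mulVec, hWv, hGv,
    Matrix.zero_mulVec, Matrix.zero_mulVec, add_zero, zero_add, Matrix.kronecker_mulVec_vec,
    Matrix.kronecker_mulVec_vec, sqrt_transpose, sqrt_transpose] at hω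
  have hF : M.F t ω = s • (CFC.sqrt M.Sig₁ * W * CFC.sqrt M.Sig₂) := by
    rw [← Matrix.vec_inj]
    funext a
    simpa using congrFun hω (Sum.inl a)
  have hE : M.E t ω = s • (CFC.sqrt M.Om₁ * G * CFC.sqrt M.Om₂) := by
    rw [← Matrix.vec_inj]
    funext a
    simpa using congrFun hω (Sum.inr a)
  have hsp : √(p : ℝ) ≠ 0 := (Real.sqrt_pos.2 hp').ne'
  have hsq : √(q : ℝ) ≠ 0 := (Real.sqrt_pos.2 hq').ne'
  have hN : noiseMatrix (CFC.sqrt M.Om₁) (CFC.sqrt M.Om₂) (fun a => Sum.inr (a.2, a.1))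
      (WithLp.ofLp (M.Z t ω)) = (√((p : ℝ) * q))⁻¹ • (CFC.sqrt M.Om₁ * G * CFC.sqrt M.Om₂) := rfl
  rw [X, hF, hE, hN, smul_add, smul_smul, mul_assoc s, Real.sqrt_mul hp'.le,
    mul_inv_cancel₀ (mul_ne_zero hsp hsq), mul_one]
  congr 1
  rw [Matrix.transpose_smul, Matrix.smul_mul, Matrix.smul_mul, Matrix.mul_smul, Matrix.mul_smul,
    Matrix.smul_mul, smul_smul, smul_smul]
  congr 1
  field_simp

theorem iIndepFun_X (M : MatrixEllipticalFactorModel P p q p₀ q₀ T) :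
    iIndepFun (fun t ω (a : Fin p × Fin q) => M.X t ω a.1 a.2) P :=
  M.indep_obs.comp (fun _ (w : Fin q × Fin p → ℝ) (a : Fin p × Fin q) => w a.swap)
    fun _ => by fun_prop

theorem iIndepFun_X_transpose (M : MatrixEllipticalFactorModel P p q p₀ q₀ T) :
    iIndepFun (fun t ω (a : Fin q × Fin p) => (M.X t ω)ᵀ a.1 a.2) P :=
  M.indep_obs

end MatrixEllipticalFactorModel

theorem tendsto_natCast_rpow_neg_half {ι : Type*} {l : Filter ι} {p : ι → ℕ}
    (hp : Tendsto p l atTop) : Tendsto (fun i => (p i : ℝ) ^ (-(1 / 2) : ℝ)) l (nhds 0) :=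
  (tendsto_rpow_neg_atTop (by norm_num)).comp (tendsto_natCast_atTop_atTop.comp hp)

/-- Consistency of one side of the estimator along a family of factor models. -/
theorem exists_rotation_of_factor_model {m n k : ℕ} (hm : 0 < m) (hn : 0 < n) (hk : k = min m n)
    {ι : Type*} {l : Filter ι} {p q T : ι → ℕ} (hp : Tendsto p l atTop) (hq : Tendsto q l atTop)
    (hT : Tendsto T l atTop) {Ω : ι → Type*} [∀ i, MeasurableSpace (Ω i)]
    (P : ∀ i, Measure (Ω i)) [∀ i, IsProbabilityMeasure (P i)]
    {κ : ι → Type} [∀ i, Fintype (κ i)] {e : ∀ i, Fin m × Fin n → κ i}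
    {f : ∀ i, Fin (p i) × Fin (q i) → κ i} (he : ∀ i, Function.Injective (e i))
    (hf : ∀ i, Function.Injective (f i))
    (R : ∀ i, Matrix (Fin (p i)) (Fin m) ℝ) (V : ∀ i, Matrix (Fin (q i)) (Fin n) ℝ)
    (hR : ∀ᶠ i in l, ((√(p i : ℝ))⁻¹ • R i)ᵀ * ((√(p i : ℝ))⁻¹ • R i) = 1)
    (hV : ∀ᶠ i in l, (V i)ᵀ * V i = 1)
    {S₁ : ι → Matrix (Fin m) (Fin m) ℝ} {S₂ : ι → Matrix (Fin n) (Fin n) ℝ}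
    {O₁ : ∀ i, Matrix (Fin (p i)) (Fin (p i)) ℝ} {O₂ : ∀ i, Matrix (Fin (q i)) (Fin (q i)) ℝ}
    (pS₁ : ∀ i, (S₁ i).PosDef) (pS₂ : ∀ i, (S₂ i).PosDef) (pO₁ : ∀ i, (O₁ i).PosDef)
    (pO₂ : ∀ i, (O₂ i).PosDef)
    {c₁ C₁ c₂ C₂ : ℝ} (hc₁ : 0 < c₁) (hC₁ : 0 ≤ C₁) (hC₂ : 0 ≤ C₂)
    (hS₁ : ∀ᶠ i in l, EigenvaluesBetween (S₁ i) c₁ C₁)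
    (hS₂ : ∀ᶠ i in l, EigenvaluesBetween (S₂ i) c₁ C₁)
    (hO₁ : ∀ᶠ i in l, EigenvaluesBetween (O₁ i) c₂ C₂)
    (hO₂ : ∀ᶠ i in l, EigenvaluesBetween (O₂ i) c₂ C₂)
    {Z : ∀ i, Fin (T i) → Ω i → κ i → ℝ}
    {X : ∀ i, Fin (T i) → Ω i → Matrix (Fin (p i)) (Fin (q i)) ℝ}
    (hZ : ∀ i t, HasLaw (Z i t) (stdGaussianPi (κ i)) (P i))
    (hX : ∀ i, 0 < p i → 0 < q i → ∀ t, ∀ᵐ ω ∂P i, ∃ s : ℝ, 0 < s ∧ X i t ω =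
      s • (((√(p i : ℝ))⁻¹ • R i) * (CFC.sqrt (S₁ i) * (entryMatrix fun a => Z i t ω (e i a)) *
        CFC.sqrt (S₂ i)) * (V i)ᵀ +
        noiseMatrix (CFC.sqrt (O₁ i)) (CFC.sqrt (O₂ i)) (f i) (Z i t ω)))
    (hXi : ∀ i, iIndepFun (fun t ω (a : Fin (p i) × Fin (q i)) => X i t ω a.1 a.2) (P i))
    (Rhat : ∀ i, Ω i → Matrix (Fin (p i)) (Fin m) ℝ)
    (hRhat : ∀ᶠ i in l, ∀ᵐ ω ∂P i, ∃ Rt : Fin (T i) → Matrix (Fin (p i)) (Fin k) ℝ,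
      (∀ t, IsLeadingEigenvectors (X i t ω * (X i t ω)ᵀ) (Rt t)) ∧
        IsLeadingEigenvectors ((T i : ℝ)⁻¹ • ∑ t, Rt t * (Rt t)ᵀ)
          ((√(p i : ℝ))⁻¹ • Rhat i ω)) :
    ∃ H : ∀ i, Ω i → Matrix.orthogonalGroup (Fin m) ℝ,
      (∀ i, (∀ b c, Measurable fun ω => Rhat i ω b c) →
        ∀ b c, Measurable fun ω => (H i ω : Matrix (Fin m) (Fin m) ℝ) b c) ∧
      IsBigOInProb l P (fun i ω => frobeniusNorm
        (Rhat i ω - R i * (H i ω : Matrix (Fin m) (Fin m) ℝ)) ^ 2 / (p i : ℝ))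
        (fun i => (T i : ℝ)⁻¹ + (p i : ℝ) ^ (-(1 / 2) : ℝ) + (q i : ℝ) ^ (-(1 / 2) : ℝ)) := by
  obtain ⟨K, hK, c₀, hc₀, x₀, hx₀, hmain⟩ := exists_measure_subspace_distance_le hm hn hk
    (c := √c₁) (b := √C₁) (d := √C₂) (Real.sqrt_pos.2 hc₁) (Real.sqrt_nonneg _)
  have hp0 : ∀ᶠ i in l, 0 < p i := hp.eventually_gt_atTop 0
  have hq0 : ∀ᶠ i in l, 0 < q i := hq.eventually_gt_atTop 0
  have hx : Tendsto (fun i => √((p i : ℝ) + q i) / √((p i : ℝ) * q i)) l (nhds 0) := by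
    have h := (tendsto_natCast_rpow_neg_half hp).add (tendsto_natCast_rpow_neg_half hq)
    rw [add_zero] at h
    refine tendsto_of_tendsto_of_tendsto_of_le_of_le' tendsto_const_nhds h
      (Eventually.of_forall fun i => by positivity) ?_
    filter_upwards [hp0, hq0] with i h1 h2 using sqrt_add_div_sqrt_mul_le h1 h2
  refine exists_rotation_isBigOInProb (x := fun i => √((p i : ℝ) + q i) / √((p i : ℝ) * q i))
    hp0 hT ?_ hx ?_ P R Rhat hR ?_ hK hc₀ ?_
  · filter_upwards [hp0, hq0] with i h1 h2
    have h1' : (0 : ℝ) < p i := by exact_mod_cast h1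
    have h2' : (0 : ℝ) < q i := by exact_mod_cast h2
    positivity
  -- The distance bound has rate x; adding T⁻¹ only enlarges the stated rate.
  · filter_upwards [hp0, hq0] with i h1 h2
    have := sqrt_add_div_sqrt_mul_le h1 h2
    have : (0 : ℝ) ≤ (T i : ℝ)⁻¹ := by positivity
    linarith
  · filter_upwards [hRhat] with i hi
    filter_upwards [hi] with ω ⟨_, _, h⟩
    exact h.transpose_mul_self
  · filter_upwards [hp0, hq0, hT.eventually_gt_atTop 0, hx.eventually_le_const hx₀, hR, hV, hS₁,
      hS₂, hO₁, hO₂, hRhat] with i h1 h2 h3 h4 h5 h6 h7 h8 h9 h10 h11 η hη hηc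
    exact hmain h1 h2 h3 h4 (he i) (hf i) h5 h6 (sqrt_transpose _) (sqrt_transpose _)
      (le_sqrt_mulVec_dotProduct_self (pS₁ i).posSemidef hc₁ fun x => (h7.dotProduct_mulVec x).1)
      (le_sqrt_mulVec_dotProduct_self (pS₂ i).posSemidef hc₁ fun x => (h8.dotProduct_mulVec x).1)
      (opNorm_sqrt_le (pS₁ i).posSemidef hC₁ fun x => (h7.dotProduct_mulVec x).2)
      (opNorm_sqrt_le (pS₂ i).posSemidef hC₁ fun x => (h8.dotProduct_mulVec x).2)
      (opNorm_sqrt_le (pO₁ i).posSemidef hC₂ fun x => (h9.dotProduct_mulVec x).2)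
      (opNorm_sqrt_le (pO₂ i).posSemidef hC₂ fun x => (h10.dotProduct_mulVec x).2)
      (hZ i) (hX i h1 h2) (hXi i) h11 hη hηc

theorem normalized_transpose_mul_self {p m : ℕ} {R : Matrix (Fin p) (Fin m) ℝ}
    (h : (p : ℝ)⁻¹ • (Rᵀ * R) = 1) : ((√(p : ℝ))⁻¹ • R)ᵀ * ((√(p : ℝ))⁻¹ • R) = 1 := by
  rw [← h, Matrix.transpose_smul, Matrix.smul_mul, Matrix.mul_smul, smul_smul, ← mul_inv,
    Real.mul_self_sqrt (by positivity)]

end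

/-! ### Both sides of the estimator. -/

theorem mainTheorem1
    -- numbers of factors, fixed
    (p₀ q₀ : ℕ) (hp₀ : 0 < p₀) (hq₀ : 0 < q₀)
    -- a family of models, indexed by `i` and considered along `l`, where `T, p, q → ∞`
    {ι : Type*} (l : Filter ι) (p q T : ι → ℕ)
    (hp : Tendsto p l atTop) (hq : Tendsto q l atTop) (hT : Tendsto T l atTop)
    {Ω : ι → Type*} [∀ i, MeasurableSpace (Ω i)]
    (P : ∀ i, Measure (Ω i)) [∀ i, IsProbabilityMeasure (P i)]
    (M : ∀ i, MatrixEllipticalFactorModel (P i) (p i) (q i) p₀ q₀ (T i))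
    (hr : ∀ t : ℕ, IsBigOInProb l P (fun i => (M i).scaledRadius t) (fun _ => 1))
    (c₁ C₁ c₂ C₂ : ℝ) (hc₁ : 0 < c₁) (hC₁ : 0 < C₁) (hc₂ : 0 < c₂) (hC₂ : 0 < C₂)
    (hB : ∀ᶠ i in l, (M i).StrongFactors c₁ C₁)
    (hC : ∀ᶠ i in l, (M i).RegularNoise c₂ C₂)
    -- the estimators, computed from the observations
    (Rhat : ∀ i, Ω i → Matrix (Fin (p i)) (Fin p₀) ℝ)
    (Chat : ∀ i, Ω i → Matrix (Fin (q i)) (Fin q₀) ℝ)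
    (hest : ∀ᶠ i in l, ∀ᵐ ω ∂(P i),
      IsMPCAop (fun t => (M i).X t ω) (Rhat i ω) (Chat i ω)) :
    ∃ (HR : ∀ i, Ω i → Matrix.orthogonalGroup (Fin p₀) ℝ)
      (HC : ∀ i, Ω i → Matrix.orthogonalGroup (Fin q₀) ℝ),
      -- the rotations are random matrices whenever the estimators are
      (∀ i, (∀ a b, Measurable fun ω => Rhat i ω a b) →
        ∀ a b, Measurable fun ω => (HR i ω : Matrix (Fin p₀) (Fin p₀) ℝ) a b) ∧
      (∀ i, (∀ a b, Measurable fun ω => Chat i ω a b) →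
        ∀ a b, Measurable fun ω => (HC i ω : Matrix (Fin q₀) (Fin q₀) ℝ) a b) ∧
      IsBigOInProb l P
        (fun i ω => frobeniusNorm
          (Rhat i ω - (M i).R * (HR i ω : Matrix (Fin p₀) (Fin p₀) ℝ)) ^ 2 / (p i : ℝ))
        (fun i => (T i : ℝ)⁻¹ + (p i : ℝ) ^ (-(1 / 2) : ℝ) + (q i : ℝ) ^ (-(1 / 2) : ℝ)) ∧
      IsBigOInProb l P
        (fun i ω => frobeniusNorm
          (Chat i ω - (M i).C * (HC i ω : Matrix (Fin q₀) (Fin q₀) ℝ)) ^ 2 / (q i : ℝ))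
        (fun i => (T i : ℝ)⁻¹ + (p i : ℝ) ^ (-(1 / 2) : ℝ) + (q i : ℝ) ^ (-(1 / 2) : ℝ)) := by
  have hR : ∀ᶠ i in l, ((√(p i : ℝ))⁻¹ • (M i).R)ᵀ * ((√(p i : ℝ))⁻¹ • (M i).R) = 1 :=
    hB.mono fun i h => normalized_transpose_mul_self h.1
  have hC' : ∀ᶠ i in l, ((√(q i : ℝ))⁻¹ • (M i).C)ᵀ * ((√(q i : ℝ))⁻¹ • (M i).C) = 1 :=
    hB.mono fun i h => normalized_transpose_mul_self h.2.1
  have hZ : ∀ i t, HasLaw (fun ω => WithLp.ofLp ((M i).Z t ω)) (stdGaussianPi _) (P i) :=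
    fun i t => hasLaw_ofLp_stdGaussianPi ((M i).hasLaw_Z t)
  obtain ⟨HR, hRm, hRO⟩ := exists_rotation_of_factor_model hp₀ hq₀ rfl hp hq hT P
    (e := fun i a => Sum.inl (a.2, a.1)) (f := fun i a => Sum.inr (a.2, a.1))
    (fun i a b h => by simpa [Prod.ext_iff, and_comm] using h)
    (fun i a b h => by simpa [Prod.ext_iff, and_comm] using h)
    (fun i => (M i).R) (fun i => (√(q i : ℝ))⁻¹ • (M i).C) hR hC'
    (fun i => (M i).posDef_Sig₁) (fun i => (M i).posDef_Sig₂) (fun i => (M i).posDef_Om₁)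
    (fun i => (M i).posDef_Om₂) hc₁ hC₁.le hC₂.le (hB.mono fun i h => h.2.2.1)
    (hB.mono fun i h => h.2.2.2) (hC.mono fun i h => h.1) (hC.mono fun i h => h.2) hZ
    (fun i hpi hqi t => (M i).ae_exists_X_eq hpi hqi t) (fun i => (M i).iIndepFun_X) Rhat
    (hest.mono fun i h => h.mono fun ω ⟨Rt, _, h1, _, h3, _⟩ => ⟨Rt, h1, h3⟩)
  have hXt : ∀ i, 0 < q i → 0 < p i → ∀ t, ∀ᵐ ω ∂P i, ∃ s : ℝ, 0 < s ∧ ((M i).X t ω)ᵀ =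
      s • (((√(q i : ℝ))⁻¹ • (M i).C) * (CFC.sqrt (M i).Sig₂ *
        (entryMatrix fun a => WithLp.ofLp ((M i).Z t ω) (Sum.inl a)) * CFC.sqrt (M i).Sig₁) *
        ((√(p i : ℝ))⁻¹ • (M i).R)ᵀ +
      noiseMatrix (CFC.sqrt (M i).Om₂) (CFC.sqrt (M i).Om₁) (fun a => Sum.inr a)
        (WithLp.ofLp ((M i).Z t ω))) := by
    intro i hqi hpi t
    filter_upwards [(M i).ae_exists_X_eq hpi hqi t] with ω ⟨s, hs, hω⟩
    refine ⟨s, hs, ?_⟩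
    rw [hω, Matrix.transpose_smul, Matrix.transpose_add,
      noiseMatrix_transpose (sqrt_transpose _) (sqrt_transpose _), Matrix.transpose_mul,
      Matrix.transpose_mul, Matrix.transpose_mul, Matrix.transpose_mul, sqrt_transpose,
      sqrt_transpose, Matrix.transpose_transpose]
    simp only [Matrix.mul_assoc]
    rfl
  -- Transposition exchanges the row and column roles, and the order (column, row) of the
  -- coordinates of Z_t becomes the natural one.
  obtain ⟨HC, hCm, hCO⟩ := exists_rotation_of_factor_model hq₀ hp₀ (min_comm p₀ q₀) hq hp hT P
    (e := fun i a => Sum.inl a) (f := fun i a => Sum.inr a)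
    (fun i => Sum.inl_injective) (fun i => Sum.inr_injective)
    (fun i => (M i).C) (fun i => (√(p i : ℝ))⁻¹ • (M i).R) hC' hR
    (fun i => (M i).posDef_Sig₂) (fun i => (M i).posDef_Sig₁) (fun i => (M i).posDef_Om₂)
    (fun i => (M i).posDef_Om₁) hc₁ hC₁.le hC₂.le (hB.mono fun i h => h.2.2.2)
    (hB.mono fun i h => h.2.2.1) (hC.mono fun i h => h.2) (hC.mono fun i h => h.1) hZ
    (X := fun i t ω => ((M i).X t ω)ᵀ)
    hXt (fun i => (M i).iIndepFun_X_transpose) Chat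
    (hest.mono fun i h => h.mono fun ω ⟨_, Ct, _, h2, _, h4⟩ => ⟨Ct, by simpa using h2, h4⟩)
  refine ⟨HR, HC, hRm, hCm, hRO, ?_⟩
  simpa only [add_right_comm] using hCO
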